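/- Let $n\ge 1$ and $\alpha\in(1/2,1)$. For $\varphi\in C_c^\infty(\mathbb R,\mathbb R^n)$ let $$D^\alpha\varphi(x)={}_{-\infty}D^\alpha_x\varphi(x)=\frac{d}{dx}\,\frac1{\Gamma(1-\alpha)}\int_{-\infty}^x (x-\xi)^{-\alpha}\varphi(\xi)\,d\xi ,$$ let $H^\alpha=H^\alpha(\mathbb R,\mathbb R^n)\subset L^2$ be the completion of $C_c^\infty(\mathbb R,\mathbb R^n)$ for the norm $\|u\|_\alpha=(\int|u|^2+\int|\omega|^{2\alpha}|\widehat u(\omega)|^2d\omega)^{1/2}$ (unitary Fourier transform, so that $\|u\|_\alpha^2=\|u\|_{L^2}^2+\|D^\alpha u\|_{L^2}^2$), and extend $D^\alpha$ to $H^\alpha$ as a closed operator in $L^2$. Let $L:\mathbb R\to\mathbb R^{n\times n}$ and $W\in C^1(\mathbb R\times\mathbb R^n,\mathbb R)$, write $\nabla W$ for the gradient in the second variable, and put $$X^\alpha=\Bigl\{u\in H^\alpha:\ \int_{\mathbb R}(L(t)u,u)\,dt<\infty\Bigr\},\qquad \|u\|_{X^\alpha}^2=\int_{\mathbb R}\bigl[|D^\alpha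 u|^2+(L(t)u,u)\bigr]dt .$$ Assume the following. * $(\mathcal L)_1$ $L$ is continuous and $L(t)$ is symmetric for all $t$; there are a continuous $l:\mathbb R\to[0,\infty)$ and $c>0$ with $(L(t)x,x)\ge l(t)|x|^2$ for all $t\in\mathbb R$, $x\in\mathbb R^n$, and the set $\{l<c\}$ is nonempty with $\operatorname{meas}\{l<c\}<1/C_\infty^2$, where $C_\infty$ is the best constant in $\|u\|_\infty\le C\|u\|_{X^\alpha}$ $(u\in X^\alpha)$ or the best constant in $\|u\|_\infty\le C\|u\|_\alpha$ $(u\in H^\alpha)$; it suffices that the inequality holds for one of the two. * $(\mathcal L)_2$ $J=\operatorname{int}(l^{-1}(0))$ is a nonempty finite interval and $\overline J=l^{-1}(0)$. * $(\mathcal L)_3$ There is a nonempty open interval $T\subset J$ with $L(t)=0$ for all $t\in\overline T$. * $(W_1)$ $|\nabla W(t,x)|=o(|x|)$ as $|x|\to0$, uniformly in $t\in\mathbb R$. * $(W_2)$ $W(t,x)\ge0$ and $H(t,x):=\frac12(\nabla W(t,x),x)-W(t,x)\ge0$ for all $(t,x)\in\mathbb R\times\mathbb R^n$. * $(W_3)$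 $W(t,x)/|x|^2\to+\infty$ as $|x|\to\infty$, uniformly in $t\in\mathbb R$. * $(W_4)$ There are $C_0,R>0$ and $\sigma>1$ such that $|\nabla W(t,x)|^\sigma/|x|^\sigma\le C_0H(t,x)$ for all $t\in\mathbb R$ and all $|x|\ge R$. Then there is $\Lambda_*>0$ such that for every $\lambda>\Lambda_*$ the fractional Hamiltonian system $$-{}_tD^\alpha_\infty({}_{-\infty}D^\alpha_t u)-\lambda L(t)u+\nabla W(t,u)=0,\qquad u\in H^\alpha(\mathbb R,\mathbb R^n),$$ has at least one nontrivial (weak) solution: there is $u\in X^\alpha$, $u\neq0$, such that for every $w\in X^\alpha$ $$\int_{\mathbb R}\bigl[(D^\alpha u,D^\alpha w)+\lambda(L(t)u,w)-(\nabla W(t,u),w)\bigr]dt=0 .$$ -/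

import Mathlib

open MeasureTheory Filter Topology
open scoped ENNReal FourierTransform

noncomputable section

namespace FracHam

/-- `ℝⁿ` with its Euclidean norm. -/
abbrev Vec (n : ℕ) : Type := EuclideanSpace ℝ (Fin n)

/-- The left Liouville-Weyl fractional integral
`(₋∞I^β u)(x) = Γ(β)⁻¹ ∫_{-∞}^x (x - ξ)^(β-1) u(ξ) dξ`. -/
def leftIntegral {n : ℕ} (β : ℝ) (u : ℝ → Vec n) (x : ℝ) : Vec n :=
  (Real.Gamma β)⁻¹ • ∫ ξ in Set.Iio x, (x - ξ) ^ (β - 1) • u ξ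

/-- The left Liouville-Weyl fractional derivative `₋∞D^α u = d/dx (₋∞I^(1-α) u)`
(used below only for test functions `u`). -/
def leftDeriv {n : ℕ} (α : ℝ) (u : ℝ → Vec n) (x : ℝ) : Vec n :=
  deriv (leftIntegral (1 - α) u) x

/-- `C_c^∞(ℝ, ℝⁿ)`. -/
def IsTest {n : ℕ} (φ : ℝ → Vec n) : Prop :=
  ContDiff ℝ ((⊤ : ℕ∞) : WithTop ℕ∞) φ ∧ HasCompactSupport φ

/-- `∫ |ω|^(2α) |û(ω)|² dω` for a test function, with the unitary Fourier transform in the angular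
frequency `ω = 2πξ`, written in the variable `ξ`. -/
def fracEnergy {n : ℕ} (α : ℝ) (φ : ℝ → Vec n) : ℝ :=
  ∫ ξ : ℝ, |2 * Real.pi * ξ| ^ (2 * α) * ∑ i : Fin n, ‖𝓕 (fun t : ℝ => (φ t i : ℂ)) ξ‖ ^ 2

/-- Membership in `H^α(ℝ, ℝⁿ)`, the completion (realised in `L²`) of `C_c^∞` for the norm
`(∫ |u|² + ∫ |ω|^(2α) |û|²)^(1/2)`: `u` is the `L²` limit of a sequence of test functions that is
Cauchy for this norm. -/
def MemH {n : ℕ} (α : ℝ) (u : ℝ → Vec n) : Prop :=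
  MemLp u 2 volume ∧ ∃ φ : ℕ → ℝ → Vec n, (∀ k, IsTest (φ k)) ∧
    Tendsto (fun k => eLpNorm (φ k - u) 2 volume) atTop (𝓝 0) ∧
    ∀ ε > 0, ∃ N, ∀ j ≥ N, ∀ k ≥ N, fracEnergy α (φ j - φ k) < ε

/-- `v = ₋∞D^α u` in `L²`, where `₋∞D^α` is extended from `C_c^∞` by closing its graph in
`L² × L²`. -/
def HasLeftDeriv {n : ℕ} (α : ℝ) (u v : ℝ → Vec n) : Prop :=
  MemLp u 2 volume ∧ MemLp v 2 volume ∧ ∃ φ : ℕ → ℝ → Vec n, (∀ k, IsTest (φ k)) ∧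
    Tendsto (fun k => eLpNorm (φ k - u) 2 volume) atTop (𝓝 0) ∧
    Tendsto (fun k => eLpNorm (leftDeriv α (φ k) - v) 2 volume) atTop (𝓝 0)

/-- The quadratic form `(L(t)x, y)`. -/
def form {n : ℕ} (L : ℝ → Matrix (Fin n) (Fin n) ℝ) (t : ℝ) (x y : Vec n) : ℝ :=
  inner ℝ ((L t).toEuclideanLin x) y

/-- `u ∈ X^α` with `v = ₋∞D^α u`. Here `v` is square integrable, so that the only further
requirement is `∫ (L(t)u, u) dt < ∞`. -/
def MemX {n : ℕ} (α : ℝ) (L : ℝ → Matrix (Fin n) (Fin n) ℝ) (u v : ℝ → Vec n) : Prop :=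
  MemH α u ∧ HasLeftDeriv α u v ∧ Integrable (fun t => form L t (u t) (u t)) volume

/-- The best constant `C` in `‖u‖_∞ ≤ C ‖u‖_{X^α}`, where
`‖u‖²_{X^α} = ∫ |₋∞D^α u|² + (L u, u)`; it is `∞` if there is no finite one. -/
def bestConstX {n : ℕ} (α : ℝ) (L : ℝ → Matrix (Fin n) (Fin n) ℝ) : ℝ≥0∞ :=
  sInf {C : ℝ≥0∞ | ∀ u v : ℝ → Vec n, MemX α L u v →
    eLpNorm u ∞ volume ≤
      C * ENNReal.ofReal (Real.sqrt (∫ t, (‖v t‖ ^ 2 + form L t (u t) (u t))))}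

/-- The best constant `C` in `‖u‖_∞ ≤ C ‖u‖_α`, where `‖u‖²_α = ∫ |u|² + |₋∞D^α u|²`. -/
def bestConstH (n : ℕ) (α : ℝ) : ℝ≥0∞ :=
  sInf {C : ℝ≥0∞ | ∀ u v : ℝ → Vec n, MemH α u → HasLeftDeriv α u v →
    eLpNorm u ∞ volume ≤
      C * ENNReal.ofReal (Real.sqrt (∫ t, (‖u t‖ ^ 2 + ‖v t‖ ^ 2)))}

/-- `L` is continuous and symmetric, `(L(t)x, x) ≥ l(t)|x|²` with `l ≥ 0` continuous, and the set
`{l < c}` is nonempty of measure less than `1 / C_∞²`, for one of the two Sobolev constants (for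
the embedding of `X^α` or of `H^α` in `L^∞`). -/
structure CondL1 {n : ℕ} (α : ℝ) (L : ℝ → Matrix (Fin n) (Fin n) ℝ) (l : ℝ → ℝ) (c : ℝ) :
    Prop where
  continuous_L : Continuous L
  symm : ∀ t, (L t).IsSymm
  continuous_l : Continuous l
  nonneg : ∀ t, 0 ≤ l t
  lower : ∀ t (x : Vec n), l t * ‖x‖ ^ 2 ≤ form L t x x
  c_pos : 0 < c
  nonempty : {t | l t < c}.Nonempty
  small : volume {t | l t < c} < (bestConstX α L ^ 2)⁻¹ ∨
    volume {t | l t < c} < (bestConstH n α ^ 2)⁻¹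

/-- `J = int l⁻¹(0)` is a nonempty finite interval and its closure is `l⁻¹(0)`. -/
def CondL2 (l : ℝ → ℝ) : Prop :=
  (∃ a b : ℝ, a < b ∧ interior (l ⁻¹' {0}) = Set.Ioo a b) ∧
    closure (interior (l ⁻¹' {0})) = l ⁻¹' {0}

/-- There is a (nonempty) open interval `T ⊆ J` with `L = 0` on the closure of `T`. -/
def CondL3 {n : ℕ} (L : ℝ → Matrix (Fin n) (Fin n) ℝ) (l : ℝ → ℝ) : Prop :=
  ∃ a b : ℝ, a < b ∧ Set.Ioo a b ⊆ interior (l ⁻¹' {0}) ∧ ∀ t ∈ closure (Set.Ioo a b), L t = 0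

/-- `∇W(t,x)`, the gradient in `x`. -/
def grad {n : ℕ} (W : ℝ → Vec n → ℝ) (t : ℝ) (x : Vec n) : Vec n :=
  gradient (W t) x

/-- `H(t,x) = ½ (∇W(t,x), x) - W(t,x)`. -/
def hFun {n : ℕ} (W : ℝ → Vec n → ℝ) (t : ℝ) (x : Vec n) : ℝ :=
  (1 / 2) * inner ℝ (grad W t x) x - W t x

/-- `|∇W(t,x)| = o(|x|)` as `x → 0`, uniformly in `t`. -/
def CondW1 {n : ℕ} (W : ℝ → Vec n → ℝ) : Prop :=
  ∀ ε > 0, ∃ δ > 0, ∀ (t : ℝ) (x : Vec n), ‖x‖ < δ → ‖grad W t x‖ ≤ ε * ‖x‖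

/-- `W ≥ 0` and `H ≥ 0`. -/
def CondW2 {n : ℕ} (W : ℝ → Vec n → ℝ) : Prop :=
  (∀ t x, 0 ≤ W t x) ∧ ∀ t x, 0 ≤ hFun W t x

/-- `W(t,x)/|x|² → ∞` as `|x| → ∞`, uniformly in `t`. -/
def CondW3 {n : ℕ} (W : ℝ → Vec n → ℝ) : Prop :=
  ∀ M : ℝ, ∃ R > 0, ∀ (t : ℝ) (x : Vec n), R ≤ ‖x‖ → M ≤ W t x / ‖x‖ ^ 2

/-- `|∇W(t,x)|^σ / |x|^σ ≤ C₀ H(t,x)` for `|x| ≥ R`. -/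
def CondW4 {n : ℕ} (W : ℝ → Vec n → ℝ) : Prop :=
  ∃ C₀ > 0, ∃ R > 0, ∃ σ > (1 : ℝ), ∀ (t : ℝ) (x : Vec n), R ≤ ‖x‖ →
    ‖grad W t x‖ ^ σ / ‖x‖ ^ σ ≤ C₀ * hFun W t x

/-- `u ∈ X^α` is a (weak) solution of `ₜD^α_∞(₋∞D^α u) + λ L u = ∇W(t,u)`, that is
`∫ (₋∞D^α u, ₋∞D^α w) + λ (L u, w) - (∇W(t,u), w) = 0` for every `w ∈ X^α`. -/
def IsSolution {n : ℕ} (α : ℝ) (L : ℝ → Matrix (Fin n) (Fin n) ℝ) (W : ℝ → Vec n → ℝ) (lam : ℝ)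
    (u : ℝ → Vec n) : Prop :=
  ∃ v : ℝ → Vec n, MemX α L u v ∧ ∀ w z : ℝ → Vec n, MemX α L w z →
    Integrable (fun t => inner ℝ (grad W t (u t)) (w t)) volume ∧
    Integrable (fun t => inner ℝ (v t) (z t) + lam * form L t (u t) (w t)
      - inner ℝ (grad W t (u t)) (w t)) volume ∧
    ∫ t, (inner ℝ (v t) (z t) + lam * form L t (u t) (w t)
      - inner ℝ (grad W t (u t)) (w t)) = 0

end FracHam

end

/-! The solution is a limit of mountain pass points on finite dimensional spaces of test functions;
no Palais-Smale condition on `X^α` is needed.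

A bump `e` supported where `L = 0` has an energy that does not involve `λ`. Superquadraticity makes
the energy negative at a multiple of `e`, and its maximum `M` along the segment from `0` is bounded
independently of `λ`. On any finite dimensional space of test functions containing this multiple,
the set where the energy is nonnegative is bounded, so `exists_mountain_pass` gives a critical point
`φ` at a level in `[ρ/4, M]`. Testing with `φ` itself gives the Nehari identity `N = 2∫W + 2∫H`,
with `N = quad α L lam φ`, hence the level equals `∫H`.

Two estimates, uniform in the finite dimensional space, carry the argument for large `λ`. In
`exists_apriori`, (W₄) in the form `W ≤ (κH + K)|x|²` bounds `∫W` by a small multiple of `N` plus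
`K∫|φ|²`. Outside `{l < c}` the last term is `O(N/λ)`; on `{l < c}`, a set of finite measure, (W₃)
controls it by `∫W ≤ N/2`. In `exists_mass_bound`, a small mass on `{l < c}` would make `φ`
uniformly small by a scaled Sobolev inequality, and then (W₁) contradicts the Nehari identity
because `∫H > 0`.

Bounded energy gives a subsequence converging pointwise, with sup bounds and weakly convergent
derivatives (`exists_weak_limit`). Finite measure of `{l < c}` lets the mass bound survive, so the
limit `u` is nonzero. The equation holds against a countable family that is dense among test
functions, hence against every test function (`exists_test_solution`).

Passing to all `w ∈ X^α` is a separate matter, since `Lu` need not be in `L²`. Multiplication by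
`χ(t/m)` is bounded in `H^α` uniformly in `m ≥ 1` (`exists_energy_cutoff`), which permits a cutoff
argument (`integral_inner_add_eq_zero`). The analysis of `D^α` rests on `‖D^α φ‖² = ∫|ω|^(2α)|φ̂|²`,
obtained by damping the singular kernel with `exp(-εs)`, using Plancherel's theorem and letting `ε →
0`. -/

namespace FracHam

/-! ### Fourier transform of the damped Liouville-Weyl kernel -/

/-- Plancherel's theorem for continuous integrable functions with integrable transform. -/
theorem integral_norm_sq_fourier_eq {f : ℝ → ℂ} (hc : Continuous f) (hf : Integrable f)
    (hf' : Integrable (𝓕 f)) : ∫ x, ‖𝓕 f x‖ ^ 2 = ∫ x, ‖f x‖ ^ 2 := by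
  have h := VectorFourier.integral_sesq_fourierIntegral_eq_neg_flip (μ := volume) (ν := volume)
    (L := innerₗ ℝ) (e := Real.fourierChar) (innerSL ℂ) Real.continuous_fourierChar
    continuous_inner hf hf'
  have h2 : ∀ x, VectorFourier.fourierIntegral Real.fourierChar volume (-(innerₗ ℝ).flip)
      (𝓕 f) x = f x := by
    intro x
    have := congrFun (hc.fourierInv_fourier_eq hf hf') x
    rw [← this]
    simp only [Real.fourierInv_eq, VectorFourier.fourierIntegral]
    congr 1; ext v
    simp
  simp only [h2] at h
  change ∫ ξ, inner ℂ (𝓕 f ξ) (𝓕 f ξ) = ∫ x, inner ℂ (f x) (f x) at h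
  simp only [inner_self_eq_norm_sq_to_K] at h
  have h3 : ((∫ x, ‖𝓕 f x‖ ^ 2 : ℝ) : ℂ) = ((∫ x, ‖f x‖ ^ 2 : ℝ) : ℂ) := by
    rw [← integral_complex_ofReal, ← integral_complex_ofReal]
    simpa using h
  exact_mod_cast h3

/-- The damped Liouville-Weyl kernel `s₊^(-α) exp(-ε s)`. -/
noncomputable def kern (α ε : ℝ) (s : ℝ) : ℂ :=
  (Set.Ioi (0 : ℝ)).indicator (fun s => ((s ^ (-α) * Real.exp (-(ε * s)) : ℝ) : ℂ)) s

theorem integrableOn_rpow_mul_exp {a ε : ℝ} (ha : -1 < a) (hε : 0 < ε) :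
    IntegrableOn (fun s : ℝ => s ^ a * Real.exp (-(ε * s))) (Set.Ioi 0) := by
  have := integrableOn_rpow_mul_exp_neg_mul_rpow (p := 1) (s := a) (b := ε) ha one_pos hε
  simpa using this

theorem integrable_kern {α ε : ℝ} (hα : α < 1) (hε : 0 < ε) : Integrable (kern α ε) := by
  unfold kern
  rw [integrable_indicator_iff measurableSet_Ioi]
  exact (integrableOn_rpow_mul_exp (by linarith) hε).ofReal

theorem fourier_kern_zero {α ε : ℝ} (hα : α < 1) (hε : 0 < ε) :
    𝓕 (kern α ε) 0 = ((Real.Gamma (1 - α) * ε ^ (α - 1) : ℝ) : ℂ) := by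
  rw [Real.fourier_real_eq]
  simp only [mul_zero, neg_zero, AddChar.map_zero_eq_one, one_smul]
  unfold kern
  rw [integral_indicator measurableSet_Ioi, integral_complex_ofReal]
  have := Real.integral_rpow_mul_exp_neg_mul_Ioi (a := 1 - α) (r := ε) (by linarith) hε
  rw [show (1 - α - 1) = -α by ring] at this
  rw [this, one_div, Real.inv_rpow hε.le, ← Real.rpow_neg hε.le, neg_sub, mul_comm]

/-- Integration by parts for the damped kernel. -/
theorem kern_parts {α ε : ℝ} (hα : α < 1) (hε : 0 < ε) (ξ : ℝ) :
    (ε + 2 * Real.pi * Complex.I * ξ) * 𝓕 (fun s : ℝ => (s : ℂ) * kern α ε s) ξ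
      = (1 - α) * 𝓕 (kern α ε) ξ := by
  set r : ℂ := ε + 2 * Real.pi * Complex.I * ξ with hr
  have hF : ∀ g : ℝ → ℝ, 𝓕 (fun s => (Set.Ioi (0 : ℝ)).indicator
      (fun s => ((g s * Real.exp (-(ε * s)) : ℝ) : ℂ)) s) ξ
        = ∫ s in Set.Ioi (0 : ℝ), (g s : ℂ) * Complex.exp (-(r * s)) := by
    intro g
    rw [Real.fourier_real_eq_integral_exp_smul, ← integral_indicator measurableSet_Ioi]
    congr 1; ext s
    by_cases hs : s ∈ Set.Ioi (0 : ℝ)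
    · simp only [Set.indicator_of_mem hs, smul_eq_mul]
      push_cast
      rw [mul_left_comm, ← Complex.exp_add, hr]
      congr 2; ring
    · simp [Set.indicator_of_notMem hs]
  have e1 : (fun s : ℝ => (s : ℂ) * kern α ε s) = fun s => (Set.Ioi (0 : ℝ)).indicator
      (fun s => (((s ^ (1 - α)) * Real.exp (-(ε * s)) : ℝ) : ℂ)) s := by
    ext s
    unfold kern
    by_cases hs : s ∈ Set.Ioi (0 : ℝ)
    · simp only [Set.indicator_of_mem hs]
      rw [show (1 - α) = 1 + -α by ring, Real.rpow_add hs, Real.rpow_one]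
      push_cast; ring
    · simp [Set.indicator_of_notMem hs]
  rw [e1, hF (fun s => s ^ (1 - α))]
  have e2 : 𝓕 (kern α ε) ξ = ∫ s in Set.Ioi (0 : ℝ),
      ((s ^ (-α) : ℝ) : ℂ) * Complex.exp (-(r * s)) := hF (fun s => s ^ (-α))
  rw [e2]
  have hre : r.re = ε := by simp [hr]
  have hint : ∀ a : ℝ, -1 < a → IntegrableOn (fun s : ℝ => ((s ^ a : ℝ) : ℂ) *
      Complex.exp (-(r * s))) (Set.Ioi 0) := by
    intro a ha
    refine (integrableOn_rpow_mul_exp ha hε).mono' ?_ ?_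
    · apply Measurable.aestronglyMeasurable
      have : Measurable fun s : ℝ => s ^ a := by fun_prop
      fun_prop
    · refine (ae_restrict_iff' measurableSet_Ioi).2 (Eventually.of_forall fun s hs => ?_)
      rw [norm_mul, Complex.norm_exp, Complex.norm_real, Real.norm_of_nonneg
        (Real.rpow_nonneg (le_of_lt hs) _)]
      simp [hre]
  -- The primitive `s^(1-α) exp(-rs)` vanishes at `0` because `α < 1` and at infinity because `Re r
  -- = ε > 0`, so the integral of its derivative is zero.
  have key := integral_Ioi_of_hasDerivAt_of_tendsto (a := 0) (m := 0)
    (f := fun s : ℝ => ((s ^ (1 - α) : ℝ) : ℂ) * Complex.exp (-(r * s)))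
    (f' := fun s : ℝ => (1 - α) * (((s ^ (-α) : ℝ) : ℂ) * Complex.exp (-(r * s)))
      - r * (((s ^ (1 - α) : ℝ) : ℂ) * Complex.exp (-(r * s)))) ?_ ?_ ?_ ?_
  · rw [integral_sub ((hint (-α) (by linarith)).const_mul _)
      ((hint (1 - α) (by linarith)).const_mul _), integral_const_mul, integral_const_mul] at key
    rw [Real.zero_rpow (by linarith)] at key
    simp only [Complex.ofReal_zero, zero_mul, sub_zero] at key
    exact (sub_eq_zero.1 key).symm
  · have : Continuous fun s : ℝ => s ^ (1 - α) := by
      exact Real.continuous_rpow_const (by linarith)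
    exact Continuous.continuousWithinAt (by fun_prop)
  · intro s hs
    have h1 : HasDerivAt (fun s : ℝ => s ^ (1 - α)) ((1 - α) * s ^ (1 - α - 1)) s :=
      Real.hasDerivAt_rpow_const (Or.inl (ne_of_gt hs))
    have h2 : HasDerivAt (fun s : ℝ => Complex.exp (-(r * s)))
        (Complex.exp (-(r * s)) * (-(r * 1))) s := by
      exact (((hasDerivAt_id s).ofReal_comp.const_mul r).neg).cexp
    refine (h1.ofReal_comp.mul h2).congr_deriv ?_
    rw [show 1 - α - 1 = -α by ring]
    push_cast; ring
  · exact ((hint (-α) (by linarith)).const_mul _).sub ((hint (1 - α) (by linarith)).const_mul _)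
  · rw [tendsto_zero_iff_norm_tendsto_zero]
    have := tendsto_rpow_mul_exp_neg_mul_atTop_nhds_zero (1 - α) ε hε
    refine this.congr' ?_
    filter_upwards [eventually_gt_atTop 0] with s hs
    rw [norm_mul, Complex.norm_exp, Complex.norm_real, Real.norm_of_nonneg
        (Real.rpow_nonneg (le_of_lt hs) _)]
    simp [hre]

/-- Differentiating under the Fourier integral and applying `kern_parts` gives a first order linear
equation for the transform. Its product with `(ε + 2πiξ)^(1-α)` is therefore constant, and the value
at `ξ = 0` is a Gamma integral. -/
theorem fourier_kern {α ε : ℝ} (hα : α < 1) (hε : 0 < ε) (ξ : ℝ) :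
    𝓕 (kern α ε) ξ = Real.Gamma (1 - α) * (ε + 2 * Real.pi * Complex.I * ξ) ^ ((α - 1 : ℝ) : ℂ) := by
  have hslit : ∀ ξ : ℝ, (ε + 2 * Real.pi * Complex.I * ξ : ℂ) ∈ Complex.slitPlane := by
    intro ξ; left; simp [hε]
  have hne : ∀ ξ : ℝ, (ε + 2 * Real.pi * Complex.I * ξ : ℂ) ≠ 0 := fun ξ =>
    Complex.slitPlane_ne_zero (hslit ξ)
  have hxk : Integrable (fun s : ℝ => (s : ℂ) * kern α ε s) := by
    have e1 : (fun s : ℝ => (s : ℂ) * kern α ε s) = fun s => (Set.Ioi (0 : ℝ)).indicator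
      (fun s => (((s ^ (1 - α)) * Real.exp (-(ε * s)) : ℝ) : ℂ)) s := by
      ext s
      unfold kern
      by_cases hs : s ∈ Set.Ioi (0 : ℝ)
      · simp only [Set.indicator_of_mem hs]
        rw [show (1 - α) = 1 + -α by ring, Real.rpow_add hs, Real.rpow_one]
        push_cast; ring
      · simp [Set.indicator_of_notMem hs]
    rw [e1]
    exact (integrable_indicator_iff measurableSet_Ioi).2
      (integrableOn_rpow_mul_exp (by linarith) hε).ofReal
  have hd : ∀ ξ : ℝ, HasDerivAt (𝓕 (kern α ε))
      (-2 * Real.pi * Complex.I * 𝓕 (fun s : ℝ => (s : ℂ) * kern α ε s) ξ) ξ := by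
    intro ξ
    have := Real.hasDerivAt_fourier (integrable_kern hα hε) (by simpa using hxk) ξ
    refine this.congr_deriv ?_
    rw [Real.fourier_real_eq, Real.fourier_real_eq, ← integral_const_mul]
    congr 1; ext s
    simp only [Circle.smul_def, smul_eq_mul]; ring
  have hg : ∀ ξ : ℝ, HasDerivAt (fun ξ : ℝ => 𝓕 (kern α ε) ξ *
      (ε + 2 * Real.pi * Complex.I * ξ : ℂ) ^ ((1 - α : ℝ) : ℂ)) 0 ξ := by
    intro ξ
    have h1 : HasDerivAt (fun ξ : ℝ => (ε + 2 * Real.pi * Complex.I * ξ : ℂ))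
        (2 * Real.pi * Complex.I * 1) ξ :=
      ((hasDerivAt_id ξ).ofReal_comp.const_mul (2 * Real.pi * Complex.I)).const_add _
    have h2 := HasDerivAt.comp (𝕜' := ℂ) ξ
      ((hasDerivAt_id (ε + 2 * Real.pi * Complex.I * ξ : ℂ)).cpow_const (c := ((1 - α : ℝ) : ℂ))
        (hslit ξ)) h1
    refine ((hd ξ).mul h2).congr_deriv ?_
    simp only [id_eq, Function.comp]
    have hp := kern_parts hα hε ξ
    rw [Complex.cpow_sub _ _ (hne ξ), Complex.cpow_one]
    have := hne ξ
    field_simp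
    push_cast
    linear_combination (-2 * Real.pi * Complex.I * (ε + 2 * Real.pi * Complex.I * ξ : ℂ) ^ (1 - α : ℂ)) * hp
  have hconst := is_const_of_deriv_eq_zero (fun x => (hg x).differentiableAt)
    (fun x => (hg x).deriv) ξ 0
  have h0 : (ε + 2 * Real.pi * Complex.I * ((0 : ℝ) : ℂ) : ℂ) = (ε : ℂ) := by simp
  simp only [h0, fourier_kern_zero hα hε] at hconst
  rw [← Complex.ofReal_cpow hε.le, ← Complex.ofReal_mul, mul_assoc (Real.Gamma _), ← Real.rpow_add hε,
    show α - 1 + (1 - α) = 0 by ring, Real.rpow_zero, mul_one] at hconst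
  rw [← hconst, mul_assoc (𝓕 (kern α ε) ξ), ← Complex.cpow_add _ _ (hne ξ)]
  push_cast
  rw [show ((1 : ℂ) - α + (α - 1)) = 0 by ring, Complex.cpow_zero, mul_one]

theorem norm_fourier_kern {α ε : ℝ} (hα : α < 1) (hε : 0 < ε) (ξ : ℝ) :
    ‖𝓕 (kern α ε) ξ‖ = Real.Gamma (1 - α) * ‖(ε + 2 * Real.pi * Complex.I * ξ : ℂ)‖ ^ (α - 1) := by
  rw [fourier_kern hα hε, norm_mul, Complex.norm_real,
    Real.norm_of_nonneg (Real.Gamma_nonneg_of_nonneg (by linarith)), Complex.norm_cpow_real]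

end FracHam

/-! ### Convolution with the kernel and removal of the damping -/

namespace FracHam
open scoped Convolution ContDiff

theorem norm_kern {α ε : ℝ} (s : ℝ) : ‖kern α ε s‖ =
    (Set.Ioi (0 : ℝ)).indicator (fun s => s ^ (-α) * Real.exp (-(ε * s))) s := by
  unfold kern
  by_cases hs : s ∈ Set.Ioi (0 : ℝ)
  · have : 0 ≤ s ^ (-α) := Real.rpow_nonneg (le_of_lt hs) _
    simp only [Set.indicator_of_mem hs, Complex.norm_real]
    exact Real.norm_of_nonneg (by positivity)
  · simp [Set.indicator_of_notMem hs]

theorem norm_kern_le {α ε : ℝ} (hε : 0 ≤ ε) (s : ℝ) : ‖kern α ε s‖ ≤ ‖kern α 0 s‖ := by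
  rw [norm_kern, norm_kern]
  by_cases hs : s ∈ Set.Ioi (0 : ℝ)
  · simp only [Set.indicator_of_mem hs]
    have h1 : 0 ≤ s ^ (-α) := Real.rpow_nonneg (le_of_lt hs) _
    have h2 : 0 ≤ ε * s := mul_nonneg hε (le_of_lt hs)
    rw [zero_mul]
    gcongr
  · simp [Set.indicator_of_notMem hs]

theorem tendsto_kern {α : ℝ} (s : ℝ) :
    Tendsto (fun ε => kern α ε s) (𝓝[>] 0) (𝓝 (kern α 0 s)) := by
  have : Continuous fun ε => kern α ε s := by
    unfold kern
    by_cases hs : s ∈ Set.Ioi (0 : ℝ)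
    · simp only [Set.indicator_of_mem hs]; fun_prop
    · simp only [Set.indicator_of_notMem hs]; fun_prop
  exact (this.tendsto 0).mono_left nhdsWithin_le_nhds

theorem measurable_kern (α ε : ℝ) : Measurable (kern α ε) := by
  unfold kern
  refine Measurable.indicator ?_ measurableSet_Ioi
  fun_prop

theorem locallyIntegrable_kern {α : ℝ} (hα : α < 1) : LocallyIntegrable (kern α 0) := by
  rw [locallyIntegrable_iff]
  intro k hk
  obtain ⟨R, hR⟩ := hk.isBounded.subset_closedBall 0
  have : IntegrableOn (fun s => Real.exp (1 * R) * ‖kern α 1 s‖) k :=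
    (((integrable_kern hα one_pos).norm).const_mul _).integrableOn
  refine this.mono' (measurable_kern _ _).aestronglyMeasurable ?_
  refine (ae_restrict_iff' hk.measurableSet).2 (Eventually.of_forall fun s hs => ?_)
  rw [norm_kern, norm_kern]
  by_cases hs0 : s ∈ Set.Ioi (0 : ℝ)
  · have h1 : 0 ≤ s ^ (-α) := Real.rpow_nonneg (le_of_lt hs0) _
    simp only [Set.indicator_of_mem hs0, zero_mul, neg_zero, Real.exp_zero, mul_one, one_mul]
    have h2 : s ≤ R := by
      have := hR hs
      rw [Metric.mem_closedBall, dist_zero_right] at this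
      exact (le_abs_self _).trans this
    calc s ^ (-α) = s ^ (-α) * 1 := by ring
      _ ≤ s ^ (-α) * (Real.exp R * Real.exp (-s)) := by
        gcongr
        rw [← Real.exp_add]
        exact Real.one_le_exp (by linarith)
      _ = _ := by ring
  · simp [Set.indicator_of_notMem hs0]

section
variable {α : ℝ} {g : ℝ → ℂ}

/-- The absolute convolution with the Liouville-Weyl kernel is square integrable. -/
theorem integrable_abs_conv_sq (hα : 1 / 2 < α) (hα' : α < 1) (hg : Continuous g)
    (hc : HasCompactSupport g) :
    Integrable (fun x => (∫ s, ‖kern α 0 s‖ * ‖g (x - s)‖) ^ 2) := by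
  have hcont : Continuous fun x => ∫ s, ‖kern α 0 s‖ * ‖g (x - s)‖ :=
    hc.norm.continuous_convolution_right (ContinuousLinearMap.mul ℝ ℝ)
      (fun x => (locallyIntegrable_kern hα' x).norm) hg.norm
  obtain ⟨a, ha⟩ := hc.isCompact.isBounded.subset_closedBall 0
  have hsupp : ∀ y, a < |y| → g y = 0 := fun y hy => by
    refine image_eq_zero_of_notMem_tsupport fun h => ?_
    have := ha h
    rw [Metric.mem_closedBall, dist_zero_right, Real.norm_eq_abs] at this
    linarith
  have hgi : Integrable g := hg.integrable_of_hasCompactSupport hc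
  refine (hcont.pow 2).locallyIntegrable.integrable_of_isBigO_atBot_atTop
    (g := fun _ => (0 : ℝ)) (g' := fun x => x ^ (-(2 * α))) ?_ ?_ ?_ ?_
  · refine EventuallyEq.isBigO ?_
    filter_upwards [eventually_lt_atBot (-|a|)] with x hx
    rw [sq_eq_zero_iff]
    refine integral_eq_zero_of_ae (Eventually.of_forall fun s => ?_)
    by_cases hs : s ∈ Set.Ioi (0 : ℝ)
    · have : a < |x - s| := by
        have := neg_le_abs (x - s)
        have := le_abs_self a
        rw [Set.mem_Ioi] at hs
        linarith
      simp [hsupp _ this]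
    · simp [norm_kern, Set.indicator_of_notMem hs]
  · exact (integrable_zero _ _ _).integrableAtFilter _
  -- For `x > 2|a|` only `s ≥ x/2` meets the support of `g`, so the convolution is `O(x^(-α))`; its
  -- square is integrable because `2α > 1`.
  · refine Asymptotics.IsBigO.of_bound ((2 ^ α * ∫ x, ‖g x‖) ^ 2) ?_
    filter_upwards [eventually_gt_atTop (2 * |a|), eventually_gt_atTop 0] with x hx hx0
    have hb : ∫ s, ‖kern α 0 s‖ * ‖g (x - s)‖ ≤ ∫ s, (x / 2) ^ (-α) * ‖g (x - s)‖ := by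
      refine integral_mono_of_nonneg (Eventually.of_forall fun s => by positivity)
        (((hgi.comp_sub_left x).norm).const_mul _) (Eventually.of_forall fun s => ?_)
      dsimp only
      by_cases hs : a < |x - s|
      · simp [hsupp _ hs]
      · gcongr
        rw [norm_kern]
        have h1 : x / 2 ≤ s := by
          have := le_abs_self (x - s)
          have := le_abs_self a
          push Not at hs
          linarith
        have h2 : s ∈ Set.Ioi (0 : ℝ) := by rw [Set.mem_Ioi]; linarith
        simp only [Set.indicator_of_mem h2, zero_mul, neg_zero, Real.exp_zero, mul_one]
        exact Real.rpow_le_rpow_of_nonpos (by linarith) h1 (by linarith)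
    rw [integral_const_mul, integral_sub_left_eq_self (fun s => ‖g s‖)] at hb
    have h0 : 0 ≤ ∫ s, ‖kern α 0 s‖ * ‖g (x - s)‖ := by positivity
    rw [Real.norm_of_nonneg (by positivity), Real.norm_of_nonneg (by positivity)]
    calc _ ≤ ((x / 2) ^ (-α) * ∫ x, ‖g x‖) ^ 2 := by gcongr
      _ = _ := by
        rw [Real.div_rpow hx0.le zero_le_two, Real.rpow_neg zero_le_two, mul_pow, mul_pow,
          div_inv_eq_mul, mul_pow, ← Real.rpow_natCast (x ^ (-α)), ← Real.rpow_mul hx0.le]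
        have : -α * (2 : ℕ) = -(2 * α) := by push_cast; ring
        rw [this]; ring
  · exact integrableAtFilter_rpow_atTop_iff.2 (by linarith)

theorem conv_integrable (hα' : α < 1) (hg : Continuous g)
    (hc : HasCompactSupport g) (x : ℝ) : Integrable (fun s => ‖kern α 0 s‖ * ‖g (x - s)‖) :=
  hc.norm.convolutionExists_right (ContinuousLinearMap.mul ℝ ℝ)
      (fun x => (locallyIntegrable_kern hα' x).norm) hg.norm x

theorem norm_conv_le {ε : ℝ} (hε : 0 ≤ ε) (hα' : α < 1) (hg : Continuous g)
    (hc : HasCompactSupport g) (x : ℝ) :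
    ‖∫ s, kern α ε s * g (x - s)‖ ≤ ∫ s, ‖kern α 0 s‖ * ‖g (x - s)‖ := by
  refine norm_integral_le_of_norm_le (conv_integrable hα' hg hc x) (Eventually.of_forall fun s => ?_)
  rw [norm_mul]
  gcongr
  exact norm_kern_le hε s

theorem memLp_conv (hα : 1 / 2 < α) (hα' : α < 1) (hg : Continuous g)
    (hc : HasCompactSupport g) : MemLp (fun x => ∫ s, kern α 0 s * g (x - s)) 2 := by
  have hcont : Continuous fun x => ∫ s, kern α 0 s * g (x - s) :=
    hc.continuous_convolution_right (ContinuousLinearMap.mul ℝ ℂ)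
      (locallyIntegrable_kern hα') hg
  rw [memLp_two_iff_integrable_sq_norm hcont.aestronglyMeasurable]
  refine (integrable_abs_conv_sq hα hα' hg hc).mono' (hcont.norm.pow 2).aestronglyMeasurable
    (Eventually.of_forall fun x => ?_)
  rw [Real.norm_of_nonneg (by positivity)]
  gcongr
  exact norm_conv_le le_rfl hα' hg hc x

theorem tendsto_integral_conv_sq (hα : 1 / 2 < α) (hα' : α < 1) (hg : Continuous g)
    (hc : HasCompactSupport g) :
    Tendsto (fun ε => ∫ x, ‖∫ s, kern α ε s * g (x - s)‖ ^ 2) (𝓝[>] 0)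
      (𝓝 (∫ x, ‖∫ s, kern α 0 s * g (x - s)‖ ^ 2)) := by
  refine tendsto_integral_filter_of_dominated_convergence _ ?_ ?_
    (integrable_abs_conv_sq hα hα' hg hc) ?_
  · filter_upwards [self_mem_nhdsWithin] with ε hε
    have hcont : Continuous fun x => ∫ s, kern α ε s * g (x - s) :=
      hc.continuous_convolution_right (ContinuousLinearMap.mul ℝ ℂ)
        (integrable_kern hα' hε).locallyIntegrable hg
    exact (hcont.norm.pow 2).aestronglyMeasurable
  · filter_upwards [self_mem_nhdsWithin] with ε hε
    refine Eventually.of_forall fun x => ?_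
    rw [Real.norm_of_nonneg (by positivity)]
    gcongr
    exact norm_conv_le (le_of_lt hε) hα' hg hc x
  · refine Eventually.of_forall fun x => ?_
    refine (Tendsto.norm ?_).pow 2
    refine tendsto_integral_filter_of_dominated_convergence _ ?_ ?_ (conv_integrable hα' hg hc x) ?_
    · refine Eventually.of_forall fun ε => ?_
      exact ((measurable_kern α ε).mul (by fun_prop)).aestronglyMeasurable
    · filter_upwards [self_mem_nhdsWithin] with ε hε
      refine Eventually.of_forall fun s => ?_
      rw [norm_mul]
      gcongr
      exact norm_kern_le (le_of_lt hε) s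
    · exact Eventually.of_forall fun s => (tendsto_kern s).mul_const _

/-- For `ε > 0` the kernel is integrable, which is what the convolution theorem and Plancherel's
theorem require. -/
theorem integral_damped_conv_sq {ε : ℝ} (hε : 0 < ε) (hα' : α < 1) (hg : Continuous g)
    (hc : HasCompactSupport g) (hgF : Integrable (𝓕 g)) :
    ∫ x, ‖∫ s, kern α ε s * g (x - s)‖ ^ 2 =
      ∫ ξ : ℝ, (Real.Gamma (1 - α) * ‖(ε + 2 * Real.pi * Complex.I * ξ : ℂ)‖ ^ (α - 1) * ‖𝓕 g ξ‖) ^ 2 := by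
  have hcont : Continuous fun x => ∫ s, kern α ε s * g (x - s) :=
    hc.continuous_convolution_right (ContinuousLinearMap.mul ℝ ℂ)
      (integrable_kern hα' hε).locallyIntegrable hg
  have hgi := hg.integrable_of_hasCompactSupport (μ := volume) hc
  have hint : Integrable fun x => ∫ s, kern α ε s * g (x - s) :=
    (integrable_kern hα' hε).integrable_convolution (ContinuousLinearMap.mul ℝ ℂ) hgi
  have hF : ∀ ξ, 𝓕 (fun x => ∫ s, kern α ε s * g (x - s)) ξ = 𝓕 (kern α ε) ξ * 𝓕 g ξ := fun ξ =>
    Real.fourier_mul_convolution_eq (integrable_kern hα' hε) hgi ξ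
  have hcF : ∀ {f : ℝ → ℂ}, Integrable f → Continuous (𝓕 f) := fun hf =>
    VectorFourier.fourierIntegral_continuous Real.continuous_fourierChar
      (by exact continuous_inner) hf
  rw [← integral_norm_sq_fourier_eq hcont hint]
  · simp only [hF, norm_mul, norm_fourier_kern hα' hε]
  · simp only [funext hF]
    refine hgF.bdd_mul (c := ∫ x, ‖kern α ε x‖) (hcF (integrable_kern hα' hε)).aestronglyMeasurable
      (Eventually.of_forall fun ξ => ?_)
    exact VectorFourier.norm_fourierIntegral_le_integral_norm _ _ _ _ _

end

/-- The Fourier side of the fractional derivative of a smooth compactly supported function. -/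
theorem integral_conv_deriv_sq {α : ℝ} {f : ℝ → ℂ} (hα : 1 / 2 < α) (hα' : α < 1)
    (hf : ContDiff ℝ ∞ f) (hc : HasCompactSupport f) :
    Integrable (fun ξ : ℝ => |2 * Real.pi * ξ| ^ (2 * α) * ‖𝓕 f ξ‖ ^ 2) ∧
    ∫ x, ‖∫ s, kern α 0 s * deriv f (x - s)‖ ^ 2 =
      Real.Gamma (1 - α) ^ 2 * ∫ ξ : ℝ, |2 * Real.pi * ξ| ^ (2 * α) * ‖𝓕 f ξ‖ ^ 2 := by
  have hf' : ContDiff ℝ ∞ (deriv f) := by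
    apply ContDiff.deriv' ; simpa using hf
  have hc' : HasCompactSupport (deriv f) := hc.deriv
  have hFS : 𝓕 f = ⇑(𝓕 (hc.toSchwartzMap hf) : SchwartzMap ℝ ℂ) := rfl
  have hFS' : 𝓕 (deriv f) = ⇑(𝓕 (hc'.toSchwartzMap hf') : SchwartzMap ℝ ℂ) := rfl
  have hd : ∀ ξ : ℝ, ‖𝓕 (deriv f) ξ‖ = |2 * Real.pi * ξ| * ‖𝓕 f ξ‖ := by
    intro ξ
    rw [Real.fourier_deriv (hf.continuous.integrable_of_hasCompactSupport hc)
      (hf.differentiable (by simp)) (hf'.continuous.integrable_of_hasCompactSupport hc'), norm_smul]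
    simp [abs_mul]
  have hi1 : Integrable (fun ξ => ‖𝓕 f ξ‖ ^ 2) := by
    rw [hFS, ← memLp_two_iff_integrable_sq_norm (SchwartzMap.continuous _).aestronglyMeasurable]
    exact SchwartzMap.memLp _ 2 _
  have hi2 : Integrable (fun ξ => ‖𝓕 (deriv f) ξ‖ ^ 2) := by
    rw [hFS', ← memLp_two_iff_integrable_sq_norm (SchwartzMap.continuous _).aestronglyMeasurable]
    exact SchwartzMap.memLp _ 2 _
  have hcF : Continuous (𝓕 f) := by rw [hFS]; exact SchwartzMap.continuous _
  have hcont : Continuous fun ξ : ℝ => |2 * Real.pi * ξ| ^ (2 * α) * ‖𝓕 f ξ‖ ^ 2 := by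
    refine Continuous.mul (Continuous.rpow_const (by fun_prop) ?_) (by fun_prop)
    intro x; right; linarith
  have hi3 : Integrable (fun ξ : ℝ => |2 * Real.pi * ξ| ^ (2 * α) * ‖𝓕 f ξ‖ ^ 2) := by
    refine (hi1.add hi2).mono' hcont.aestronglyMeasurable (Eventually.of_forall fun ξ => ?_)
    rw [Real.norm_of_nonneg (by positivity), Pi.add_apply, hd, mul_pow]
    have : |2 * Real.pi * ξ| ^ (2 * α) ≤ 1 + |2 * Real.pi * ξ| ^ 2 := by
      rcases le_total |2 * Real.pi * ξ| 1 with h | h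
      · have := Real.rpow_le_one (abs_nonneg _) h (by linarith : 0 ≤ 2 * α)
        nlinarith [sq_nonneg |2 * Real.pi * ξ|]
      · have := Real.rpow_le_rpow_of_exponent_le h (by linarith : 2 * α ≤ 2)
        rw [Real.rpow_two] at this
        linarith
    nlinarith [sq_nonneg ‖𝓕 f ξ‖]
  refine ⟨hi3, ?_⟩
  have hl := tendsto_integral_conv_sq hα hα' hf'.continuous hc'
  have hr : Tendsto (fun ε => ∫ x, ‖∫ s, kern α ε s * deriv f (x - s)‖ ^ 2) (𝓝[>] 0)
      (𝓝 (∫ ξ : ℝ, Real.Gamma (1 - α) ^ 2 * (|2 * Real.pi * ξ| ^ (2 * α) * ‖𝓕 f ξ‖ ^ 2))) := by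
    have heq : (fun ε : ℝ => ∫ ξ : ℝ, (Real.Gamma (1 - α) *
        ‖(ε + 2 * Real.pi * Complex.I * ξ : ℂ)‖ ^ (α - 1) * ‖𝓕 (deriv f) ξ‖) ^ 2) =ᶠ[𝓝[>] 0]
        fun ε => ∫ x, ‖∫ s, kern α ε s * deriv f (x - s)‖ ^ 2 := by
      filter_upwards [self_mem_nhdsWithin] with ε hε
      rw [integral_damped_conv_sq hε hα' hf'.continuous hc']
      rw [hFS']; exact SchwartzMap.integrable _
    refine Tendsto.congr' heq ?_
    -- The derivative contributes a factor `|ω|` and the undamped kernel `|ω|^(α-1)`, together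
    -- `|ω|^α`. At `ω = 0` both sides vanish.
    have hbase : ∀ ξ : ℝ, (Real.Gamma (1 - α) * |2 * Real.pi * ξ| ^ (α - 1) *
        (|2 * Real.pi * ξ| * ‖𝓕 f ξ‖)) ^ 2 =
        Real.Gamma (1 - α) ^ 2 * (|2 * Real.pi * ξ| ^ (2 * α) * ‖𝓕 f ξ‖ ^ 2) := by
      intro ξ
      rcases eq_or_ne ξ 0 with rfl | h0
      · simp [Real.zero_rpow (by linarith : 2 * α ≠ 0)]
      · have hp : 0 < |2 * Real.pi * ξ| := by positivity
        have : |2 * Real.pi * ξ| ^ (2 * α) = (|2 * Real.pi * ξ| ^ (α - 1) * |2 * Real.pi * ξ|) ^ 2 := by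
          nth_rewrite 3 [← Real.rpow_one |2 * Real.pi * ξ|]
          rw [← Real.rpow_add hp, ← Real.rpow_natCast, ← Real.rpow_mul hp.le]
          congr 1; push_cast; ring
        rw [this]; ring
    have hnorm : ∀ ε ξ : ℝ, |2 * Real.pi * ξ| ≤ ‖(ε + 2 * Real.pi * Complex.I * ξ : ℂ)‖ := by
      intro ε ξ
      have := Complex.abs_im_le_norm (ε + 2 * Real.pi * Complex.I * ξ : ℂ)
      simpa using this
    -- The limit itself dominates: `|ε + iω| ≥ |ω|` and the exponent `α - 1` is negative.
    refine tendsto_integral_filter_of_dominated_convergence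
      (fun ξ : ℝ => Real.Gamma (1 - α) ^ 2 * (|2 * Real.pi * ξ| ^ (2 * α) * ‖𝓕 f ξ‖ ^ 2)) ?_ ?_
      (hi3.const_mul _) ?_
    · refine Eventually.of_forall fun ε => Measurable.aestronglyMeasurable ?_
      have : Measurable fun ξ : ℝ => ‖𝓕 (deriv f) ξ‖ := by
        rw [hFS']; exact (SchwartzMap.continuous _).norm.measurable
      fun_prop
    · filter_upwards [self_mem_nhdsWithin] with ε hε
      refine Eventually.of_forall fun ξ => ?_
      rw [Real.norm_of_nonneg (by positivity), ← hbase, hd]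
      rcases eq_or_ne ξ 0 with rfl | h0
      · simp
      · have hp : 0 < |2 * Real.pi * ξ| := by positivity
        have hG : 0 ≤ Real.Gamma (1 - α) := Real.Gamma_nonneg_of_nonneg (by linarith)
        gcongr ((?_ * ?_) * ?_) ^ 2
        exact Real.rpow_le_rpow_of_nonpos hp (hnorm ε ξ) (by linarith)
    · refine Eventually.of_forall fun ξ => ?_
      rw [← hbase, hd]
      rcases eq_or_ne ξ 0 with rfl | h0
      · simp
      · have hp : 0 < |2 * Real.pi * ξ| := by positivity
        refine Tendsto.pow (Tendsto.mul_const _ (Tendsto.const_mul _ ?_)) 2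
        have h1 : Tendsto (fun ε : ℝ => ‖(ε + 2 * Real.pi * Complex.I * ξ : ℂ)‖) (𝓝[>] 0)
            (𝓝 |2 * Real.pi * ξ|) := by
          have hcn : Continuous fun ε : ℝ => ‖(ε + 2 * Real.pi * Complex.I * ξ : ℂ)‖ := by fun_prop
          have := (hcn.tendsto 0).mono_left (nhdsWithin_le_nhds (s := Set.Ioi 0))
          convert this using 2
          simp [abs_mul]
        exact h1.rpow_const (Or.inl hp.ne')
  rw [← integral_const_mul]
  exact tendsto_nhds_unique hl hr

end FracHam

/-! ### Scalar Sobolev inequality -/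

namespace FracHam
open scoped ContDiff

/-- Cauchy-Schwarz inequality with a weight. -/
theorem sq_integral_mul_le {X : Type*} [MeasurableSpace X] {μ : Measure X} {a b : X → ℝ}
    (ha : ∀ x, 0 ≤ a x) (h0 : Integrable a μ) (h1 : Integrable (fun x => a x * b x) μ)
    (h2 : Integrable (fun x => a x * b x ^ 2) μ) :
    (∫ x, a x * b x ∂μ) ^ 2 ≤ (∫ x, a x ∂μ) * ∫ x, a x * b x ^ 2 ∂μ := by
  -- Discriminant argument: the polynomial in `s` is `∫ a (b - s)²`.
  have key : ∀ s : ℝ, 0 ≤ (∫ x, a x * b x ^ 2 ∂μ) - 2 * s * (∫ x, a x * b x ∂μ)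
      + s ^ 2 * ∫ x, a x ∂μ := by
    intro s
    have h : 0 ≤ ∫ x, (a x * b x ^ 2 - 2 * s * (a x * b x) + s ^ 2 * a x) ∂μ := by
      refine integral_nonneg fun x => ?_
      have := mul_nonneg (ha x) (sq_nonneg (b x - s))
      dsimp only [Pi.zero_apply]
      nlinarith
    have e1 := integral_add (h2.sub (h1.const_mul (2 * s))) (h0.const_mul (s ^ 2))
    have e2 := integral_sub h2 (h1.const_mul (2 * s))
    rw [integral_const_mul] at e1 e2
    simp only [Pi.sub_apply] at e1
    rwa [e1, e2] at h
  set A := ∫ x, a x ∂μ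
  set F := ∫ x, a x * b x ∂μ
  set B := ∫ x, a x * b x ^ 2 ∂μ
  have hA : 0 ≤ A := integral_nonneg ha
  rcases hA.eq_or_lt with hA | hA
  -- With `A = 0` the polynomial is affine in `s`, and it stays nonnegative only if `F = 0`.
  · have h3 := key ((B + 1) * F)
    have h4 := key 0
    rw [← hA] at h3 ⊢
    simp only [mul_zero, zero_mul, zero_pow, ne_eq, OfNat.ofNat_ne_zero, not_false_eq_true, sub_zero, add_zero] at h3 h4 ⊢
    by_contra hF
    push Not at hF
    have h5 : 0 ≤ B - 2 * ((B + 1) * F ^ 2) := by linarith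
    have h6 := key (B / F)
    rw [← hA] at h6
    have hF0 : F ≠ 0 := by rintro h; rw [h] at hF; simp at hF
    have h7 : 2 * (B / F) * F = 2 * B := by field_simp
    have hB : B = 0 := by linarith
    rw [hB] at h5
    linarith
  · have h3 := key (F / A)
    have h4 : B - 2 * (F / A) * F + (F / A) ^ 2 * A = B - F ^ 2 / A := by field_simp; ring
    rw [h4] at h3
    have : F ^ 2 / A ≤ B := by linarith
    rw [div_le_iff₀ hA] at this
    linarith

/-- The Fourier seminorm `∫ |ω|^(2α) |f̂|²` of a scalar function. -/
noncomputable def energy (α : ℝ) (f : ℝ → ℂ) : ℝ :=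
  ∫ ξ : ℝ, |2 * Real.pi * ξ| ^ (2 * α) * ‖𝓕 f ξ‖ ^ 2

theorem energy_nonneg (α : ℝ) (f : ℝ → ℂ) : 0 ≤ energy α f := by
  unfold energy; positivity

section
variable {α : ℝ} {f : ℝ → ℂ}

theorem fourier_eq_schwartz (hf : ContDiff ℝ ∞ f) (hc : HasCompactSupport f) :
    𝓕 f = ⇑(𝓕 (hc.toSchwartzMap hf) : SchwartzMap ℝ ℂ) := rfl

theorem continuous_fourier_test (hf : ContDiff ℝ ∞ f) (hc : HasCompactSupport f) :
    Continuous (𝓕 f) := by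
  rw [fourier_eq_schwartz hf hc]; exact SchwartzMap.continuous _

theorem integrable_fourier_test (hf : ContDiff ℝ ∞ f) (hc : HasCompactSupport f) :
    Integrable (𝓕 f) := by
  rw [fourier_eq_schwartz hf hc]; exact SchwartzMap.integrable _

theorem integrable_fourier_sq_test (hf : ContDiff ℝ ∞ f) (hc : HasCompactSupport f) :
    Integrable (fun ξ => ‖𝓕 f ξ‖ ^ 2) := by
  rw [fourier_eq_schwartz hf hc,
    ← memLp_two_iff_integrable_sq_norm (SchwartzMap.continuous _).aestronglyMeasurable]
  exact SchwartzMap.memLp _ 2 _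

theorem plancherel_test (hf : ContDiff ℝ ∞ f) (hc : HasCompactSupport f) :
    ∫ ξ, ‖𝓕 f ξ‖ ^ 2 = ∫ x, ‖f x‖ ^ 2 :=
  integral_norm_sq_fourier_eq hf.continuous (hf.continuous.integrable_of_hasCompactSupport hc)
    (integrable_fourier_test hf hc)

theorem norm_le_integral_fourier (hf : ContDiff ℝ ∞ f) (hc : HasCompactSupport f) (x : ℝ) :
    ‖f x‖ ≤ ∫ ξ, ‖𝓕 f ξ‖ := by
  have h := congrFun (hf.continuous.fourierInv_fourier_eq
    (hf.continuous.integrable_of_hasCompactSupport hc) (integrable_fourier_test hf hc)) x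
  rw [← h, Real.fourierInv_eq]
  refine (norm_integral_le_integral_norm _).trans (le_of_eq ?_)
  simp

end

theorem integrable_weight {α : ℝ} (hα : 1 / 2 < α) :
    Integrable (fun η : ℝ => (1 + |2 * Real.pi * η| ^ (2 * α))⁻¹) := by
  have hm : Continuous fun η : ℝ => (1 + |η| ^ (2 * α))⁻¹ := by
    refine Continuous.inv₀ (continuous_const.add (Continuous.rpow_const (by fun_prop) ?_)) ?_
    · intro x; right; linarith
    · intro x; positivity
  have h1 : Integrable (fun η : ℝ => (1 + |η| ^ (2 * α))⁻¹) := by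
    refine hm.locallyIntegrable.integrable_of_isBigO_atBot_atTop
      (g := fun x => (-x) ^ (-(2 * α))) (g' := fun x => x ^ (-(2 * α))) ?_ ?_ ?_ ?_
    · refine Asymptotics.IsBigO.of_bound 1 ?_
      filter_upwards [eventually_lt_atBot 0] with x hx
      have hx' : 0 < -x := by linarith
      rw [Real.norm_of_nonneg (by positivity), Real.norm_of_nonneg (by positivity), abs_of_neg hx,
        one_mul, Real.rpow_neg hx'.le]
      gcongr
      linarith
    · have := (integrableAtFilter_rpow_atTop_iff (s := -(2 * α))).2 (by linarith)
      obtain ⟨s, hs, hi⟩ := this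
      refine ⟨Neg.neg ⁻¹' s, tendsto_neg_atBot_atTop hs, ?_⟩
      have e := (Measure.measurePreserving_neg (volume : Measure ℝ)).integrableOn_comp_preimage
        (MeasurableEquiv.neg ℝ).measurableEmbedding (f := fun x : ℝ => x ^ (-(2 * α))) (s := s)
      exact e.2 hi
    · refine Asymptotics.IsBigO.of_bound 1 ?_
      filter_upwards [eventually_gt_atTop 0] with x hx
      rw [Real.norm_of_nonneg (by positivity), Real.norm_of_nonneg (by positivity), abs_of_pos hx,
        one_mul, Real.rpow_neg hx.le]
      gcongr
      linarith
    · exact (integrableAtFilter_rpow_atTop_iff).2 (by linarith)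
  exact h1.comp_mul_left' (by positivity)

/-- Sobolev inequality with a scale parameter. -/
theorem exists_sobolev {α : ℝ} (hα : 1 / 2 < α) (hα' : α < 1) : ∃ C > 0, ∀ f : ℝ → ℂ,
    ContDiff ℝ ∞ f → HasCompactSupport f → ∀ x, ∀ r > 0,
      ‖f x‖ ^ 2 ≤ C * (r * (∫ x, ‖f x‖ ^ 2) + r ^ (1 - 2 * α) * energy α f) := by
  have hpos : 0 ≤ ∫ η : ℝ, (1 + |2 * Real.pi * η| ^ (2 * α))⁻¹ :=
    integral_nonneg fun η => by positivity
  refine ⟨(∫ η : ℝ, (1 + |2 * Real.pi * η| ^ (2 * α))⁻¹) + 1, by linarith, ?_⟩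
  intro f hf hc x r hr
  -- Cauchy-Schwarz is applied to `|f̂| = w⁻¹ · w|f̂|`. The powers of `r` are chosen so that `ξ ↦
  -- rξ` removes `r` from `∫ w⁻¹`, leaving a constant that does not depend on the scale.
  set w : ℝ → ℝ := fun ξ => r + r ^ (1 - 2 * α) * |2 * Real.pi * ξ| ^ (2 * α) with hw
  have hwpos : ∀ ξ, 0 < w ξ := fun ξ => by positivity
  have hweq : ∀ ξ, (w ξ)⁻¹ = r⁻¹ * (1 + |2 * Real.pi * (r⁻¹ * ξ)| ^ (2 * α))⁻¹ := by
    intro ξ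
    rw [← mul_inv]
    congr 1
    simp only [hw]
    rw [show 2 * Real.pi * (r⁻¹ * ξ) = r⁻¹ * (2 * Real.pi * ξ) by ring, abs_mul r⁻¹,
      abs_of_pos (inv_pos.2 hr), Real.mul_rpow (by positivity) (by positivity), mul_add, mul_one,
      ← mul_assoc, sub_eq_add_neg, Real.rpow_add hr, Real.rpow_one, Real.rpow_neg hr.le,
      Real.inv_rpow hr.le]
  have hwi : Integrable fun ξ => (w ξ)⁻¹ := by
    simp only [hweq]
    exact ((integrable_weight hα).comp_mul_left' (by positivity)).const_mul _
  have hwI : ∫ ξ, (w ξ)⁻¹ = ∫ η : ℝ, (1 + |2 * Real.pi * η| ^ (2 * α))⁻¹ := by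
    simp only [hweq]
    rw [integral_const_mul, Measure.integral_comp_mul_left
      (fun η : ℝ => (1 + |2 * Real.pi * η| ^ (2 * α))⁻¹), inv_inv, abs_of_pos hr, smul_eq_mul,
      inv_mul_cancel_left₀ hr.ne']
  have e1 : ∀ ξ, (w ξ)⁻¹ * (w ξ * ‖𝓕 f ξ‖) = ‖𝓕 f ξ‖ := fun ξ => by
    rw [inv_mul_cancel_left₀ (hwpos ξ).ne']
  have e2 : ∀ ξ, (w ξ)⁻¹ * (w ξ * ‖𝓕 f ξ‖) ^ 2 =
      r * ‖𝓕 f ξ‖ ^ 2 + r ^ (1 - 2 * α) * (|2 * Real.pi * ξ| ^ (2 * α) * ‖𝓕 f ξ‖ ^ 2) := fun ξ => by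
    have := (hwpos ξ).ne'
    rw [show (w ξ)⁻¹ * (w ξ * ‖𝓕 f ξ‖) ^ 2 = w ξ * ‖𝓕 f ξ‖ ^ 2 by field_simp]
    simp only [hw]; ring
  have i1 := (integrable_fourier_sq_test hf hc).const_mul r
  have i2 := ((integral_conv_deriv_sq hα hα' hf hc).1).const_mul (r ^ (1 - 2 * α))
  have h := sq_integral_mul_le (μ := volume) (a := fun ξ => (w ξ)⁻¹) (b := fun ξ => w ξ * ‖𝓕 f ξ‖)
    (fun ξ => (inv_pos.2 (hwpos ξ)).le) hwi
    (by simp only [e1]; exact (integrable_fourier_test hf hc).norm)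
    (by simp only [e2]; exact i1.add i2)
  simp only [e1, e2] at h
  rw [integral_add i1 i2, integral_const_mul, integral_const_mul, hwI, plancherel_test hf hc] at h
  change _ ≤ _ * (_ + _ * energy α f) at h
  have hx := norm_le_integral_fourier hf hc x
  have hE := energy_nonneg α f
  calc ‖f x‖ ^ 2 ≤ (∫ ξ, ‖𝓕 f ξ‖) ^ 2 := by gcongr
    _ ≤ _ := h
    _ ≤ _ := by
      gcongr
      linarith

end FracHam

/-! ### Cutoff multiplication in the fractional norm -/

namespace FracHam
open scoped ContDiff

/-- A smooth bump equal to one on `[-1, 1]` and supported in `[-2, 2]`. -/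
noncomputable def bump : ContDiffBump (0 : ℝ) := ⟨1, 2, one_pos, one_lt_two⟩

/-- The cutoff function `χ(t / m)`. -/
noncomputable def cutoff (m : ℝ) (t : ℝ) : ℝ := bump (t / m)

theorem cutoff_contDiff (m : ℝ) : ContDiff ℝ ∞ (cutoff m) :=
  bump.contDiff.comp (contDiff_id.div_const m)

theorem cutoff_nonneg (m t : ℝ) : 0 ≤ cutoff m t := bump.nonneg

theorem cutoff_le_one (m t : ℝ) : cutoff m t ≤ 1 := bump.le_one

theorem cutoff_eq_one {m t : ℝ} (hm : 0 < m) (ht : |t| ≤ m) : cutoff m t = 1 := by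
  refine bump.one_of_mem_closedBall ?_
  rw [Metric.mem_closedBall, dist_zero_right, Real.norm_eq_abs, abs_div, abs_of_pos hm]
  exact (div_le_one hm).2 ht

theorem cutoff_eq_zero {m t : ℝ} (hm : 0 < m) (ht : 2 * m ≤ |t|) : cutoff m t = 0 := by
  refine bump.zero_of_le_dist ?_
  rw [dist_zero_right, Real.norm_eq_abs, abs_div, abs_of_pos hm]
  exact (le_div_iff₀ hm).2 ht

theorem cutoff_hasCompactSupport {m : ℝ} (hm : 0 < m) : HasCompactSupport (cutoff m) := by
  refine HasCompactSupport.intro (isCompact_closedBall (0 : ℝ) (2 * m)) fun t ht => ?_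
  rw [Metric.mem_closedBall, dist_zero_right, Real.norm_eq_abs, not_le] at ht
  exact cutoff_eq_zero hm ht.le

/-- The Fourier transform of the complexified bump. -/
noncomputable def bumpF : ℝ → ℂ := 𝓕 (fun t : ℝ => ((bump t : ℝ) : ℂ))

theorem bumpC_contDiff : ContDiff ℝ ∞ (fun t : ℝ => ((bump t : ℝ) : ℂ)) :=
  Complex.ofRealCLM.contDiff.comp bump.contDiff

theorem bumpC_compact : HasCompactSupport (fun t : ℝ => ((bump t : ℝ) : ℂ)) :=
  bump.hasCompactSupport.comp_left (g := fun x : ℝ => (x : ℂ)) (by simp)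

theorem cutoff_eq_integral (m t : ℝ) : ((cutoff m t : ℝ) : ℂ) =
    ∫ η : ℝ, Complex.exp (↑(2 * Real.pi * η * (t / m)) * Complex.I) * bumpF η := by
  have h := congrFun (bumpC_contDiff.continuous.fourierInv_fourier_eq
    (bumpC_contDiff.continuous.integrable_of_hasCompactSupport bumpC_compact)
    (integrable_fourier_test bumpC_contDiff bumpC_compact)) (t / m)
  rw [Real.fourierInv_eq'] at h
  unfold cutoff
  rw [← h]
  congr 1; ext η
  simp only [smul_eq_mul, bumpF]
  congr 4
  simp; ring

section
variable {α : ℝ} {f : ℝ → ℂ}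

/-- By Fourier inversion the cutoff is a superposition of characters in `ηt/m` with weight `bumpF
η`; each character shifts `𝓕 f` by `η/m`, and Fubini exchanges the integrals. -/
theorem fourier_cutoff_mul (hf : Continuous f) (hc : HasCompactSupport f)
    (m ξ : ℝ) : 𝓕 (fun t => (cutoff m t : ℂ) * f t) ξ = ∫ η, bumpF η * 𝓕 f (ξ - η / m) := by
  have hfi := hf.integrable_of_hasCompactSupport (μ := volume) hc
  have hbi : Integrable bumpF := integrable_fourier_test bumpC_contDiff bumpC_compact
  simp only [Real.fourier_real_eq_integral_exp_smul, smul_eq_mul]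
  have e1 : ∀ t : ℝ, Complex.exp (↑(-2 * Real.pi * t * ξ) * Complex.I) * (↑(cutoff m t) * f t)
      = ∫ η : ℝ, Complex.exp (↑(-2 * Real.pi * t * (ξ - η / m)) * Complex.I) * (f t * bumpF η) := by
    intro t
    rw [cutoff_eq_integral, ← integral_mul_const, ← integral_const_mul]
    congr 1; ext η
    have : Complex.exp (↑(-2 * Real.pi * t * (ξ - η / m)) * Complex.I) =
      Complex.exp (↑(-2 * Real.pi * t * ξ) * Complex.I) *
        Complex.exp (↑(2 * Real.pi * η * (t / m)) * Complex.I) := by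
      rw [← Complex.exp_add]; congr 1; push_cast; ring
    rw [this]; ring
  simp only [e1]
  rw [integral_integral_swap]
  · congr 1; ext η
    rw [← integral_const_mul]
    congr 1; ext t; ring
  · have h1 : Integrable (fun p : ℝ × ℝ => f p.1 * bumpF p.2) (volume.prod volume) :=
      hfi.mul_prod hbi
    refine h1.bdd_mul (c := 1) ?_ (Eventually.of_forall fun p => ?_)
    · apply Continuous.aestronglyMeasurable
      fun_prop
    · rw [Complex.norm_exp_ofReal_mul_I]

theorem bumpF_moment_integrable (h0 : 0 ≤ α) (h1 : α ≤ 1) :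
    Integrable (fun η : ℝ => ‖bumpF η‖ * (1 + |2 * Real.pi * η| ^ α)) := by
  have hb := integrable_fourier_test bumpC_contDiff bumpC_compact
  have hcont : Continuous bumpF := continuous_fourier_test bumpC_contDiff bumpC_compact
  have hs : Integrable fun η : ℝ => ‖η‖ ^ 1 * ‖bumpF η‖ :=
    SchwartzMap.integrable_pow_mul volume (𝓕 (bumpC_compact.toSchwartzMap bumpC_contDiff)) 1
  refine ((hb.norm.const_mul 2).add (hs.const_mul (2 * Real.pi))).mono' ?_
    (Eventually.of_forall fun η => ?_)
  · refine (hcont.norm.mul (continuous_const.add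
      (Continuous.rpow_const (by fun_prop) fun _ => Or.inr h0))).aestronglyMeasurable
  · rw [Real.norm_of_nonneg (by positivity)]
    simp only [Pi.add_apply, pow_one, Real.norm_eq_abs]
    have hle : |2 * Real.pi * η| ^ α ≤ 1 + |2 * Real.pi * η| := by
      rcases le_total |2 * Real.pi * η| 1 with h | h
      · have := Real.rpow_le_one (abs_nonneg _) h h0
        linarith [abs_nonneg (2 * Real.pi * η)]
      · have := Real.rpow_le_rpow_of_exponent_le h h1
        rw [Real.rpow_one] at this
        linarith
    have e : |2 * Real.pi * η| = 2 * Real.pi * |η| := by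
      rw [abs_mul, abs_of_pos Real.two_pi_pos]
    change ‖bumpF η‖ * _ ≤ 2 * ‖bumpF η‖ + _
    rw [e] at hle ⊢
    nlinarith [norm_nonneg (bumpF η)]

theorem integrable_shift_mul {a b : ℝ → ℝ} {B : ℝ} (hai : Integrable a)
    (hb : Continuous b) (hbB : ∀ x, ‖b x‖ ≤ B) (ξ m : ℝ) :
    Integrable fun η => a η * b (ξ - η / m) :=
  hai.mul_bdd (by fun_prop) (Eventually.of_forall fun _ => hbB _)

/-- Young's inequality `L¹ * L² ⊆ L²` for a rescaled convolution. -/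
theorem integral_sq_le_of_le_conv {a b F : ℝ → ℝ} {m B : ℝ} (ha : ∀ x, 0 ≤ a x)
    (hai : Integrable a) (ham : Continuous a)
    (hb : Continuous b) (hbB : ∀ x, ‖b x‖ ≤ B) (hb2 : Integrable fun x => b x ^ 2)
    (hF0 : ∀ ξ, 0 ≤ F ξ) (hF : ∀ ξ, F ξ ≤ ∫ η, a η * b (ξ - η / m))
    (hFm : Continuous F) :
    ∫ ξ, F ξ ^ 2 ≤ (∫ η, a η) ^ 2 * ∫ x, b x ^ 2 := by
  have hA : 0 ≤ ∫ η, a η := integral_nonneg ha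
  have hBB : 0 ≤ ∫ x, b x ^ 2 := by positivity
  -- Cauchy-Schwarz with respect to the weight `a`; Tonelli and translation invariance then finish
  -- the estimate.
  have h1 : ∀ ξ, F ξ ^ 2 ≤ (∫ η, a η) * ∫ η, a η * b (ξ - η / m) ^ 2 := by
    intro ξ
    refine (pow_le_pow_left₀ (hF0 ξ) (hF ξ) 2).trans
      (sq_integral_mul_le ha hai (integrable_shift_mul hai hb hbB ξ m) ?_)
    exact integrable_shift_mul (b := fun x => b x ^ 2) (B := B ^ 2) hai (by fun_prop)
      (fun x => by rw [norm_pow]; exact pow_le_pow_left₀ (norm_nonneg _) (hbB x) 2) ξ m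
  rw [integral_eq_lintegral_of_nonneg_ae (Eventually.of_forall fun ξ => by positivity)
    (by fun_prop)]
  refine ENNReal.toReal_le_of_le_ofReal (by positivity) ?_
  calc ∫⁻ ξ, ENNReal.ofReal (F ξ ^ 2)
      ≤ ∫⁻ ξ, ENNReal.ofReal (∫ η, a η) * ∫⁻ η, ENNReal.ofReal (a η * b (ξ - η / m) ^ 2) := by
        refine lintegral_mono fun ξ => ?_
        rw [← ofReal_integral_eq_lintegral_ofReal, ← ENNReal.ofReal_mul hA]
        · exact ENNReal.ofReal_le_ofReal (h1 ξ)
        · exact integrable_shift_mul (b := fun x => b x ^ 2) (B := B ^ 2) hai (by fun_prop)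
            (fun x => by rw [norm_pow]; exact pow_le_pow_left₀ (norm_nonneg _) (hbB x) 2) ξ m
        · exact Eventually.of_forall fun η => mul_nonneg (ha η) (sq_nonneg _)
    _ = ENNReal.ofReal (∫ η, a η) * ∫⁻ ξ, ∫⁻ η, ENNReal.ofReal (a η * b (ξ - η / m) ^ 2) := by
        rw [lintegral_const_mul']
        exact ENNReal.ofReal_ne_top
    _ = ENNReal.ofReal (∫ η, a η) * ∫⁻ η, ∫⁻ ξ, ENNReal.ofReal (a η * b (ξ - η / m) ^ 2) := by
        rw [lintegral_lintegral_swap]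
        apply Measurable.aemeasurable
        apply ENNReal.measurable_ofReal.comp
        apply Continuous.measurable
        fun_prop
    _ = ENNReal.ofReal (∫ η, a η) * ∫⁻ η, ENNReal.ofReal (a η) * ENNReal.ofReal (∫ x, b x ^ 2) := by
        congr 1
        refine lintegral_congr fun η => ?_
        simp only [ENNReal.ofReal_mul (ha η)]
        rw [lintegral_const_mul' _ _ ENNReal.ofReal_ne_top]
        congr 1
        rw [lintegral_sub_right_eq_self (fun x => ENNReal.ofReal (b x ^ 2)),
          ofReal_integral_eq_lintegral_ofReal hb2 (Eventually.of_forall fun x => sq_nonneg _)]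
    _ = ENNReal.ofReal ((∫ η, a η) ^ 2 * ∫ x, b x ^ 2) := by
        rw [lintegral_mul_const' _ _ ENNReal.ofReal_ne_top,
          ← ofReal_integral_eq_lintegral_ofReal hai (Eventually.of_forall ha), ← mul_assoc,
          ← ENNReal.ofReal_mul hA, ← ENNReal.ofReal_mul (by positivity), sq]

end

/-- The symbol `|ω|^α` is subadditive for `α ≤ 1`, so it splits over the shifts of
`fourier_cutoff_mul` into a moment of `bumpF` and the `H^α` weight of `f`; Young's inequality
concludes. No commutator limit as `m → ∞` is needed, only a bound uniform in `m`. -/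
theorem exists_energy_cutoff {α : ℝ} (hα : 1 / 2 < α) (hα' : α < 1) : ∃ C > 0, ∀ m ≥ (1 : ℝ),
    ∀ f : ℝ → ℂ, ContDiff ℝ ∞ f → HasCompactSupport f →
      energy α (fun t => (cutoff m t : ℂ) * f t) ≤ C * ((∫ x, ‖f x‖ ^ 2) + energy α f) := by
  have h0 : 0 < α := by linarith
  refine ⟨2 * (∫ η : ℝ, ‖bumpF η‖ * (1 + |2 * Real.pi * η| ^ α)) ^ 2 + 1, by positivity, ?_⟩
  intro m hm f hf hc
  have hm0 : 0 < m := by linarith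
  have hrp : Continuous fun ξ : ℝ => |2 * Real.pi * ξ| ^ α :=
    Continuous.rpow_const (by fun_prop) fun _ => Or.inr h0.le
  have hsq : ∀ ξ : ℝ, |2 * Real.pi * ξ| ^ (2 * α) = (|2 * Real.pi * ξ| ^ α) ^ 2 := by
    intro ξ
    rw [← Real.rpow_natCast, ← Real.rpow_mul (abs_nonneg _)]
    congr 1; push_cast; ring
  have hcf := continuous_fourier_test hf hc
  have hχf : ContDiff ℝ ∞ (fun t => (cutoff m t : ℂ) * f t) :=
    (Complex.ofRealCLM.contDiff.comp (cutoff_contDiff m)).mul hf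
  have hχc : HasCompactSupport (fun t => (cutoff m t : ℂ) * f t) := hc.mul_left
  set b : ℝ → ℝ := fun ξ => (1 + |2 * Real.pi * ξ| ^ α) * ‖𝓕 f ξ‖ with hbdef
  have hbc : Continuous b := (continuous_const.add hrp).mul hcf.norm
  have hb2le : ∀ ξ, b ξ ^ 2 ≤ 2 * (‖𝓕 f ξ‖ ^ 2 + |2 * Real.pi * ξ| ^ (2 * α) * ‖𝓕 f ξ‖ ^ 2) := by
    intro ξ
    rw [hsq]
    simp only [hbdef]
    nlinarith [sq_nonneg ((1 - |2 * Real.pi * ξ| ^ α) * ‖𝓕 f ξ‖)]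
  have hi := ((integrable_fourier_sq_test hf hc).add
    (integral_conv_deriv_sq hα hα' hf hc).1).const_mul 2
  have hb2 : Integrable fun ξ => b ξ ^ 2 := by
    refine hi.mono' (by fun_prop) (Eventually.of_forall fun ξ => ?_)
    rw [Real.norm_of_nonneg (sq_nonneg _)]
    exact hb2le ξ
  have hbB : ∃ B, ∀ x, ‖b x‖ ≤ B := by
    obtain ⟨K1, hK1⟩ := (𝓕 (hc.toSchwartzMap hf) : SchwartzMap ℝ ℂ).decay 0 0
    obtain ⟨K2, hK2⟩ := (𝓕 (hc.toSchwartzMap hf) : SchwartzMap ℝ ℂ).decay 1 0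
    refine ⟨2 * K1 + 2 * Real.pi * K2, fun x => ?_⟩
    have e1 : ‖𝓕 f x‖ ≤ K1 := by simpa [fourier_eq_schwartz hf hc] using hK1.2 x
    have e2 : |x| * ‖𝓕 f x‖ ≤ K2 := by simpa [fourier_eq_schwartz hf hc] using hK2.2 x
    simp only [hbdef]
    rw [Real.norm_of_nonneg (by positivity)]
    have hle : |2 * Real.pi * x| ^ α ≤ 1 + |2 * Real.pi * x| := by
      rcases le_total |2 * Real.pi * x| 1 with h | h
      · have := Real.rpow_le_one (abs_nonneg _) h h0.le
        linarith [abs_nonneg (2 * Real.pi * x)]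
      · have := Real.rpow_le_rpow_of_exponent_le h hα'.le
        rw [Real.rpow_one] at this
        linarith
    have e : |2 * Real.pi * x| = 2 * Real.pi * |x| := by
      rw [abs_mul, abs_of_pos Real.two_pi_pos]
    rw [e] at hle ⊢
    nlinarith [norm_nonneg (𝓕 f x), Real.pi_pos]
  obtain ⟨B, hB⟩ := hbB
  have key := integral_sq_le_of_le_conv (m := m)
    (a := fun η => ‖bumpF η‖ * (1 + |2 * Real.pi * η| ^ α)) (b := b)
    (F := fun ξ => |2 * Real.pi * ξ| ^ α * ‖𝓕 (fun t => (cutoff m t : ℂ) * f t) ξ‖)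
    (fun x => by positivity) (bumpF_moment_integrable h0.le hα'.le)
    ((continuous_fourier_test bumpC_contDiff bumpC_compact).norm.mul (continuous_const.add hrp))
    hbc hB hb2 (fun ξ => by positivity) ?_ (hrp.mul (continuous_fourier_test hχf hχc).norm)
  · have hE : energy α (fun t => (cutoff m t : ℂ) * f t) =
        ∫ ξ : ℝ, (|2 * Real.pi * ξ| ^ α * ‖𝓕 (fun t => (cutoff m t : ℂ) * f t) ξ‖) ^ 2 := by
      unfold energy
      congr 1; ext ξ
      rw [hsq]; ring
    have hb3 : ∫ ξ, b ξ ^ 2 ≤ 2 * ((∫ x, ‖f x‖ ^ 2) + energy α f) := by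
      refine (integral_mono hb2 hi hb2le).trans (le_of_eq ?_)
      simp only [Pi.add_apply]
      rw [integral_const_mul, integral_add (integrable_fourier_sq_test hf hc)
        (integral_conv_deriv_sq hα hα' hf hc).1, plancherel_test hf hc]
      rfl
    rw [hE]
    refine key.trans ?_
    have hS : 0 ≤ (∫ x, ‖f x‖ ^ 2) + energy α f := by
      have := energy_nonneg α f
      positivity
    calc _ ≤ (∫ η : ℝ, ‖bumpF η‖ * (1 + |2 * Real.pi * η| ^ α)) ^ 2 *
          (2 * ((∫ x, ‖f x‖ ^ 2) + energy α f)) := by gcongr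
      _ ≤ _ := by nlinarith
  · intro ξ
    rw [fourier_cutoff_mul hf.continuous hc]
    have hr := integrable_shift_mul (bumpF_moment_integrable h0.le hα'.le) hbc hB ξ m
    calc |2 * Real.pi * ξ| ^ α * ‖∫ η, bumpF η * 𝓕 f (ξ - η / m)‖
        = ‖∫ η, ((|2 * Real.pi * ξ| ^ α : ℝ) : ℂ) * (bumpF η * 𝓕 f (ξ - η / m))‖ := by
          rw [integral_const_mul, norm_mul, Complex.norm_real, Real.norm_of_nonneg (by positivity)]
      _ ≤ _ := by
        refine norm_integral_le_of_norm_le hr (Eventually.of_forall fun η => ?_)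
        rw [norm_mul, norm_mul, Complex.norm_real, Real.norm_of_nonneg (by positivity)]
        -- Here `m ≥ 1` enters: the shift `η/m` is replaced by `η`, which makes the constant
        -- independent of `m`.
        have h3 : |2 * Real.pi * ξ| ^ α ≤
            (1 + |2 * Real.pi * η| ^ α) * (1 + |2 * Real.pi * (ξ - η / m)| ^ α) := by
          have h4 : |2 * Real.pi * ξ| ≤ |2 * Real.pi * η| + |2 * Real.pi * (ξ - η / m)| := by
            have : 2 * Real.pi * ξ = 2 * Real.pi * (η / m) + 2 * Real.pi * (ξ - η / m) := by ring
            rw [this]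
            refine (abs_add_le _ _).trans ?_
            gcongr ?_ + _
            rw [abs_mul, abs_mul _ η, abs_div, abs_of_pos hm0]
            gcongr
            exact div_le_self (abs_nonneg _) hm
          have h5 := (Real.rpow_le_rpow (abs_nonneg _) h4 h0.le).trans
            (Real.rpow_add_le_add_rpow (abs_nonneg _) (abs_nonneg _) h0.le hα'.le)
          have h6 : 0 ≤ |2 * Real.pi * η| ^ α := by positivity
          have h7 : 0 ≤ |2 * Real.pi * (ξ - η / m)| ^ α := by positivity
          nlinarith
        simp only [hbdef]
        calc _ ≤ ((1 + |2 * Real.pi * η| ^ α) * (1 + |2 * Real.pi * (ξ - η / m)| ^ α)) *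
              (‖bumpF η‖ * ‖𝓕 f (ξ - η / m)‖) := by gcongr
          _ = _ := by ring

end FracHam

/-! ### Vector valued test functions and their fractional derivatives -/

namespace FracHam
open scoped ContDiff

variable {n : ℕ}

namespace IsTest
variable {φ ψ : ℝ → Vec n}

theorem contDiff (h : IsTest φ) : ContDiff ℝ ∞ φ := h.1

theorem continuous (h : IsTest φ) : Continuous φ := h.1.continuous

theorem zero : IsTest (0 : ℝ → Vec n) := ⟨contDiff_const, HasCompactSupport.zero⟩

theorem add (h : IsTest φ) (h' : IsTest ψ) : IsTest (φ + ψ) := ⟨h.1.add h'.1, h.2.add h'.2⟩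

theorem smul (c : ℝ) (h : IsTest φ) : IsTest (c • φ) := ⟨h.1.const_smul c, h.2.smul_left⟩

theorem sub (h : IsTest φ) (h' : IsTest ψ) : IsTest (φ - ψ) := by
  rw [sub_eq_add_neg, ← neg_one_smul ℝ ψ]
  exact h.add (h'.smul _)

theorem cutoff_smul {m : ℝ} (h : IsTest φ) : IsTest (fun t => cutoff m t • φ t) :=
  ⟨(cutoff_contDiff m).smul h.1, HasCompactSupport.smul_left (f := cutoff m) h.2⟩

theorem memLp (h : IsTest φ) (p : ℝ≥0∞) : MemLp φ p volume :=
  h.continuous.memLp_of_hasCompactSupport h.2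

theorem deriv (h : IsTest φ) : IsTest (deriv φ) :=
  ⟨by apply ContDiff.deriv'; simpa using h.contDiff, h.2.deriv⟩

theorem comp_contDiff (h : IsTest φ) (i : Fin n) : ContDiff ℝ ∞ (fun t => (φ t i : ℂ)) :=
  (Complex.ofRealCLM.contDiff.comp (EuclideanSpace.proj (𝕜 := ℝ) i).contDiff).comp h.contDiff

theorem comp_compact (h : IsTest φ) (i : Fin n) : HasCompactSupport (fun t => (φ t i : ℂ)) :=
  h.2.comp_left (g := fun v : Vec n => (v i : ℂ)) (by simp)

theorem deriv_comp (h : IsTest φ) (i : Fin n) (t : ℝ) :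
    _root_.deriv (fun t => (φ t i : ℂ)) t = (_root_.deriv φ t i : ℂ) := by
  have h1 := (h.contDiff.differentiable (by simp) t).hasDerivAt
  have h2 := ((EuclideanSpace.proj (𝕜 := ℝ) i).hasFDerivAt.comp_hasDerivAt t h1).ofReal_comp
  exact h2.deriv

theorem integrable_norm_sq (h : IsTest φ) : Integrable (fun t => ‖φ t‖ ^ 2) :=
  (memLp_two_iff_integrable_sq_norm h.continuous.aestronglyMeasurable).1 (h.memLp 2)

theorem integrable_comp_sq (h : IsTest φ) (i : Fin n) : Integrable (fun t => ‖(φ t i : ℂ)‖ ^ 2) :=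
  (memLp_two_iff_integrable_sq_norm (h.comp_contDiff i).continuous.aestronglyMeasurable).1
    ((h.comp_contDiff i).continuous.memLp_of_hasCompactSupport (h.comp_compact i))

theorem integral_norm_sq_eq (h : IsTest φ) :
    ∫ t, ‖φ t‖ ^ 2 = ∑ i, ∫ t, ‖(φ t i : ℂ)‖ ^ 2 := by
  rw [← integral_finsetSum _ fun i _ => h.integrable_comp_sq i]
  congr 1; ext t
  rw [EuclideanSpace.norm_sq_eq]
  simp

theorem fracEnergy_eq {α : ℝ} (hα : 1 / 2 < α) (hα' : α < 1) (h : IsTest φ) :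
    fracEnergy α φ = ∑ i, energy α (fun t => (φ t i : ℂ)) := by
  unfold fracEnergy energy
  rw [← integral_finsetSum _ fun i _ => (integral_conv_deriv_sq hα hα' (h.comp_contDiff i)
    (h.comp_compact i)).1]
  congr 1; ext ξ
  rw [Finset.mul_sum]

end IsTest

/-- The real Liouville-Weyl kernel `s₊^(-α)`. -/
noncomputable def rkern (α s : ℝ) : ℝ := (Set.Ioi (0 : ℝ)).indicator (fun s => s ^ (-α)) s

theorem kern_eq_rkern (α s : ℝ) : kern α 0 s = (rkern α s : ℂ) := by
  unfold kern rkern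
  by_cases hs : s ∈ Set.Ioi (0 : ℝ)
  · simp [Set.indicator_of_mem hs]
  · simp [Set.indicator_of_notMem hs]

theorem locallyIntegrable_rkern {α : ℝ} (hα : α < 1) : LocallyIntegrable (rkern α) := by
  have := locallyIntegrable_kern hα
  intro x
  obtain ⟨s, hs, hi⟩ := this x
  refine ⟨s, hs, ?_⟩
  have := hi.re
  simpa [kern_eq_rkern, IntegrableOn] using this

section
variable {α : ℝ} {φ : ℝ → Vec n}

theorem leftIntegral_eq (φ : ℝ → Vec n) (x : ℝ) : leftIntegral (1 - α) φ x =
    (Real.Gamma (1 - α))⁻¹ • ∫ s, rkern α s • φ (x - s) := by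
  unfold leftIntegral
  congr 1
  rw [← integral_indicator measurableSet_Iio,
    ← integral_sub_left_eq_self (fun s => (Set.Iio x).indicator
      (fun ξ => (x - ξ) ^ (1 - α - 1) • φ ξ) s) volume x]
  congr 1; ext1 s
  unfold rkern
  by_cases hs : s ∈ Set.Ioi (0 : ℝ)
  · have : x - s ∈ Set.Iio x := by simpa using hs
    rw [Set.indicator_of_mem hs, Set.indicator_of_mem this]
    congr 2 <;> ring
  · have : x - s ∉ Set.Iio x := by simpa using hs
    rw [Set.indicator_of_notMem hs, Set.indicator_of_notMem this, zero_smul]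

theorem integrable_rkern_smul (hα' : α < 1) {ψ : ℝ → Vec n} (hψ : Continuous ψ)
    (hc : HasCompactSupport ψ) (x : ℝ) : Integrable (fun s => rkern α s • ψ (x - s)) :=
  hc.convolutionExists_right (ContinuousLinearMap.lsmul ℝ ℝ)
      (locallyIntegrable_rkern hα') hψ x

/-- A convolution with a locally integrable kernel may be differentiated on its smooth compactly
supported factor. In this form linearity and the scalar Fourier identity apply. -/
theorem leftDeriv_eq (hα' : α < 1) (h : IsTest φ) (x : ℝ) : leftDeriv α φ x =
    (Real.Gamma (1 - α))⁻¹ • ∫ s, rkern α s • deriv φ (x - s) := by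
  unfold leftDeriv
  have e : leftIntegral (1 - α) φ = fun x => (Real.Gamma (1 - α))⁻¹ • ∫ s, rkern α s • φ (x - s) :=
    funext fun x => leftIntegral_eq φ x
  rw [e]
  have := h.2.hasDerivAt_convolution_right (ContinuousLinearMap.lsmul ℝ ℝ)
    (locallyIntegrable_rkern hα') (h.contDiff.of_le (by simp)) x
  exact (this.const_smul (Real.Gamma (1 - α))⁻¹).deriv

theorem leftDeriv_add (hα' : α < 1) {ψ : ℝ → Vec n} (h : IsTest φ) (h' : IsTest ψ) :
    leftDeriv α (φ + ψ) = leftDeriv α φ + leftDeriv α ψ := by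
  ext1 x
  rw [Pi.add_apply, leftDeriv_eq hα' h, leftDeriv_eq hα' h', leftDeriv_eq hα' (h.add h'), ← smul_add,
    ← integral_add (integrable_rkern_smul hα' h.deriv.continuous h.deriv.2 x)
      (integrable_rkern_smul hα' h'.deriv.continuous h'.deriv.2 x)]
  congr 2; ext1 s
  rw [← smul_add]
  congr 1
  exact deriv_add (h.contDiff.differentiable (by simp) _) (h'.contDiff.differentiable (by simp) _)

theorem leftDeriv_smul (hα' : α < 1) (c : ℝ) (h : IsTest φ) :
    leftDeriv α (c • φ) = c • leftDeriv α φ := by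
  ext1 x
  rw [Pi.smul_apply, leftDeriv_eq hα' h, leftDeriv_eq hα' (h.smul c), smul_comm c, ← integral_smul c]
  congr 2; ext1 s
  rw [smul_comm c]
  congr 1
  exact deriv_const_smul c (h.contDiff.differentiable (by simp) _)

theorem leftDeriv_sub (hα' : α < 1) {ψ : ℝ → Vec n} (h : IsTest φ) (h' : IsTest ψ) :
    leftDeriv α (φ - ψ) = leftDeriv α φ - leftDeriv α ψ := by
  rw [sub_eq_add_neg, ← neg_one_smul ℝ ψ, leftDeriv_add hα' h (h'.smul _), leftDeriv_smul hα' _ h']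
  simp [sub_eq_add_neg]

theorem leftDeriv_apply (hα' : α < 1) (h : IsTest φ) (x : ℝ) (i : Fin n) :
    ((leftDeriv α φ x i : ℝ) : ℂ) =
      ((Real.Gamma (1 - α))⁻¹ : ℝ) * ∫ s, kern α 0 s * deriv (fun t => (φ t i : ℂ)) (x - s) := by
  rw [leftDeriv_eq hα' h, PiLp.smul_apply, smul_eq_mul, Complex.ofReal_mul]
  congr 1
  have := (EuclideanSpace.proj (𝕜 := ℝ) i).integral_comp_comm
    (integrable_rkern_smul hα' h.deriv.continuous h.deriv.2 x)
  change _ = (∫ s, rkern α s • deriv φ (x - s)) i at this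
  rw [← this, ← integral_complex_ofReal]
  congr 1; ext s
  rw [h.deriv_comp, kern_eq_rkern]
  simp

theorem leftDeriv_comp_memLp (hα : 1 / 2 < α) (hα' : α < 1) (h : IsTest φ) (i : Fin n) :
    MemLp (fun x => ((leftDeriv α φ x i : ℝ) : ℂ)) 2 := by
  simp only [leftDeriv_apply hα' h]
  refine (memLp_conv hα hα' ?_ (h.comp_compact i).deriv).const_mul _
  exact (h.comp_contDiff i).continuous_deriv (by simp)

theorem leftDeriv_continuous (hα' : α < 1) (h : IsTest φ) : Continuous (leftDeriv α φ) := by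
  rw [funext (leftDeriv_eq hα' h)]
  exact (h.deriv.2.continuous_convolution_right (ContinuousLinearMap.lsmul ℝ ℝ)
    (locallyIntegrable_rkern hα') h.deriv.continuous).const_smul (Real.Gamma (1 - α))⁻¹

theorem leftDeriv_integrable_sq (hα : 1 / 2 < α) (hα' : α < 1) (h : IsTest φ) :
    Integrable (fun x => ‖leftDeriv α φ x‖ ^ 2) := by
  have : ∀ i, Integrable (fun x => ‖((leftDeriv α φ x i : ℝ) : ℂ)‖ ^ 2) := fun i =>
    (memLp_two_iff_integrable_sq_norm (leftDeriv_comp_memLp hα hα' h i).1).1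
      (leftDeriv_comp_memLp hα hα' h i)
  refine (integrable_finsetSum Finset.univ fun i _ => this i).congr (Eventually.of_forall fun x => ?_)
  simp [EuclideanSpace.norm_sq_eq]

theorem leftDeriv_memLp (hα : 1 / 2 < α) (hα' : α < 1) (h : IsTest φ) :
    MemLp (leftDeriv α φ) 2 :=
  (memLp_two_iff_integrable_sq_norm (leftDeriv_continuous hα' h).aestronglyMeasurable).2
    (leftDeriv_integrable_sq hα hα' h)

/-- On test functions, `‖D^α φ‖² = ∫ |ω|^(2α) |φ̂|²`. -/
theorem integral_leftDeriv_sq (hα : 1 / 2 < α) (hα' : α < 1) (h : IsTest φ) :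
    ∫ x, ‖leftDeriv α φ x‖ ^ 2 = fracEnergy α φ := by
  have hi : ∀ i, Integrable (fun x => ‖((leftDeriv α φ x i : ℝ) : ℂ)‖ ^ 2) := fun i =>
    (memLp_two_iff_integrable_sq_norm (leftDeriv_comp_memLp hα hα' h i).1).1
      (leftDeriv_comp_memLp hα hα' h i)
  have hΓ : Real.Gamma (1 - α) ≠ 0 := (Real.Gamma_pos_of_pos (by linarith)).ne'
  have e : ∀ x, ‖leftDeriv α φ x‖ ^ 2 = ∑ i, ‖((leftDeriv α φ x i : ℝ) : ℂ)‖ ^ 2 := fun x => by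
    simp [EuclideanSpace.norm_sq_eq]
  simp only [e]
  rw [integral_finsetSum _ fun i _ => hi i, h.fracEnergy_eq hα hα']
  refine Finset.sum_congr rfl fun i _ => ?_
  simp only [leftDeriv_apply hα' h, norm_mul, mul_pow, Complex.norm_real]
  rw [integral_const_mul, (integral_conv_deriv_sq hα hα' (h.comp_contDiff i) (h.comp_compact i)).2,
    norm_inv, Real.norm_eq_abs, inv_pow, sq_abs, inv_mul_cancel_left₀ (pow_ne_zero 2 hΓ)]
  rfl

/-- Sobolev inequality for vector valued test functions. -/
theorem exists_sobolev_vec (n : ℕ) (hα : 1 / 2 < α) (hα' : α < 1) :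
    ∃ C > 0, ∀ φ : ℝ → Vec n, IsTest φ →
    ∀ x, ∀ r > 0, ‖φ x‖ ^ 2 ≤ C * (r * (∫ t, ‖φ t‖ ^ 2) + r ^ (1 - 2 * α) *
      ∫ t, ‖leftDeriv α φ t‖ ^ 2) := by
  obtain ⟨C, hC, h⟩ := exists_sobolev hα hα'
  refine ⟨C, hC, fun φ hφ x r hr => ?_⟩
  rw [EuclideanSpace.norm_sq_eq, hφ.integral_norm_sq_eq, integral_leftDeriv_sq hα hα' hφ,
    hφ.fracEnergy_eq hα hα', Finset.mul_sum, Finset.mul_sum, ← Finset.sum_add_distrib, Finset.mul_sum]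
  refine Finset.sum_le_sum fun i _ => ?_
  have := h _ (hφ.comp_contDiff i) (hφ.comp_compact i) x r hr
  simpa using this

/-- Multiplication by `χ(t / m)` is bounded in the `H^α` norm, uniformly in `m ≥ 1`. -/
theorem exists_cutoff_vec (n : ℕ) (hα : 1 / 2 < α) (hα' : α < 1) :
    ∃ C > 0, ∀ m ≥ (1 : ℝ), ∀ φ : ℝ → Vec n, IsTest φ →
      ∫ t, ‖leftDeriv α (fun t => cutoff m t • φ t) t‖ ^ 2 ≤
        C * ((∫ t, ‖φ t‖ ^ 2) + ∫ t, ‖leftDeriv α φ t‖ ^ 2) := by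
  obtain ⟨C, hC, h⟩ := exists_energy_cutoff hα hα'
  refine ⟨C, hC, fun m hm φ hφ => ?_⟩
  rw [hφ.integral_norm_sq_eq, integral_leftDeriv_sq hα hα' hφ, integral_leftDeriv_sq hα hα'
    hφ.cutoff_smul, hφ.fracEnergy_eq hα hα', hφ.cutoff_smul.fracEnergy_eq hα hα',
    ← Finset.sum_add_distrib, Finset.mul_sum]
  refine Finset.sum_le_sum fun i _ => ?_
  have := h m hm _ (hφ.comp_contDiff i) (hφ.comp_compact i)
  simpa using this

end

end FracHam

namespace FracHam

/-! ### Pointwise inequalities for the potential -/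

section potential
variable {n : ℕ} {W : ℝ → Vec n → ℝ}

theorem hasFDerivAt_potential (hW : ContDiff ℝ 1 (fun p : ℝ × Vec n => W p.1 p.2)) (t : ℝ)
    (x : Vec n) : HasFDerivAt (W t) ((fderiv ℝ (fun p : ℝ × Vec n => W p.1 p.2) (t, x)).comp
      (ContinuousLinearMap.inr ℝ ℝ (Vec n))) x := by
  have h1 := (hW.differentiable one_ne_zero (t, x)).hasFDerivAt
  exact h1.comp x (hasFDerivAt_prodMk_right t x)

theorem hasFDerivAt_inner_grad (hW : ContDiff ℝ 1 (fun p : ℝ × Vec n => W p.1 p.2)) (t : ℝ)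
    (x : Vec n) : HasFDerivAt (W t) (innerSL ℝ (grad W t x)) x :=
  (hasFDerivAt_potential hW t x).differentiableAt.hasGradientAt

theorem continuous_grad (hW : ContDiff ℝ 1 (fun p : ℝ × Vec n => W p.1 p.2)) :
    Continuous fun p : ℝ × Vec n => grad W p.1 p.2 := by
  unfold grad gradient
  refine (LinearIsometryEquiv.continuous _).comp ?_
  simp only [(hasFDerivAt_potential hW _ _).fderiv]
  exact (hW.continuous_fderiv one_ne_zero).clm_comp continuous_const

theorem potential_zero (h2 : CondW2 W) (t : ℝ) : W t 0 = 0 := by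
  have h := h2.2 t 0
  unfold hFun at h
  rw [inner_zero_right] at h
  linarith [h2.1 t 0]

theorem two_potential_add (t : ℝ) (x : Vec n) :
    inner ℝ (grad W t x) x = 2 * W t x + 2 * hFun W t x := by
  unfold hFun; ring

theorem potential_le_half (h2 : CondW2 W) (t : ℝ) (x : Vec n) :
    W t x ≤ 1 / 2 * (‖grad W t x‖ * ‖x‖) := by
  have h := two_potential_add (W := W) t x
  have := real_inner_le_norm (grad W t x) x
  linarith [h2.2 t x]

/-- `W(t, s x) ≤ s² W(t, x)` for `0 < s ≤ 1`. -/
theorem potential_smul_le (hW : ContDiff ℝ 1 (fun p : ℝ × Vec n => W p.1 p.2)) (h2 : CondW2 W)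
    (t : ℝ) (x : Vec n) {s : ℝ} (hs : 0 < s) (hs1 : s ≤ 1) : W t (s • x) ≤ s ^ 2 * W t x := by
  -- The sign condition on `H` says precisely that `W(t, rx)/r²` is nondecreasing in `r > 0`.
  have hd : ∀ r > (0 : ℝ), HasDerivAt (fun r : ℝ => W t (r • x) / r ^ 2)
      (2 * hFun W t (r • x) / r ^ 3) r := by
    intro r hr
    have h1 : HasDerivAt (fun r : ℝ => r • x) ((1 : ℝ) • x) r := (hasDerivAt_id r).smul_const x
    have h3 := ((hasFDerivAt_inner_grad hW t (r • x)).comp_hasDerivAt r h1).div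
      (hasDerivAt_pow 2 r) (by positivity)
    refine h3.congr_deriv ?_
    unfold hFun
    simp only [one_smul, innerSL_apply_apply, inner_smul_right, Function.comp]
    field_simp
    push_cast
    ring
  have hm : MonotoneOn (fun r : ℝ => W t (r • x) / r ^ 2) (Set.Icc s 1) := by
    refine monotoneOn_of_deriv_nonneg (convex_Icc s 1) ?_ ?_ ?_
    · intro r hr
      exact (hd r (hs.trans_le hr.1)).continuousAt.continuousWithinAt
    · intro r hr
      rw [interior_Icc] at hr
      exact (hd r (hs.trans hr.1)).differentiableAt.differentiableWithinAt
    · intro r hr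
      rw [interior_Icc] at hr
      rw [(hd r (hs.trans hr.1)).deriv]
      have := h2.2 t (r • x)
      have := hs.trans hr.1
      positivity
  have := hm (Set.left_mem_Icc.2 hs1) (Set.right_mem_Icc.2 hs1) hs1
  simp only [one_smul, one_pow, div_one] at this
  rw [div_le_iff₀ (by positivity)] at this
  linarith

/-- Either `g ≤ K`, or `g = g^(1-σ) g^σ` with `g^(1-σ) ≤ K^(1-σ) ≤ κ`; since `σ > 1`, a large `K`
makes `κ` arbitrarily small. -/
theorem exists_young {σ κ : ℝ} (hσ : 1 < σ) (hκ : 0 < κ) :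
    ∃ K > 0, ∀ g y : ℝ, 0 ≤ g → g ^ σ ≤ y → g ≤ κ * y + K := by
  have ht : Tendsto (fun K : ℝ => K ^ (-(σ - 1))) atTop (𝓝 0) :=
    tendsto_rpow_neg_atTop (by linarith)
  obtain ⟨K, hK, hK0⟩ := ((ht.eventually (gt_mem_nhds hκ)).and (eventually_gt_atTop 0)).exists
  refine ⟨K, hK0, fun g y hg hy => ?_⟩
  have hy0 : 0 ≤ y := (Real.rpow_nonneg hg _).trans hy
  rcases le_total g K with h | h
  · have := mul_nonneg hκ.le hy0
    linarith
  · have hg0 : 0 < g := hK0.trans_le h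
    have e : g = g ^ (-(σ - 1)) * g ^ σ := by
      rw [← Real.rpow_add hg0, show -(σ - 1) + σ = 1 by ring, Real.rpow_one]
    have h1 : g ^ (-(σ - 1)) ≤ κ :=
      (Real.rpow_le_rpow_of_nonpos hK0 h (by linarith)).trans hK.le
    calc g = g ^ (-(σ - 1)) * g ^ σ := e
      _ ≤ κ * y := by gcongr
      _ ≤ _ := by linarith

/-- The form in which (W₄) is used: the coefficient of `H` can be made as small as desired, so the
term multiplied by `H` can later be absorbed. Outside the ball of radius `R` this is `exists_young`
applied to `|∇W|/|x|`; inside, scaling reduces to the sphere. -/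
theorem exists_potential_le (hW : ContDiff ℝ 1 (fun p : ℝ × Vec n => W p.1 p.2))
    (h2 : CondW2 W) (h4 : CondW4 W) {κ : ℝ} (hκ : 0 < κ) :
    ∃ K > 0, ∀ t x, W t x ≤ (κ * hFun W t x + K) * ‖x‖ ^ 2 := by
  obtain ⟨C₀, hC₀, R, hR, σ, hσ, h⟩ := h4
  have hgrow : ∀ μ > 0, ∃ K > 0, ∀ t (x : Vec n), R ≤ ‖x‖ →
      ‖grad W t x‖ ≤ (μ * hFun W t x + K) * ‖x‖ := by
    intro μ hμ
    obtain ⟨K, hK, hy⟩ := exists_young hσ (div_pos hμ hC₀)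
    refine ⟨K, hK, fun t x hx => ?_⟩
    have hx0 : 0 < ‖x‖ := hR.trans_le hx
    have := hy (‖grad W t x‖ / ‖x‖) (C₀ * hFun W t x) (by positivity)
      (by rw [Real.div_rpow (norm_nonneg _) (norm_nonneg _)]; exact h t x hx)
    rw [← mul_assoc, div_mul_cancel₀ _ hC₀.ne', div_le_iff₀ hx0] at this
    exact this
  obtain ⟨K₁, hK₁, h₁⟩ := hgrow κ hκ
  obtain ⟨K₂, hK₂, h₂⟩ := hgrow (1 / R ^ 2) (by positivity)
  -- Continuity of `W` would give a bound only locally in `t`. With the choice `μ = 1/R²` the term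
  -- in `H` is absorbed by `2W + 2H = (∇W, x)`, which gives a bound uniform in `t`.
  have hsphere : ∀ t (x : Vec n), ‖x‖ = R → W t x ≤ K₂ * R ^ 2 := by
    intro t x hx
    have e := h₂ t x hx.ge
    have i := real_inner_le_norm (grad W t x) x
    rw [two_potential_add] at i
    rw [hx] at e i
    have hH := h2.2 t x
    have hW0 := h2.1 t x
    have e' : ‖grad W t x‖ * R ≤ hFun W t x + K₂ * R ^ 2 := by
      have := mul_le_mul_of_nonneg_right e hR.le
      have e3 : (1 / R ^ 2 * hFun W t x + K₂) * R * R = hFun W t x + K₂ * R ^ 2 := by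
        field_simp
      linarith
    linarith
  refine ⟨K₁ + K₂, by positivity, fun t x => ?_⟩
  have hH := h2.2 t x
  rcases le_total R ‖x‖ with hx | hx
  · calc W t x ≤ 1 / 2 * (‖grad W t x‖ * ‖x‖) := potential_le_half h2 t x
      _ ≤ 1 / 2 * (((κ * hFun W t x + K₁) * ‖x‖) * ‖x‖) := by gcongr; exact h₁ t x hx
      _ ≤ _ := by nlinarith [mul_nonneg (mul_nonneg hκ.le hH) (sq_nonneg ‖x‖), sq_nonneg ‖x‖,
          mul_nonneg hK₁.le (sq_nonneg ‖x‖), mul_nonneg hK₂.le (sq_nonneg ‖x‖)]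
  · rcases eq_or_ne x 0 with rfl | hx0
    · rw [potential_zero h2]; simp
    · have hn : 0 < ‖x‖ := norm_pos_iff.2 hx0
      have e := potential_smul_le hW h2 t ((R / ‖x‖) • x) (s := ‖x‖ / R) (by positivity)
        ((div_le_one hR).2 hx)
      rw [smul_smul, show ‖x‖ / R * (R / ‖x‖) = 1 by field_simp, one_smul] at e
      have e2 := hsphere t ((R / ‖x‖) • x) (by
        rw [norm_smul, Real.norm_of_nonneg (by positivity), div_mul_cancel₀ _ hn.ne'])
      calc W t x ≤ (‖x‖ / R) ^ 2 * (K₂ * R ^ 2) := e.trans (by gcongr)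
        _ = K₂ * ‖x‖ ^ 2 := by field_simp
        _ ≤ _ := by nlinarith [mul_nonneg (mul_nonneg hκ.le hH) (sq_nonneg ‖x‖),
            mul_nonneg hK₁.le (sq_nonneg ‖x‖)]

end potential

/-! ### Mountain pass in finite dimension -/

section mountainPass
variable {E : Type*} [NormedAddCommGroup E] [InnerProductSpace ℝ E]

/-- One explicit gradient step replaces the gradient flow. As long as `G` moves by at most half its
length, `f(u - tG) + t‖G‖²/2` has nonpositive derivative in `t`. -/
theorem descent_step {f : E → ℝ} {G : E → E} (hf : ∀ u, HasFDerivAt f (innerSL ℝ (G u)) u)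
    {u : E} {τ : ℝ} (h : ∀ t ∈ Set.Icc 0 τ, ‖G (u - t • G u) - G u‖ ≤ ‖G u‖ / 2) :
    ∀ t ∈ Set.Icc 0 τ, f (u - t • G u) ≤ f u - t * (‖G u‖ ^ 2 / 2) := by
  intro t ht
  have hd : ∀ t, HasDerivAt (fun t : ℝ => f (u - t • G u) + t * (‖G u‖ ^ 2 / 2))
      (inner ℝ (G (u - t • G u)) (-G u) + ‖G u‖ ^ 2 / 2) t := by
    intro t
    have h1 : HasDerivAt (fun t : ℝ => u - t • G u) (-((1 : ℝ) • G u)) t :=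
      ((hasDerivAt_id t).smul_const (G u)).const_sub u
    have h2 := (hf (u - t • G u)).comp_hasDerivAt t h1
    have h3 : HasDerivAt (fun t : ℝ => t * (‖G u‖ ^ 2 / 2)) (1 * (‖G u‖ ^ 2 / 2)) t :=
      (hasDerivAt_id t).mul_const _
    refine (h2.add h3).congr_deriv ?_
    simp
  have ha : AntitoneOn (fun t : ℝ => f (u - t • G u) + t * (‖G u‖ ^ 2 / 2)) (Set.Icc 0 τ) := by
    refine antitoneOn_of_deriv_nonpos (convex_Icc 0 τ)
      (fun t _ => (hd t).continuousAt.continuousWithinAt)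
      (fun t _ => (hd t).differentiableAt.differentiableWithinAt) fun t ht => ?_
    rw [(hd t).deriv]
    have h1 := h t (interior_subset ht)
    have h2 : inner ℝ (G (u - t • G u)) (-G u) = -‖G u‖ ^ 2 - inner ℝ (G (u - t • G u) - G u) (G u) := by
      rw [inner_neg_right, inner_sub_left, real_inner_self_eq_norm_sq]; ring
    have h3 := abs_real_inner_le_norm (G (u - t • G u) - G u) (G u)
    have h4 := neg_abs_le (inner ℝ (G (u - t • G u) - G u) (G u))
    have h5 : ‖G (u - t • G u) - G u‖ * ‖G u‖ ≤ ‖G u‖ / 2 * ‖G u‖ := by gcongr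
    rw [h2]
    nlinarith
  have := ha (Set.left_mem_Icc.2 (ht.1.trans ht.2)) ht ht.1
  simp only [zero_smul, sub_zero, zero_mul, add_zero] at this
  linarith

/-- Mountain pass theorem in a finite dimensional space, for a function with bounded
superlevel set `{f ≥ 0}`. -/
theorem exists_mountain_pass [FiniteDimensional ℝ E] {f : E → ℝ} {G : E → E}
    (hf : ∀ u, HasFDerivAt f (innerSL ℝ (G u)) u) (hG : Continuous G) {q : E → ℝ}
    (hq : Continuous q) (hq0 : q 0 = 0) {ρ c₀ M : ℝ} (hρ : 0 < ρ) (hc₀ : 0 < c₀)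
    (hgeo : ∀ u, q u = ρ → c₀ ≤ f u) (hf0 : f 0 ≤ 0) {e : E} (he : ρ ≤ q e) (hfe : f e ≤ 0)
    (hb : Bornology.IsBounded {u | 0 ≤ f u}) (hM : ∀ s ∈ Set.Icc (0 : ℝ) 1, f (s • e) ≤ M) :
    ∃ u, G u = 0 ∧ c₀ ≤ f u ∧ f u ≤ M := by
  have hfc : Continuous f := continuous_iff_continuousAt.2 fun u => (hf u).continuousAt
  set A : Set ℝ := {a | ∃ γ : ℝ → E, Continuous γ ∧ γ 0 = 0 ∧ γ 1 = e ∧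
    ∀ s ∈ Set.Icc (0 : ℝ) 1, f (γ s) ≤ a} with hA
  have hAM : M ∈ A := ⟨fun s => s • e, by fun_prop, by simp, by simp, hM⟩
  have hAlb : ∀ a ∈ A, c₀ ≤ a := by
    rintro a ⟨γ, hγ, h0, h1, ha⟩
    obtain ⟨s, hs, hs'⟩ := intermediate_value_Icc (zero_le_one (α := ℝ))
      (hq.comp hγ).continuousOn (show ρ ∈ Set.Icc ((q ∘ γ) 0) ((q ∘ γ) 1) by
        simp only [Function.comp, h0, h1, hq0]; exact ⟨hρ.le, he⟩)
    exact (hgeo _ hs').trans (ha s hs)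
  have hAbdd : BddBelow A := ⟨c₀, hAlb⟩
  set c := sInf A with hc
  have hcM : c ≤ M := csInf_le hAbdd hAM
  have hc0 : c₀ ≤ c := le_csInf ⟨M, hAM⟩ hAlb
  by_contra hcon
  push Not at hcon
  have hK : IsCompact {u | 0 ≤ f u} :=
    Metric.isCompact_of_isClosed_isBounded (isClosed_le continuous_const hfc) hb
  -- Compactness of `{f ≥ 0}` plays the role of the Palais-Smale condition: with no critical point
  -- at level `c`, `|f - c| + ‖G‖` has a positive minimum there.
  obtain ⟨μ, hμ, hμK⟩ : ∃ μ > 0, ∀ u, 0 ≤ f u → μ ≤ |f u - c| + ‖G u‖ := by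
    rcases Set.eq_empty_or_nonempty {u | 0 ≤ f u} with h | h
    · exact ⟨1, one_pos, fun u hu => absurd (show u ∈ {u | 0 ≤ f u} from hu) (by simp [h])⟩
    · obtain ⟨u, hu, hmin⟩ := hK.exists_isMinOn h
        (f := fun u => |f u - c| + ‖G u‖) (by fun_prop)
      refine ⟨_, ?_, fun v hv => hmin hv⟩
      by_contra hle
      push Not at hle
      have h1 := abs_nonneg (f u - c)
      have h2 := norm_nonneg (G u)
      have h3 : |f u - c| = 0 := by linarith
      have h4 : ‖G u‖ = 0 := by linarith
      rw [abs_eq_zero, sub_eq_zero] at h3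
      have := hcon u (norm_eq_zero.1 h4) (by rw [h3]; exact hc0)
      linarith
  -- The bound by `c` keeps the band `|f - c| ≤ ε₀` inside `{f ≥ 0}` and above the endpoints; the
  -- bound by `μ/2` leaves `‖G‖ ≥ μ/2` on the band.
  set ε₀ := min (μ / 2) c with hε₀
  have hcpos : 0 < c := hc₀.trans_le hc0
  have hε₀pos : 0 < ε₀ := lt_min (by linarith) hcpos
  set κ := μ / 2 with hκ
  have hκpos : 0 < κ := by positivity
  have hGκ : ∀ u, |f u - c| ≤ ε₀ → κ ≤ ‖G u‖ := by
    intro u hu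
    have h1 : ε₀ ≤ c := min_le_right _ _
    have h2 : ε₀ ≤ μ / 2 := min_le_left _ _
    have := hμK u (by linarith [neg_abs_le (f u - c)])
    linarith
  obtain ⟨R, hR⟩ := hb.subset_closedBall 0
  have hcomp : IsCompact (Metric.closedBall (0 : E) (R + 1)) := isCompact_closedBall _ _
  obtain ⟨B, hB⟩ := hcomp.exists_bound_of_continuousOn hG.continuousOn
  obtain ⟨δ, hδ, hδG⟩ := Metric.uniformContinuousOn_iff.1
    (hcomp.uniformContinuousOn_of_continuous hG.continuousOn) (κ / 2) (by positivity)
  -- A step of length below `min 1 δ` stays in the ball of radius `R + 1` and changes `G` by less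
  -- than `κ/2 ≤ ‖G‖/2`.
  set τ := min 1 δ / (2 * (|B| + 1)) with hτ
  have hτpos : 0 < τ := by positivity
  have hτs : ∀ u, 0 ≤ f u → ∀ t ∈ Set.Icc 0 τ, ‖t • G u‖ < min 1 δ := by
    intro u hu t ht
    have hu' := hR hu
    have h1 : ‖G u‖ ≤ |B| := (hB u (Metric.closedBall_subset_closedBall (by linarith) hu')).trans
      (le_abs_self B)
    rw [norm_smul, Real.norm_of_nonneg ht.1]
    calc t * ‖G u‖ ≤ τ * (|B| + 1) := by
          gcongr
          · exact ht.2
          · linarith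
      _ = min 1 δ / 2 := by rw [hτ]; field_simp
      _ < min 1 δ := half_lt_self (by positivity)
  have hstep : ∀ u, |f u - c| ≤ ε₀ → ∀ t ∈ Set.Icc 0 τ,
      f (u - t • G u) ≤ f u - t * (κ ^ 2 / 2) := by
    intro u hu t ht
    have hκu := hGκ u hu
    have hu0 : 0 ≤ f u := by
      have h1 : ε₀ ≤ c := min_le_right _ _
      linarith [neg_abs_le (f u - c)]
    have := descent_step hf (u := u) (τ := τ) (fun t ht => ?_) t ht
    · have h2 : t * (κ ^ 2 / 2) ≤ t * (‖G u‖ ^ 2 / 2) := by have := ht.1; gcongr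
      linarith
    · have hs := hτs u hu0 t ht
      have hu' := hR hu0
      rw [mem_closedBall_zero_iff] at hu'
      have := hδG (u - t • G u) ?_ u ?_ ?_
      · rw [dist_eq_norm] at this
        linarith
      · rw [mem_closedBall_zero_iff]
        have := norm_sub_le u (t • G u)
        linarith [hs.trans_le (min_le_left 1 δ)]
      · rw [mem_closedBall_zero_iff]; linarith
      · rw [dist_eq_norm]
        have := hs.trans_le (min_le_right 1 δ)
        simpa using this
  -- Equal to `0` below `c - ε₀`, so the endpoints of the path stay fixed, and to `1` above `c -
  -- ε₀/2`.
  set η : E → ℝ := fun u => max 0 (min 1 (2 * (f u - (c - ε₀)) / ε₀)) with hη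
  have hηc : Continuous η := by fun_prop
  have hη0 : ∀ u, 0 ≤ η u := fun u => le_max_left _ _
  have hη1 : ∀ u, η u ≤ 1 := fun u => max_le zero_le_one (min_le_left _ _)
  -- A full step lowers `f` by at least `τκ²/2`, twice the second bound: from below `c + τκ²/4` it
  -- reaches at most `c - τκ²/4`.
  set ε := min ε₀ (τ * (κ ^ 2 / 4)) with hε
  have hεpos : 0 < ε := lt_min hε₀pos (by positivity)
  obtain ⟨a, ⟨γ, hγ, h0, h1, ha⟩, hac⟩ := exists_lt_of_csInf_lt ⟨M, hAM⟩
    (show sInf A < c + ε by linarith)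
  have hend : ∀ u, f u ≤ 0 → η u = 0 := by
    intro u hu
    have h3 : ε₀ ≤ c := min_le_right _ _
    refine max_eq_left ((min_le_right _ _).trans ?_)
    refine div_nonpos_of_nonpos_of_nonneg (by linarith) hε₀pos.le
  have hnew : max (c - τ * (κ ^ 2 / 4)) (c - ε₀ / 2) ∈ A := by
    refine ⟨fun s => γ s - (τ * η (γ s)) • G (γ s), by fun_prop, ?_, ?_, ?_⟩
    · simp only [h0, hend 0 hf0]; simp
    · simp only [h1, hend e hfe]; simp
    · intro s hs
      have hle := ha s hs
      have hmem : τ * η (γ s) ∈ Set.Icc 0 τ :=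
        ⟨mul_nonneg hτpos.le (hη0 _), mul_le_of_le_one_right hτpos.le (hη1 _)⟩
      have hεε : ε ≤ ε₀ := min_le_left _ _
      have hετ : ε ≤ τ * (κ ^ 2 / 4) := min_le_right _ _
      rcases lt_or_ge (f (γ s)) (c - ε₀) with h | h
      · have hz : η (γ s) = 0 := by
          refine max_eq_left ((min_le_right _ _).trans ?_)
          exact div_nonpos_of_nonpos_of_nonneg (by linarith) hε₀pos.le
        simp only [hz, mul_zero, zero_smul, sub_zero]
        exact (by linarith : f (γ s) ≤ c - ε₀ / 2).trans (le_max_right _ _)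
      · have habs : |f (γ s) - c| ≤ ε₀ := abs_le.2 ⟨by linarith, by linarith⟩
        have hst := hstep _ habs _ hmem
        rcases lt_or_ge (f (γ s)) (c - ε₀ / 2) with h' | h'
        · have : 0 ≤ τ * η (γ s) * (κ ^ 2 / 2) := mul_nonneg hmem.1 (by positivity)
          exact (by linarith : _ ≤ c - ε₀ / 2).trans (le_max_right _ _)
        · have hone : η (γ s) = 1 := by
            have : 1 ≤ 2 * (f (γ s) - (c - ε₀)) / ε₀ := by
              rw [le_div_iff₀ hε₀pos]; linarith
            simp only [hη]
            rw [min_eq_left this]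
            simp
          rw [hone, mul_one] at hst
          simp only [hone, mul_one]
          refine le_trans ?_ (le_max_left _ _)
          linarith
  have := csInf_le hAbdd hnew
  have hlt : max (c - τ * (κ ^ 2 / 4)) (c - ε₀ / 2) < c :=
    max_lt (by linarith [show 0 < τ * (κ ^ 2 / 4) by positivity]) (by linarith)
  linarith

end mountainPass
end FracHam

/-! ### The closed graph of the fractional derivative and weak limits -/

namespace FracHam

/-- Sequential weak compactness of bounded sequences in a separable Hilbert space. -/
theorem exists_weak_subseq {H : Type*} [NormedAddCommGroup H] [InnerProductSpace ℝ H]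
    [CompleteSpace H] [SecondCountableTopology H] (x : ℕ → H) {B : ℝ} (hB : ∀ k, ‖x k‖ ≤ B) :
    ∃ (g : ℕ → ℕ) (p : H), StrictMono g ∧ ∀ f : H →L[ℝ] ℝ,
      Tendsto (fun k => f (x (g k))) atTop (𝓝 (f p)) := by
  -- Sequential Banach-Alaoglu in the dual, transported to `H` by the Riesz isomorphism.
  have hseq := WeakDual.isSeqCompact_closedBall ℝ H (0 : StrongDual ℝ H) B
  obtain ⟨ℓ, -, g, hg, hlim⟩ := hseq (x := fun k => StrongDual.toWeakDual
    (InnerProductSpace.toDual ℝ H (x k))) (fun k => by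
      change InnerProductSpace.toDual ℝ H (x k) ∈ Metric.closedBall _ _
      rw [mem_closedBall_zero_iff, LinearIsometryEquiv.norm_map]
      exact hB k)
  refine ⟨g, (InnerProductSpace.toDual ℝ H).symm (WeakDual.toStrongDual ℓ), hg, fun f => ?_⟩
  have h := (tendsto_iff_forall_eval_tendsto_topDualPairing.1 hlim)
    ((InnerProductSpace.toDual ℝ H).symm f)
  have e1 : ∀ y : H, f y = inner ℝ ((InnerProductSpace.toDual ℝ H).symm f) y := fun y => by
    rw [InnerProductSpace.toDual_symm_apply]
  simp only [e1]
  have e2 : inner ℝ ((InnerProductSpace.toDual ℝ H).symm f)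
      ((InnerProductSpace.toDual ℝ H).symm (WeakDual.toStrongDual ℓ)) =
      ℓ ((InnerProductSpace.toDual ℝ H).symm f) := by
    rw [real_inner_comm, InnerProductSpace.toDual_symm_apply]; rfl
  rw [e2]
  refine h.congr fun k => ?_
  change inner ℝ (x (g k)) _ = _
  rw [real_inner_comm]

section
variable {n : ℕ}

/-- Square integrable vector valued functions on the line. -/
abbrev LTwo (n : ℕ) : Type := Lp (Vec n) 2 (volume : Measure ℝ)

theorem norm_toLp_sq {u : ℝ → Vec n} (hu : MemLp u 2) : ‖hu.toLp u‖ ^ 2 = ∫ t, ‖u t‖ ^ 2 := by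
  rw [← real_inner_self_eq_norm_sq, L2.inner_def]
  refine integral_congr_ae ?_
  filter_upwards [hu.coeFn_toLp] with t ht
  rw [ht, real_inner_self_eq_norm_sq]

theorem eLpNorm_two_eq {u : ℝ → Vec n} (hu : MemLp u 2) :
    eLpNorm u 2 volume = ENNReal.ofReal (Real.sqrt (∫ t, ‖u t‖ ^ 2)) := by
  rw [← norm_toLp_sq hu, Real.sqrt_sq (norm_nonneg _), Lp.norm_toLp,
    ENNReal.ofReal_toReal hu.eLpNorm_ne_top]

theorem tendsto_eLpNorm_iff {ι : Type*} {F : Filter ι} {u : ι → ℝ → Vec n}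
    (hu : ∀ i, MemLp (u i) 2) :
    Tendsto (fun i => eLpNorm (u i) 2 volume) F (𝓝 0) ↔
      Tendsto (fun i => ∫ t, ‖u i t‖ ^ 2) F (𝓝 0) := by
  simp only [eLpNorm_two_eq (hu _)]
  constructor
  · intro h
    have h1 := (ENNReal.tendsto_toReal ENNReal.zero_ne_top).comp h
    simp only [Function.comp_def, ENNReal.toReal_ofReal (Real.sqrt_nonneg _),
      ENNReal.toReal_zero] at h1
    have h2 := h1.pow 2
    simpa [Real.sq_sqrt (integral_nonneg fun _ => sq_nonneg _)] using h2
  · intro h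
    have h1 := (Real.continuous_sqrt.tendsto 0).comp h
    rw [Real.sqrt_zero] at h1
    simpa using ENNReal.tendsto_ofReal h1

theorem integral_add_sq_le {u v : ℝ → Vec n} (hu : MemLp u 2) (hv : MemLp v 2) :
    ∫ t, ‖u t + v t‖ ^ 2 ≤ 2 * (∫ t, ‖u t‖ ^ 2) + 2 * ∫ t, ‖v t‖ ^ 2 := by
  have h1 := (memLp_two_iff_integrable_sq_norm hu.1).1 hu
  have h2 := (memLp_two_iff_integrable_sq_norm hv.1).1 hv
  have h3 := (memLp_two_iff_integrable_sq_norm (hu.add hv).1).1 (hu.add hv)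
  rw [← integral_const_mul, ← integral_const_mul, ← integral_add (h1.const_mul 2) (h2.const_mul 2)]
  refine integral_mono h3 ((h1.const_mul 2).add (h2.const_mul 2)) fun t => ?_
  have := norm_add_le (u t) (v t)
  dsimp only
  nlinarith [norm_nonneg (u t + v t), sq_nonneg (‖u t‖ - ‖v t‖), norm_nonneg (u t), norm_nonneg (v t)]

theorem integral_sub_sq_le {u v : ℝ → Vec n} (hu : MemLp u 2) (hv : MemLp v 2) :
    ∫ t, ‖u t - v t‖ ^ 2 ≤ 2 * (∫ t, ‖u t‖ ^ 2) + 2 * ∫ t, ‖v t‖ ^ 2 := by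
  have := integral_add_sq_le hu hv.neg
  simpa [sub_eq_add_neg] using this

/-- The space of test functions. -/
def testSpace (n : ℕ) : Submodule ℝ (ℝ → Vec n) where
  carrier := {φ | IsTest φ}
  add_mem' := fun h h' => IsTest.add h h'
  zero_mem' := IsTest.zero
  smul_mem' := fun c _ h => IsTest.smul c h

variable {α : ℝ}

/-- The graph map `φ ↦ (φ, D^α φ)`. -/
noncomputable def graphMap (n : ℕ) (hα : 1 / 2 < α) (hα' : α < 1) :
    testSpace n →ₗ[ℝ] WithLp 2 (LTwo n × LTwo n) where
  toFun φ := WithLp.toLp 2 ((IsTest.memLp φ.2 2).toLp φ.1, (leftDeriv_memLp hα hα' φ.2).toLp _)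
  map_add' φ ψ := by
    rw [← WithLp.toLp_add, Prod.mk_add_mk, ← MemLp.toLp_add, ← MemLp.toLp_add]
    congr 2
    refine (MemLp.toLp_eq_toLp_iff _ _).2 (Eventually.of_forall fun t => ?_)
    exact congrFun (leftDeriv_add hα' φ.2 ψ.2) t
  map_smul' c φ := by
    rw [RingHom.id_apply, ← WithLp.toLp_smul, Prod.smul_mk, ← MemLp.toLp_const_smul,
      ← MemLp.toLp_const_smul]
    congr 2
    refine (MemLp.toLp_eq_toLp_iff _ _).2 (Eventually.of_forall fun t => ?_)
    exact congrFun (leftDeriv_smul hα' c φ.2) t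

theorem norm_graphMap_sq (hα : 1 / 2 < α) (hα' : α < 1) (φ : testSpace n) :
    ‖graphMap n hα hα' φ‖ ^ 2 = (∫ t, ‖φ.1 t‖ ^ 2) + ∫ t, ‖leftDeriv α φ.1 t‖ ^ 2 := by
  rw [WithLp.prod_norm_sq_eq_of_L2]
  congr 1
  · exact norm_toLp_sq (IsTest.memLp φ.2 2)
  · exact norm_toLp_sq (leftDeriv_memLp hα hα' φ.2)

/-- The graph of the closure of `D^α` in `L² × L²`. -/
abbrev graphSpace (n : ℕ) (hα : 1 / 2 < α) (hα' : α < 1) : Type :=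
  (LinearMap.range (graphMap n hα hα')).topologicalClosure

instance (hα : 1 / 2 < α) (hα' : α < 1) : CompleteSpace (graphSpace n hα hα') :=
  (Submodule.isClosed_topologicalClosure (LinearMap.range (graphMap n hα hα'))).completeSpace_coe

instance : SecondCountableTopology (LTwo n) :=
  haveI : Fact ((2 : ℝ≥0∞) ≠ ∞) := ⟨by simp⟩
  Lp.SecondCountableTopology

instance (hα : 1 / 2 < α) (hα' : α < 1) : SecondCountableTopology (graphSpace n hα hα') :=
  TopologicalSpace.Subtype.secondCountableTopology _

/-- The graph map into the closed graph. -/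
noncomputable def toGraph (n : ℕ) (hα : 1 / 2 < α) (hα' : α < 1) :
    testSpace n →ₗ[ℝ] graphSpace n hα hα' :=
  (graphMap n hα hα').codRestrict _ fun φ =>
    Submodule.le_topologicalClosure _ (LinearMap.mem_range_self _ φ)

theorem norm_toGraph_sq (hα : 1 / 2 < α) (hα' : α < 1) (φ : testSpace n) :
    ‖toGraph n hα hα' φ‖ ^ 2 = (∫ t, ‖φ.1 t‖ ^ 2) + ∫ t, ‖leftDeriv α φ.1 t‖ ^ 2 :=
  norm_graphMap_sq hα hα' φ

theorem denseRange_toGraph (hα : 1 / 2 < α) (hα' : α < 1) :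
    DenseRange (toGraph n hα hα') := by
  intro p
  have hp : (p : WithLp 2 (LTwo n × LTwo n)) ∈ closure (Set.range (graphMap n hα hα')) := by
    have := p.2
    rwa [← SetLike.mem_coe, Submodule.topologicalClosure_coe, LinearMap.coe_range] at this
  rw [closure_subtype]
  rwa [← Set.range_comp]

/-- Evaluation at a point. -/
noncomputable def evalTest (n : ℕ) (x : ℝ) : testSpace n →ₗ[ℝ] Vec n :=
  (LinearMap.proj x).comp (testSpace n).subtype

/-- The Sobolev inequality at scale `r = 1`. Point evaluations thereby extend to the closed graph
with a common norm bound, so weak convergence there implies pointwise convergence. -/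
theorem exists_norm_eval_le (n : ℕ) (hα : 1 / 2 < α) (hα' : α < 1) :
    ∃ C > 0, ∀ x, ∀ φ : testSpace n, ‖evalTest n x φ‖ ≤ C * ‖toGraph n hα hα' φ‖ := by
  obtain ⟨C, hC, h⟩ := exists_sobolev_vec n hα hα'
  refine ⟨Real.sqrt C, Real.sqrt_pos.2 hC, fun x φ => ?_⟩
  have h1 := h φ.1 φ.2 x 1 one_pos
  rw [Real.one_rpow, one_mul, one_mul, ← norm_toGraph_sq hα hα'] at h1
  refine (abs_le_of_sq_le_sq' ?_ (by positivity)).2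
  rw [mul_pow, Real.sq_sqrt hC.le]
  exact h1

/-- A sequence of test functions bounded in `H^α` has a subsequence which converges pointwise to
a continuous function vanishing at infinity, with weak convergence of the fractional derivatives. -/
theorem exists_weak_limit (hα : 1 / 2 < α) (hα' : α < 1) {φ : ℕ → ℝ → Vec n}
    (hφ : ∀ k, IsTest (φ k)) {B : ℝ} (h1 : ∀ k, ∫ t, ‖φ k t‖ ^ 2 ≤ B)
    (h2 : ∀ k, ∫ t, ‖leftDeriv α (φ k) t‖ ^ 2 ≤ B) :
    ∃ (g : ℕ → ℕ) (u v : ℝ → Vec n), StrictMono g ∧ HasLeftDeriv α u v ∧ Continuous u ∧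
      Tendsto u (cocompact ℝ) (𝓝 0) ∧ (∀ t, Tendsto (fun k => φ (g k) t) atTop (𝓝 (u t))) ∧
      ∀ w, MemLp w 2 → Tendsto (fun k => ∫ t, inner ℝ (leftDeriv α (φ (g k)) t) (w t)) atTop
        (𝓝 (∫ t, inner ℝ (v t) (w t))) := by
  have hdense := denseRange_toGraph (n := n) hα hα'
  obtain ⟨C, hC, hev⟩ := exists_norm_eval_le n hα hα'
  set Φ : ℕ → testSpace n := fun k => ⟨φ k, hφ k⟩ with hΦ
  have hBn : ∀ k, ‖toGraph n hα hα' (Φ k)‖ ≤ Real.sqrt (2 * B) := fun k => by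
    refine Real.le_sqrt_of_sq_le ?_
    rw [norm_toGraph_sq]
    linarith [h1 k, h2 k]
  obtain ⟨g, p, hg, hp⟩ := exists_weak_subseq (fun k => toGraph n hα hα' (Φ k)) hBn
  set ev : ℝ → graphSpace n hα hα' →L[ℝ] Vec n := fun x =>
    (evalTest n x).extendOfNorm (toGraph n hα hα') with hevdef
  have hev1 : ∀ x (ψ : testSpace n), ev x (toGraph n hα hα' ψ) = ψ.1 x := fun x ψ =>
    LinearMap.extendOfNorm_eq hdense ⟨C, hev x⟩ ψ
  have hev2 : ∀ x q, ‖ev x q‖ ≤ C * ‖q‖ := fun x q =>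
    LinearMap.norm_extendOfNorm_apply_le hdense C (hev x) q
  obtain ⟨ψ, hψ⟩ : ∃ ψ : ℕ → testSpace n, Tendsto (fun j => toGraph n hα hα' (ψ j)) atTop (𝓝 p) := by
    obtain ⟨y, hy, hlim⟩ := mem_closure_iff_seq_limit.1 (hdense p)
    choose ψ hψ using hy
    exact ⟨ψ, by simpa only [hψ] using hlim⟩
  -- The evaluations share one norm bound, so graph convergence of test functions is uniform on the
  -- line; continuity and decay at infinity of the limit follow.
  have hunif : TendstoUniformly (fun j => (ψ j).1) (fun x => ev x p) atTop := by
    rw [Metric.tendstoUniformly_iff]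
    intro ε hε
    have h3 : Tendsto (fun j => C * ‖p - toGraph n hα hα' (ψ j)‖) atTop (𝓝 0) := by
      have := (tendsto_const_nhds (x := p)).sub hψ
      simpa using this.norm.const_mul C
    filter_upwards [h3.eventually (gt_mem_nhds hε)] with j hj x
    rw [dist_eq_norm, ← hev1, ← map_sub]
    exact (hev2 _ _).trans_lt hj
  set u : ℝ → Vec n := fun x => ev x p with hu
  set P : WithLp 2 (LTwo n × LTwo n) := p.1 with hP
  have hψP : Tendsto (fun j => graphMap n hα hα' (ψ j)) atTop (𝓝 P) :=
    (continuous_subtype_val.tendsto p).comp hψ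
  have hψ1 : Tendsto (fun j => (IsTest.memLp (ψ j).2 2).toLp (ψ j).1) atTop (𝓝 P.fst) :=
    ((WithLp.continuous_fst 2 _ _).tendsto P).comp hψP
  have hψ2 : Tendsto (fun j => (leftDeriv_memLp hα hα' (ψ j).2).toLp _) atTop (𝓝 P.snd) :=
    ((WithLp.continuous_snd 2 _ _).tendsto P).comp hψP
  have hψ1' : Tendsto (fun j => eLpNorm ((ψ j).1 - (P.fst : ℝ → Vec n)) 2 volume) atTop (𝓝 0) := by
    rw [← Lp.tendsto_Lp_iff_tendsto_eLpNorm'' (fun j => (ψ j).1) (fun j => IsTest.memLp (ψ j).2 2)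
      (P.fst : ℝ → Vec n) (Lp.memLp _), Lp.toLp_coeFn]
    exact hψ1
  have hψ2' : Tendsto (fun j => eLpNorm (leftDeriv α (ψ j).1 - (P.snd : ℝ → Vec n)) 2 volume) atTop (𝓝 0) := by
    rw [← Lp.tendsto_Lp_iff_tendsto_eLpNorm'' (fun j => leftDeriv α (ψ j).1)
      (fun j => leftDeriv_memLp hα hα' (ψ j).2) (P.snd : ℝ → Vec n) (Lp.memLp _), Lp.toLp_coeFn]
    exact hψ2
  -- The pointwise representative is matched with the `L²` component through an almost everywhere
  -- convergent subsequence.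
  have hae : u =ᵐ[volume] (P.fst : ℝ → Vec n) := by
    have hm := tendstoInMeasure_of_tendsto_eLpNorm (p := 2) (μ := volume) (by simp)
      (fun j => (IsTest.memLp (ψ j).2 2).1) (Lp.memLp P.fst).1 hψ1'
    obtain ⟨s, hs, hs'⟩ := hm.exists_seq_tendsto_ae
    filter_upwards [hs'] with x hx
    exact tendsto_nhds_unique ((hunif.tendsto_at x).comp hs.tendsto_atTop) hx
  refine ⟨g, u, (P.snd : ℝ → Vec n), hg, ⟨?_, Lp.memLp _, fun j => (ψ j).1, fun j => (ψ j).2, ?_, hψ2'⟩, ?_, ?_,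
    ?_, ?_⟩
  · exact (memLp_congr_ae hae).2 (Lp.memLp _)
  · refine hψ1'.congr fun j => ?_
    refine eLpNorm_congr_ae ?_
    filter_upwards [hae] with x hx
    simp [hx]
  · exact hunif.continuous (Eventually.of_forall fun j => IsTest.continuous (ψ j).2).frequently
  · rw [Metric.tendsto_nhds]
    intro ε hε
    obtain ⟨j, hj⟩ := (Metric.tendstoUniformly_iff.1 hunif ε hε).exists
    filter_upwards [(ψ j).2.2.isCompact.compl_mem_cocompact] with x hx
    have := hj x
    rwa [image_eq_zero_of_notMem_tsupport hx] at this
  · intro t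
    have : ∀ i, Tendsto (fun k => (φ (g k) t) i) atTop (𝓝 (u t i)) := by
      intro i
      have := hp ((EuclideanSpace.proj (𝕜 := ℝ) i).comp (ev t))
      simp only [ContinuousLinearMap.comp_apply, hev1] at this
      exact this
    have h3 := (PiLp.continuous_toLp 2 (fun _ : Fin n => ℝ)).tendsto (u t).ofLp |>.comp
      (tendsto_pi_nhds.2 this)
    exact h3
  · intro w hw
    have := hp (((innerSL ℝ (hw.toLp w)).comp (WithLp.sndL 2 ℝ (LTwo n) (LTwo n))).comp
      (Submodule.subtypeL _))
    have e : ∀ (y : ℝ → Vec n) (hy : MemLp y 2), inner ℝ (hw.toLp w) (hy.toLp y) =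
        ∫ t, inner ℝ (y t) (w t) := by
      intro y hy
      rw [L2.inner_def]
      refine integral_congr_ae ?_
      filter_upwards [hw.coeFn_toLp, hy.coeFn_toLp] with t ht ht'
      rw [ht, ht', real_inner_comm]
    rw [← e _ (Lp.memLp P.snd), Lp.toLp_coeFn]
    refine this.congr fun k => ?_
    rw [← e _ (leftDeriv_memLp hα hα' (hφ (g k)))]
    rfl

/-- The fractional energy of a difference of test functions is the squared `L²` norm of the
difference of their derivatives, so `L²` convergence of the derivatives is Cauchy convergence in
energy. -/
theorem HasLeftDeriv.memH (hα : 1 / 2 < α) (hα' : α < 1) {u v : ℝ → Vec n}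
    (h : HasLeftDeriv α u v) : MemH α u := by
  obtain ⟨hu, hv, φ, hφ, h1, h2⟩ := h
  refine ⟨hu, φ, hφ, h1, fun ε hε => ?_⟩
  have hm : ∀ k, MemLp (leftDeriv α (φ k) - v) 2 := fun k => (leftDeriv_memLp hα hα' (hφ k)).sub hv
  have h3 := (tendsto_eLpNorm_iff hm).1 h2
  obtain ⟨N, hN⟩ := eventually_atTop.1 (h3.eventually (gt_mem_nhds (show 0 < ε / 4 by positivity)))
  refine ⟨N, fun j hj k hk => ?_⟩
  rw [← integral_leftDeriv_sq hα hα' ((hφ j).sub (hφ k)), leftDeriv_sub hα' (hφ j) (hφ k)]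
  have e : ∀ t, (leftDeriv α (φ j) - leftDeriv α (φ k)) t =
      (leftDeriv α (φ j) - v) t - (leftDeriv α (φ k) - v) t := fun t => by simp
  simp only [e]
  have := integral_sub_sq_le (hm j) (hm k)
  linarith [hN j hj, hN k hk]

end
end FracHam

/-! ### Energy estimates uniform in the parameter -/

namespace FracHam

variable {n : ℕ} {α : ℝ} {L : ℝ → Matrix (Fin n) (Fin n) ℝ} {l : ℝ → ℝ} {c : ℝ}
  {W : ℝ → Vec n → ℝ}

theorem continuous_lin (hL : Continuous L) {φ : ℝ → Vec n} (hφ : Continuous φ) :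
    Continuous fun t => (L t).toEuclideanLin (φ t) := by
  have : Continuous fun t => (L t).mulVec (φ t).ofLp :=
    hL.matrix_mulVec ((PiLp.continuous_ofLp 2 _).comp hφ)
  exact (PiLp.continuous_toLp 2 _).comp this

theorem continuous_form (hL : Continuous L) {φ ψ : ℝ → Vec n} (hφ : Continuous φ)
    (hψ : Continuous ψ) : Continuous fun t => form L t (φ t) (ψ t) :=
  (continuous_lin hL hφ).inner hψ

theorem integrable_form (hL : Continuous L) {φ ψ : ℝ → Vec n} (hφ : Continuous φ)
    (hψ : IsTest ψ) : Integrable fun t => form L t (φ t) (ψ t) := by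
  refine (continuous_form hL hφ hψ.continuous).integrable_of_hasCompactSupport ?_
  refine hψ.2.mono fun t ht => ?_
  contrapose! ht
  simp only [Function.mem_support, not_not] at ht ⊢
  simp [form, ht]

theorem IsTest.integrable_comp {φ : ℝ → Vec n} (h : IsTest φ) {f : ℝ → Vec n → ℝ}
    (hf : Continuous fun p : ℝ × Vec n => f p.1 p.2) (h0 : ∀ t, f t 0 = 0) :
    Integrable fun t => f t (φ t) := by
  have hc : Continuous fun t => f t (φ t) := hf.comp (continuous_id.prodMk h.continuous)
  refine hc.integrable_of_hasCompactSupport (h.2.mono fun t ht => ?_)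
  contrapose! ht
  simp only [Function.mem_support, not_not] at ht ⊢
  rw [ht, h0]

theorem continuous_hFun (hW : ContDiff ℝ 1 (fun p : ℝ × Vec n => W p.1 p.2)) :
    Continuous fun p : ℝ × Vec n => hFun W p.1 p.2 := by
  unfold hFun
  exact (continuous_const.mul ((continuous_grad hW).inner continuous_snd)).sub hW.continuous

theorem IsTest.integrable_potential {φ : ℝ → Vec n} (h : IsTest φ)
    (hW : ContDiff ℝ 1 (fun p : ℝ × Vec n => W p.1 p.2)) (h2 : CondW2 W) :
    Integrable fun t => W t (φ t) :=
  h.integrable_comp hW.continuous (potential_zero h2)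

theorem IsTest.integrable_hFun {φ : ℝ → Vec n} (h : IsTest φ)
    (hW : ContDiff ℝ 1 (fun p : ℝ × Vec n => W p.1 p.2)) (h2 : CondW2 W) :
    Integrable fun t => hFun W t (φ t) :=
  h.integrable_comp (continuous_hFun hW) fun t => by simp [hFun, potential_zero h2]

/-- The quadratic form `∫ |D^α φ|² + λ (L φ, φ)` on test functions. -/
noncomputable def quad (α : ℝ) (L : ℝ → Matrix (Fin n) (Fin n) ℝ) (lam : ℝ) (φ : ℝ → Vec n) : ℝ :=
  (∫ t, ‖leftDeriv α φ t‖ ^ 2) + lam * ∫ t, form L t (φ t) (φ t)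

/-- The part of `(𝓛)₁` that the existence proof uses. -/
structure Coercive (L : ℝ → Matrix (Fin n) (Fin n) ℝ) (l : ℝ → ℝ) (c : ℝ) : Prop where
  continuous_L : Continuous L
  symm : ∀ t, (L t).IsSymm
  continuous_l : Continuous l
  nonneg : ∀ t, 0 ≤ l t
  lower : ∀ t (x : Vec n), l t * ‖x‖ ^ 2 ≤ form L t x x
  c_pos : 0 < c
  finite : volume {t | l t < c} < ∞

theorem CondL1.coercive (h : CondL1 α L l c) : Coercive L l c where
  continuous_L := h.continuous_L
  symm := h.symm
  continuous_l := h.continuous_l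
  nonneg := h.nonneg
  lower := h.lower
  c_pos := h.c_pos
  finite := h.small.elim lt_top_of_lt lt_top_of_lt

namespace Coercive
variable (h : Coercive L l c)
include h

theorem form_nonneg (t : ℝ) (x : Vec n) : 0 ≤ form L t x x :=
  (mul_nonneg (h.nonneg t) (sq_nonneg _)).trans (h.lower t x)

theorem measurableSet : MeasurableSet {t | l t < c} :=
  (isOpen_lt h.continuous_l continuous_const).measurableSet

theorem deriv_le_quad {lam : ℝ} (hlam : 0 ≤ lam) (φ : ℝ → Vec n) :
    ∫ t, ‖leftDeriv α φ t‖ ^ 2 ≤ quad α L lam φ := by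
  unfold quad
  have : 0 ≤ ∫ t, form L t (φ t) (φ t) := integral_nonneg fun t => h.form_nonneg t _
  nlinarith [mul_nonneg hlam this]

theorem quad_nonneg {lam : ℝ} (hlam : 0 ≤ lam) (φ : ℝ → Vec n) : 0 ≤ quad α L lam φ :=
  (integral_nonneg fun _ => sq_nonneg _).trans (h.deriv_le_quad (α := α) hlam φ)

/-- Off `{l < c}` one has `c|φ|² ≤ (Lφ, φ)`, and `λ∫(Lφ, φ)` is part of the energy. The factor `1/λ`
is the source of the large parameter argument. -/
theorem integral_sq_le {lam : ℝ} (hlam : 0 < lam) {φ : ℝ → Vec n} (hφ : IsTest φ) :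
    ∫ t, ‖φ t‖ ^ 2 ≤ (∫ t in {t | l t < c}, ‖φ t‖ ^ 2) + quad α L lam φ / (lam * c) := by
  have hc := h.c_pos
  have h1 : ∫ t, ‖φ t‖ ^ 2 ≤ (∫ t in {t | l t < c}, ‖φ t‖ ^ 2)
      + c⁻¹ * ∫ t, form L t (φ t) (φ t) := by
    rw [← integral_indicator h.measurableSet, ← integral_const_mul, ← integral_add
      (hφ.integrable_norm_sq.indicator h.measurableSet)
      ((integrable_form h.continuous_L hφ.continuous hφ).const_mul _)]
    refine integral_mono hφ.integrable_norm_sq ((hφ.integrable_norm_sq.indicator h.measurableSet).add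
      ((integrable_form h.continuous_L hφ.continuous hφ).const_mul _)) fun t => ?_
    have h0 := h.form_nonneg t (φ t)
    dsimp only
    by_cases ht : t ∈ {t | l t < c}
    · rw [Set.indicator_of_mem ht]
      have : 0 ≤ c⁻¹ * form L t (φ t) (φ t) := by positivity
      linarith
    · rw [Set.indicator_of_notMem ht, zero_add, inv_mul_eq_div, le_div_iff₀ hc]
      have h3 : c ≤ l t := not_lt.1 ht
      have := h.lower t (φ t)
      nlinarith [sq_nonneg ‖φ t‖]
  refine h1.trans ?_
  gcongr
  have h4 : 0 ≤ ∫ t, ‖leftDeriv α φ t‖ ^ 2 := integral_nonneg fun _ => sq_nonneg _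
  rw [le_div_iff₀ (by positivity)]
  have : c⁻¹ * (∫ t, form L t (φ t) (φ t)) * (lam * c) = lam * ∫ t, form L t (φ t) (φ t) := by
    field_simp
  rw [this]
  unfold quad
  linarith

theorem setIntegral_le {φ : ℝ → Vec n} {b : ℝ} (hb : ∀ t, ‖φ t‖ ^ 2 ≤ b) :
    ∫ t in {t | l t < c}, ‖φ t‖ ^ 2 ≤ b * volume.real {t | l t < c} := by
  have := norm_setIntegral_le_of_norm_le_const (μ := volume) (s := {t | l t < c})
    (f := fun t => ‖φ t‖ ^ 2) (C := b) h.finite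
    (fun t _ => by rw [Real.norm_of_nonneg (sq_nonneg _)]; exact hb t)
  exact (le_abs_self _).trans this

/-- `λ`-independent bounds of the `L²` and sup norms by the energy norm. -/
theorem exists_embedding (hα : 1 / 2 < α) (hα' : α < 1) : ∃ C > 0, ∀ lam ≥ (1 : ℝ),
    ∀ φ : ℝ → Vec n, IsTest φ →
      ∫ t, ‖φ t‖ ^ 2 ≤ C * quad α L lam φ ∧ ∀ t, ‖φ t‖ ^ 2 ≤ C * quad α L lam φ := by
  obtain ⟨C, hC, hS⟩ := exists_sobolev_vec n hα hα'
  have hc := h.c_pos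
  set m := volume.real {t | l t < c} with hm
  have hm0 : 0 ≤ m := measureReal_nonneg
  -- Makes `mCr ≤ 1/2`: the `L²` norm that the Sobolev bound on `{l < c}` reintroduces is absorbed
  -- into the left side.
  set r : ℝ := 1 / (2 * (m * C + 1)) with hr
  have hr0 : 0 < r := by positivity
  set K : ℝ := 2 * (m * C * r ^ (1 - 2 * α) + 1 / c) with hK
  have hK0 : 0 < K := by positivity
  have h1 : ∀ lam ≥ (1 : ℝ), ∀ φ : ℝ → Vec n, IsTest φ →
      ∫ t, ‖φ t‖ ^ 2 ≤ K * quad α L lam φ := by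
    intro lam hlam φ hφ
    have hN := h.quad_nonneg (α := α) (by linarith : 0 ≤ lam) φ
    have hA := h.deriv_le_quad (α := α) (by linarith : 0 ≤ lam) φ
    have e1 := h.integral_sq_le (α := α) (by linarith : 0 < lam) hφ
    have e2 := h.setIntegral_le fun t => hS φ hφ t r hr0
    have e3 : quad α L lam φ / (lam * c) ≤ 1 / c * quad α L lam φ := by
      rw [one_div_mul_eq_div]
      gcongr
      nlinarith
    have e4 : r ^ (1 - 2 * α) * ∫ t, ‖leftDeriv α φ t‖ ^ 2 ≤ r ^ (1 - 2 * α) * quad α L lam φ := by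
      gcongr
    have hS0 : 0 ≤ ∫ t, ‖φ t‖ ^ 2 := integral_nonneg fun _ => sq_nonneg _
    have e5 : m * C * r ≤ 1 / 2 := by
      rw [hr, mul_one_div, div_le_div_iff₀ (by positivity) two_pos]
      linarith
    have e6 : m * C * (r ^ (1 - 2 * α) * ∫ t, ‖leftDeriv α φ t‖ ^ 2) ≤
        m * C * (r ^ (1 - 2 * α) * quad α L lam φ) := by gcongr
    have e7 : m * C * r * (∫ t, ‖φ t‖ ^ 2) ≤ 1 / 2 * ∫ t, ‖φ t‖ ^ 2 := by gcongr
    rw [hK]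
    nlinarith
  refine ⟨K + C * (K + 1), by positivity, fun lam hlam φ hφ => ⟨?_, fun t => ?_⟩⟩
  · have hN := h.quad_nonneg (α := α) (by linarith : 0 ≤ lam) φ
    refine (h1 lam hlam φ hφ).trans ?_
    gcongr
    have : 0 ≤ C * (K + 1) := by positivity
    linarith
  · have hN := h.quad_nonneg (α := α) (by linarith : 0 ≤ lam) φ
    have hA := h.deriv_le_quad (α := α) (by linarith : 0 ≤ lam) φ
    have := hS φ hφ t 1 one_pos
    rw [Real.one_rpow, one_mul, one_mul] at this
    calc _ ≤ C * ((∫ t, ‖φ t‖ ^ 2) + ∫ t, ‖leftDeriv α φ t‖ ^ 2) := this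
      _ ≤ C * (K * quad α L lam φ + quad α L lam φ) := by gcongr; exact h1 lam hlam φ hφ
      _ ≤ _ := by nlinarith [mul_nonneg hK0.le hN]

/-- Test functions on which the Nehari identity holds at a bounded level have bounded energy,
uniformly in large `λ`. -/
theorem exists_apriori (hα : 1 / 2 < α) (hα' : α < 1)
    (hW : ContDiff ℝ 1 (fun p : ℝ × Vec n => W p.1 p.2)) (h2 : CondW2 W) (h3 : CondW3 W)
    (h4 : CondW4 W) {M : ℝ} (hM : 0 < M) :
    ∃ Lam ≥ (1 : ℝ), ∃ B > 0, ∀ lam > Lam, ∀ φ : ℝ → Vec n, IsTest φ →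
      quad α L lam φ = 2 * (∫ t, W t (φ t)) + 2 * ∫ t, hFun W t (φ t) →
      ∫ t, hFun W t (φ t) ≤ M → quad α L lam φ ≤ B := by
  obtain ⟨C, hC, hemb⟩ := h.exists_embedding hα hα'
  have hc := h.c_pos
  -- With `|φ|² ≤ CN` and `∫H ≤ M`, this `κ` turns the term in `H` into at most `N/8`.
  obtain ⟨K, hK, hWK⟩ := exists_potential_le hW h2 h4 (κ := 1 / (8 * C * M)) (by positivity)
  -- The constant `4K` gives `Kθ ≤ N/8 + KR²m`, since `∫W ≤ N/2`. Combined with `N/4 ≤ M + Kθ`, this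
  -- leaves `N/8` on the left.
  obtain ⟨R, hR, hWR⟩ := h3 (4 * K)
  set m := volume.real {t | l t < c} with hm
  have hm0 : 0 ≤ m := measureReal_nonneg
  refine ⟨max 1 (8 * K / c), le_max_left _ _, 8 * M + 8 * K * (R ^ 2 * m), by positivity, ?_⟩
  intro lam hlam φ hφ hN hH
  have hlam1 : 1 ≤ lam := ((le_max_left _ _).trans_lt hlam).le
  have hlamK : 8 * K / c ≤ lam := ((le_max_right _ _).trans_lt hlam).le
  set N := quad α L lam φ with hNdef
  have hN0 : 0 ≤ N := h.quad_nonneg (by linarith) φ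
  obtain ⟨hS, hsup⟩ := hemb lam hlam1 φ hφ
  have hH0 : 0 ≤ ∫ t, hFun W t (φ t) := integral_nonneg fun t => h2.2 t _
  set θ := ∫ t in {t | l t < c}, ‖φ t‖ ^ 2 with hθ
  have hiW := hφ.integrable_potential hW h2
  have hiH := hφ.integrable_hFun hW h2
  have e1 : ∫ t, W t (φ t) ≤ 1 / (8 * C * M) * (C * N) * (∫ t, hFun W t (φ t)) +
      K * ∫ t, ‖φ t‖ ^ 2 := by
    rw [← integral_const_mul, ← integral_const_mul, ← integral_add (hiH.const_mul _)
      (hφ.integrable_norm_sq.const_mul _)]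
    refine integral_mono hiW ((hiH.const_mul _).add (hφ.integrable_norm_sq.const_mul _)) fun t => ?_
    have i1 := hWK t (φ t)
    have i2 := hsup t
    have i3 := h2.2 t (φ t)
    have i4 : 1 / (8 * C * M) * hFun W t (φ t) * ‖φ t‖ ^ 2 ≤
        1 / (8 * C * M) * hFun W t (φ t) * (C * N) := by gcongr
    dsimp only
    nlinarith
  have e2 : 1 / (8 * C * M) * (C * N) * (∫ t, hFun W t (φ t)) ≤ N / 8 := by
    calc _ ≤ 1 / (8 * C * M) * (C * N) * M := by gcongr
      _ = N / 8 := by field_simp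
  have e3 := h.integral_sq_le (α := α) (by linarith : 0 < lam) hφ
  have e4 : K * (N / (lam * c)) ≤ N / 8 := by
    rw [div_le_iff₀ hc] at hlamK
    rw [mul_div_assoc', div_le_div_iff₀ (by positivity) (by norm_num)]
    nlinarith
  have e5 : K * ∫ t, ‖φ t‖ ^ 2 ≤ K * θ + N / 8 := by
    have : K * ∫ t, ‖φ t‖ ^ 2 ≤ K * (θ + N / (lam * c)) := by gcongr
    linarith
  have e6 : N / 4 ≤ M + K * θ := by linarith
  have e7 : 4 * K * (θ - R ^ 2 * m) ≤ ∫ t, W t (φ t) := by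
    have j1 : ∫ t in {t | l t < c}, (4 * K * ‖φ t‖ ^ 2 - 4 * K * R ^ 2) ≤
        ∫ t in {t | l t < c}, W t (φ t) := by
      refine integral_mono ((hφ.integrable_norm_sq.integrableOn.const_mul _).sub
        (integrableOn_const h.finite.ne)) hiW.integrableOn fun t => ?_
      dsimp only
      rcases le_total R ‖φ t‖ with hx | hx
      · have := hWR t (φ t) hx
        rw [le_div_iff₀ (by have := hR.trans_le hx; positivity)] at this
        have : 0 ≤ 4 * K * R ^ 2 := by positivity
        linarith
      · have h0 := h2.1 t (φ t)
        have : 4 * K * ‖φ t‖ ^ 2 ≤ 4 * K * R ^ 2 := by gcongr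
        linarith
    rw [integral_sub (hφ.integrable_norm_sq.integrableOn.const_mul _)
      (integrableOn_const h.finite.ne), integral_const_mul, setIntegral_const, smul_eq_mul] at j1
    have j2 := setIntegral_le_integral (s := {t | l t < c}) hiW
      (Eventually.of_forall fun t => h2.1 t (φ t))
    calc _ = 4 * K * θ - m * (4 * K * R ^ 2) := by ring
      _ ≤ _ := j1.trans j2
  linarith

/-- Under the Nehari identity at a bounded level, the mass on `{l < c}` is bounded below. -/
theorem exists_mass_bound (hα : 1 / 2 < α) (hα' : α < 1)
    (hW : ContDiff ℝ 1 (fun p : ℝ × Vec n => W p.1 p.2)) (h1 : CondW1 W) (h2 : CondW2 W)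
    (h3 : CondW3 W) (h4 : CondW4 W) {M : ℝ} (hM : 0 < M) :
    ∃ Lam ≥ (1 : ℝ), ∃ B > 0, ∃ θ > 0, ∀ lam > Lam, ∀ φ : ℝ → Vec n, IsTest φ →
      quad α L lam φ = 2 * (∫ t, W t (φ t)) + 2 * ∫ t, hFun W t (φ t) →
      ∫ t, hFun W t (φ t) ≤ M → 0 < ∫ t, hFun W t (φ t) →
      quad α L lam φ ≤ B ∧ θ ≤ ∫ t in {t | l t < c}, ‖φ t‖ ^ 2 := by
  obtain ⟨Lam₁, hLam₁, B, hB, hap⟩ := h.exists_apriori hα hα' hW h2 h3 h4 hM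
  obtain ⟨C, hC, hemb⟩ := h.exists_embedding hα hα'
  obtain ⟨D, hD, hsob⟩ := exists_sobolev_vec n hα hα'
  have hc := h.c_pos
  obtain ⟨δ, hδ, hgrad⟩ := h1 (1 / (2 * C)) (by positivity)
  -- Since `2α > 1`, a large scale `r` makes the derivative term in the Sobolev inequality small;
  -- `θ` and the threshold for `λ` are then chosen after `r`, so that each of the three
  -- contributions to `|φ|²` is below `δ²/4`.
  have hlim : Tendsto (fun r : ℝ => D * r ^ (-(2 * α - 1)) * B) atTop (𝓝 (D * 0 * B)) :=
    ((tendsto_rpow_neg_atTop (by linarith)).const_mul D).mul_const B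
  rw [mul_zero, zero_mul] at hlim
  obtain ⟨r, hr, hr0⟩ := ((hlim.eventually (gt_mem_nhds (show 0 < δ ^ 2 / 4 by positivity))).and
    (eventually_gt_atTop 0)).exists
  refine ⟨max Lam₁ (4 * D * r * B / (c * δ ^ 2)), hLam₁.trans (le_max_left _ _), B, hB,
    δ ^ 2 / (4 * D * r), by positivity, ?_⟩
  intro lam hlam φ hφ hN hH hHpos
  have hlam' : Lam₁ < lam := (le_max_left _ _).trans_lt hlam
  have hlam1 : 1 ≤ lam := hLam₁.trans hlam'.le
  have hlamδ : 4 * D * r * B / (c * δ ^ 2) < lam := (le_max_right _ _).trans_lt hlam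
  have hNB := hap lam hlam' φ hφ hN hH
  refine ⟨hNB, ?_⟩
  by_contra hθ
  push Not at hθ
  set N := quad α L lam φ with hNdef
  set θ := ∫ t in {t | l t < c}, ‖φ t‖ ^ 2
  have hN0 : 0 ≤ N := h.quad_nonneg (by linarith) φ
  have e1 := h.integral_sq_le (α := α) (by linarith : 0 < lam) hφ
  have hA := h.deriv_le_quad (α := α) (by linarith : 0 ≤ lam) φ
  have hsmall : ∀ t, ‖φ t‖ < δ := by
    intro t
    have i1 := hsob φ hφ t r hr0
    have i2 : D * (r ^ (1 - 2 * α) * ∫ t, ‖leftDeriv α φ t‖ ^ 2) < δ ^ 2 / 4 := by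
      rw [show 1 - 2 * α = -(2 * α - 1) by ring]
      refine lt_of_le_of_lt ?_ hr
      rw [mul_assoc]
      gcongr
      exact hA.trans hNB
    have i3 : D * r * θ < δ ^ 2 / 4 := by
      rw [lt_div_iff₀ (by positivity)] at hθ
      linarith
    have i4 : D * r * (N / (lam * c)) < δ ^ 2 / 4 := by
      rw [div_lt_iff₀ (by positivity)] at hlamδ
      rw [mul_div_assoc', div_lt_div_iff₀ (by positivity) (by norm_num)]
      have : D * r * N ≤ D * r * B := by gcongr
      nlinarith
    have i5 : D * r * ∫ t, ‖φ t‖ ^ 2 ≤ D * r * (θ + N / (lam * c)) := by gcongr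
    have i6 : ‖φ t‖ ^ 2 < δ ^ 2 := by nlinarith
    exact lt_of_pow_lt_pow_left₀ 2 hδ.le i6
  -- The left side is `N` and the right side will be at most `N/2`, which forces `N ≤ 0` against `∫H
  -- > 0`.
  have hG : 2 * (∫ t, W t (φ t)) + 2 * ∫ t, hFun W t (φ t) ≤ 1 / (2 * C) * ∫ t, ‖φ t‖ ^ 2 := by
    have hiW := hφ.integrable_potential hW h2
    have hiH := hφ.integrable_hFun hW h2
    rw [← integral_const_mul, ← integral_const_mul, ← integral_const_mul, ← integral_add
      (hiW.const_mul 2) (hiH.const_mul 2)]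
    refine integral_mono ((hiW.const_mul 2).add (hiH.const_mul 2))
      (hφ.integrable_norm_sq.const_mul _) fun t => ?_
    dsimp only
    rw [← two_potential_add]
    have := hgrad t (φ t) (hsmall t)
    calc _ ≤ ‖grad W t (φ t)‖ * ‖φ t‖ := real_inner_le_norm _ _
      _ ≤ (1 / (2 * C) * ‖φ t‖) * ‖φ t‖ := by gcongr
      _ = _ := by ring
  have hS := (hemb lam hlam1 φ hφ).1
  have : 1 / (2 * C) * ∫ t, ‖φ t‖ ^ 2 ≤ N / 2 := by
    calc _ ≤ 1 / (2 * C) * (C * N) := by gcongr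
      _ = N / 2 := by field_simp
  have hW0 : 0 ≤ ∫ t, W t (φ t) := integral_nonneg fun t => h2.1 t _
  linarith

/-- The mountain pass geometry near zero. -/
theorem exists_barrier (hα : 1 / 2 < α) (hα' : α < 1)
    (hW : ContDiff ℝ 1 (fun p : ℝ × Vec n => W p.1 p.2)) (h1 : CondW1 W) (h2 : CondW2 W) :
    ∃ ρ > 0, ∀ lam ≥ (1 : ℝ), ∀ φ : ℝ → Vec n, IsTest φ → quad α L lam φ ≤ ρ →
      quad α L lam φ / 4 ≤ quad α L lam φ / 2 - ∫ t, W t (φ t) := by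
  obtain ⟨C, hC, hemb⟩ := h.exists_embedding hα hα'
  obtain ⟨δ, hδ, hgrad⟩ := h1 (1 / (2 * C)) (by positivity)
  -- The sup bound then gives `|φ|² ≤ δ²/2`, so (W₁) applies at every point.
  refine ⟨δ ^ 2 / (2 * C), by positivity, fun lam hlam φ hφ hρ => ?_⟩
  obtain ⟨hS, hsup⟩ := hemb lam hlam φ hφ
  have hsmall : ∀ t, ‖φ t‖ < δ := by
    intro t
    have i1 : C * quad α L lam φ ≤ δ ^ 2 / 2 := by
      calc _ ≤ C * (δ ^ 2 / (2 * C)) := by gcongr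
        _ = _ := by field_simp
    have i2 : 0 < δ ^ 2 := by positivity
    exact lt_of_pow_lt_pow_left₀ 2 hδ.le (by linarith [hsup t])
  have hG : ∫ t, W t (φ t) ≤ 1 / (4 * C) * ∫ t, ‖φ t‖ ^ 2 := by
    rw [← integral_const_mul]
    refine integral_mono (hφ.integrable_potential hW h2) (hφ.integrable_norm_sq.const_mul _)
      fun t => ?_
    have := hgrad t (φ t) (hsmall t)
    calc _ ≤ 1 / 2 * (‖grad W t (φ t)‖ * ‖φ t‖) := potential_le_half h2 t _
      _ ≤ 1 / 2 * ((1 / (2 * C) * ‖φ t‖) * ‖φ t‖) := by gcongr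
      _ = _ := by ring
  have : 1 / (4 * C) * ∫ t, ‖φ t‖ ^ 2 ≤ quad α L lam φ / 4 := by
    calc _ ≤ 1 / (4 * C) * (C * quad α L lam φ) := by gcongr
      _ = _ := by field_simp
  linarith

end Coercive
end FracHam

/-! ### Galerkin approximation -/

namespace FracHam

variable {n : ℕ} {α : ℝ} {L : ℝ → Matrix (Fin n) (Fin n) ℝ} {l : ℝ → ℝ} {c : ℝ}
  {W : ℝ → Vec n → ℝ}

theorem form_add_left (t : ℝ) (x y z : Vec n) :
    form L t (x + y) z = form L t x z + form L t y z := by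
  simp [form, inner_add_left]

theorem form_smul_left (t r : ℝ) (x z : Vec n) : form L t (r • x) z = r * form L t x z := by
  simp [form, inner_smul_left]

theorem form_add_right (t : ℝ) (x y z : Vec n) :
    form L t x (y + z) = form L t x y + form L t x z := by
  simp [form, inner_add_right]

theorem form_smul_right (t r : ℝ) (x z : Vec n) : form L t x (r • z) = r * form L t x z := by
  simp [form, inner_smul_right]

theorem form_comm {t : ℝ} (h : (L t).IsSymm) (x y : Vec n) : form L t x y = form L t y x := by
  unfold form
  have hs : LinearMap.IsSymmetric (L t).toEuclideanLin := by
    rw [Matrix.isSymmetric_toEuclideanLin_iff, Matrix.IsHermitian,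
      Matrix.conjTranspose_eq_transpose_of_trivial]
    exact h
  rw [hs x y, real_inner_comm]

/-- The bilinear form `∫ (L φ, ψ)` on test functions. -/
noncomputable def formBilin (hL : Continuous L) : testSpace n →ₗ[ℝ] testSpace n →ₗ[ℝ] ℝ :=
  LinearMap.mk₂ ℝ (fun φ ψ => ∫ t, form L t (φ.1 t) (ψ.1 t))
    (fun φ φ' ψ => by
      rw [← integral_add (integrable_form hL (IsTest.continuous φ.2) ψ.2)
        (integrable_form hL (IsTest.continuous φ'.2) ψ.2)]
      exact integral_congr_ae (Eventually.of_forall fun t => form_add_left t _ _ _))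
    (fun r φ ψ => by
      rw [smul_eq_mul, ← integral_const_mul]
      exact integral_congr_ae (Eventually.of_forall fun t => form_smul_left t r _ _))
    (fun φ ψ ψ' => by
      rw [← integral_add (integrable_form hL (IsTest.continuous φ.2) ψ.2)
        (integrable_form hL (IsTest.continuous φ.2) ψ'.2)]
      exact integral_congr_ae (Eventually.of_forall fun t => form_add_right t _ _ _))
    (fun r φ ψ => by
      rw [smul_eq_mul, ← integral_const_mul]
      exact integral_congr_ae (Eventually.of_forall fun t => form_smul_right t r _ _))

/-- The fractional derivative as a linear map from test functions to `L²`. -/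
noncomputable def derivLp (n : ℕ) (hα : 1 / 2 < α) (hα' : α < 1) : testSpace n →ₗ[ℝ] LTwo n :=
  (WithLp.sndL 2 ℝ (LTwo n) (LTwo n)).toLinearMap ∘ₗ graphMap n hα hα'

/-- The inclusion of test functions into `L²`. -/
noncomputable def inclLp (n : ℕ) (hα : 1 / 2 < α) (hα' : α < 1) : testSpace n →ₗ[ℝ] LTwo n :=
  (WithLp.fstL 2 ℝ (LTwo n) (LTwo n)).toLinearMap ∘ₗ graphMap n hα hα'

/-- The bilinear form `∫ (D^α φ, D^α ψ) + λ (L φ, ψ)` on test functions. -/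
noncomputable def energyBilin (hα : 1 / 2 < α) (hα' : α < 1) (hL : Continuous L) (lam : ℝ) :
    testSpace n →ₗ[ℝ] testSpace n →ₗ[ℝ] ℝ :=
  (innerₗ (LTwo n)).compl₁₂ (derivLp n hα hα') (derivLp n hα hα') + lam • formBilin hL

theorem inner_toLp {u v : ℝ → Vec n} (hu : MemLp u 2) (hv : MemLp v 2) :
    inner ℝ (hu.toLp u) (hv.toLp v) = ∫ t, inner ℝ (u t) (v t) := by
  rw [L2.inner_def]
  refine integral_congr_ae ?_
  filter_upwards [hu.coeFn_toLp, hv.coeFn_toLp] with t ht ht'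
  rw [ht, ht']

theorem energyBilin_apply (hα : 1 / 2 < α) (hα' : α < 1) (hL : Continuous L) (lam : ℝ)
    (φ ψ : testSpace n) : energyBilin hα hα' hL lam φ ψ =
      (∫ t, inner ℝ (leftDeriv α φ.1 t) (leftDeriv α ψ.1 t)) +
        lam * ∫ t, form L t (φ.1 t) (ψ.1 t) := by
  rw [← inner_toLp (leftDeriv_memLp hα hα' φ.2) (leftDeriv_memLp hα hα' ψ.2)]
  rfl

theorem energyBilin_self (hα : 1 / 2 < α) (hα' : α < 1) (hL : Continuous L) (lam : ℝ)
    (φ : testSpace n) : energyBilin hα hα' hL lam φ φ = quad α L lam φ.1 := by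
  rw [energyBilin_apply]
  simp only [real_inner_self_eq_norm_sq]
  rfl

theorem energyBilin_comm (hα : 1 / 2 < α) (hα' : α < 1) (hL : Continuous L)
    (hs : ∀ t, (L t).IsSymm) (lam : ℝ) (φ ψ : testSpace n) :
    energyBilin hα hα' hL lam φ ψ = energyBilin hα hα' hL lam ψ φ := by
  rw [energyBilin_apply, energyBilin_apply]
  simp only [fun t => form_comm (hs t) (φ.1 t) (ψ.1 t), real_inner_comm]

section finiteDim
variable {d : ℕ} (T : EuclideanSpace ℝ (Fin d) →ₗ[ℝ] testSpace n)

/-- Evaluation at `t` of the test function with coordinates `a`. -/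
noncomputable def evalCoord (t : ℝ) : EuclideanSpace ℝ (Fin d) →L[ℝ] Vec n :=
  ∑ i, (EuclideanSpace.proj i).smulRight ((T (EuclideanSpace.single i 1)).1 t)

theorem evalCoord_apply (t : ℝ) (a : EuclideanSpace ℝ (Fin d)) : evalCoord T t a = (T a).1 t := by
  have h : a = ∑ i, a i • EuclideanSpace.single i (1 : ℝ) := by
    ext j
    simp [Pi.single_apply]
  conv_rhs => rw [h, map_sum]
  simp [evalCoord]

theorem continuous_evalCoord : Continuous (evalCoord T) := by
  unfold evalCoord
  refine continuous_finsetSum _ fun i _ => ?_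
  exact (ContinuousLinearMap.smulRightL ℝ (EuclideanSpace ℝ (Fin d)) (Vec n)
    (EuclideanSpace.proj i)).continuous.comp (IsTest.continuous (T _).2)

/-- Finitely many basis functions have a common compact support, which reduces the potential to an
integral over a compact set where differentiation under the integral sign is dominated. -/
theorem exists_compact_support : ∃ K : Set ℝ, IsCompact K ∧ ∀ a, ∀ t ∉ K, (T a).1 t = 0 := by
  refine ⟨⋃ i, tsupport (T (EuclideanSpace.single i 1)).1,
    isCompact_iUnion fun i => (T _).2.2.isCompact, fun a t ht => ?_⟩
  rw [← evalCoord_apply]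
  simp only [Set.mem_iUnion, not_exists] at ht
  simp [evalCoord, image_eq_zero_of_notMem_tsupport (ht _)]

theorem continuous_apply_pair :
    Continuous fun p : EuclideanSpace ℝ (Fin d) × ℝ => (T p.1).1 p.2 := by
  simp only [← evalCoord_apply]
  exact ((continuous_evalCoord T).comp continuous_snd).clm_apply continuous_fst

/-- The derivative of the integrand `W(t, u(t))` in the coordinates of `u`. -/
noncomputable def potentialDeriv (W : ℝ → Vec n → ℝ) (a : EuclideanSpace ℝ (Fin d)) (t : ℝ) :
    EuclideanSpace ℝ (Fin d) →L[ℝ] ℝ :=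
  (innerSL ℝ (grad W t ((T a).1 t))).comp (evalCoord T t)

theorem continuous_potentialDeriv (hW : ContDiff ℝ 1 (fun p : ℝ × Vec n => W p.1 p.2)) :
    Continuous fun p : EuclideanSpace ℝ (Fin d) × ℝ => potentialDeriv T W p.1 p.2 := by
  unfold potentialDeriv
  refine Continuous.clm_comp ?_ ((continuous_evalCoord T).comp continuous_snd)
  exact (innerSL ℝ).continuous.comp
    ((continuous_grad hW).comp (continuous_snd.prodMk (continuous_apply_pair T)))

theorem hasFDerivAt_integral_potential (hW : ContDiff ℝ 1 (fun p : ℝ × Vec n => W p.1 p.2))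
    {K : Set ℝ} (hK : IsCompact K) (a : EuclideanSpace ℝ (Fin d)) :
    HasFDerivAt (fun a => ∫ t in K, W t ((T a).1 t)) (∫ t in K, potentialDeriv T W a t) a := by
  have hWc : ∀ a, Continuous fun t => W t ((T a).1 t) := fun a =>
    hW.continuous.comp (continuous_id.prodMk (IsTest.continuous (T a).2))
  obtain ⟨C, hC⟩ := ((isCompact_closedBall a 1).prod hK).exists_bound_of_continuousOn
    (continuous_potentialDeriv T hW).continuousOn
  refine hasFDerivAt_integral_of_dominated_of_fderiv_le (F' := fun a t => potentialDeriv T W a t)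
    (bound := fun _ => C) (Metric.closedBall_mem_nhds a one_pos)
    (Eventually.of_forall fun b => (hWc b).aestronglyMeasurable)
    ((hWc a).continuousOn.integrableOn_compact hK) ?_ ?_ ?_ ?_
  · exact ((continuous_potentialDeriv T hW).comp
      (continuous_const.prodMk continuous_id)).aestronglyMeasurable
  · filter_upwards [ae_restrict_mem hK.measurableSet] with t ht b hb
    exact hC (b, t) ⟨hb, ht⟩
  · exact integrableOn_const hK.measure_lt_top.ne
  · refine Eventually.of_forall fun t b _ => ?_
    have h1 := (hasFDerivAt_inner_grad hW t ((T b).1 t))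
    have h2 : HasFDerivAt (fun a => (T a).1 t) (evalCoord T t) b := by
      have h3 : (fun a => (T a).1 t) = evalCoord T t :=
        funext fun a => (evalCoord_apply T t a).symm
      rw [h3]
      exact (evalCoord T t).hasFDerivAt
    exact h1.comp b h2

end finiteDim

/-- The energy functional on test functions. -/
noncomputable def action (α : ℝ) (L : ℝ → Matrix (Fin n) (Fin n) ℝ) (W : ℝ → Vec n → ℝ) (lam : ℝ)
    (φ : ℝ → Vec n) : ℝ :=
  quad α L lam φ / 2 - ∫ t, W t (φ t)

theorem exists_lower_potential (h2 : CondW2 W) (h3 : CondW3 W) {M : ℝ} (hM : 0 ≤ M) :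
    ∃ R > 0, ∀ t x, M * (‖x‖ ^ 2 - R ^ 2) ≤ W t x := by
  obtain ⟨R, hR, h⟩ := h3 M
  refine ⟨R, hR, fun t x => ?_⟩
  rcases le_total R ‖x‖ with hx | hx
  · have := h t x hx
    rw [le_div_iff₀ (by have := hR.trans_le hx; positivity)] at this
    have : 0 ≤ M * R ^ 2 := by positivity
    linarith
  · have h0 := h2.1 t x
    have : M * ‖x‖ ^ 2 ≤ M * R ^ 2 := by gcongr
    linarith

/-- Critical points of the energy functional on finite dimensional spaces of test functions. -/
theorem exists_galerkin (hα : 1 / 2 < α) (hα' : α < 1) (hL : Continuous L)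
    (hs : ∀ t, (L t).IsSymm) (hW : ContDiff ℝ 1 (fun p : ℝ × Vec n => W p.1 p.2)) (h2 : CondW2 W)
    (h3 : CondW3 W) {lam ρ c₀ M : ℝ} (hρ : 0 < ρ) (hc₀ : 0 < c₀)
    (hgeo : ∀ φ : ℝ → Vec n, IsTest φ → quad α L lam φ = ρ → c₀ ≤ action α L W lam φ)
    (S : Submodule ℝ (testSpace n)) [FiniteDimensional ℝ S] {e : testSpace n} (heS : e ∈ S)
    (he : ρ ≤ quad α L lam e.1) (hfe : action α L W lam e.1 ≤ 0)
    (hM : ∀ s ∈ Set.Icc (0 : ℝ) 1, action α L W lam (s • e).1 ≤ M) :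
    ∃ φ ∈ S, (∀ ψ ∈ S, energyBilin hα hα' hL lam φ ψ =
        ∫ t, inner ℝ (grad W t (φ.1 t)) (ψ.1 t)) ∧
      c₀ ≤ action α L W lam φ.1 ∧ action α L W lam φ.1 ≤ M := by
  have : Module.Free ℝ S := Module.Free.of_divisionRing ℝ S
  set d := Module.finrank ℝ S
  set b := Module.finBasis ℝ S
  set E := EuclideanSpace ℝ (Fin d)
  set T₀ : E ≃ₗ[ℝ] S := (WithLp.linearEquiv 2 ℝ (Fin d → ℝ)).trans b.equivFun.symm with hT₀
  set T : E →ₗ[ℝ] testSpace n := S.subtype ∘ₗ T₀.toLinearMap with hT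
  have hTinj : Function.Injective T := Subtype.val_injective.comp T₀.injective
  have hTS : ∀ ψ ∈ S, ∃ a, T a = ψ := fun ψ hψ => ⟨T₀.symm ⟨ψ, hψ⟩, by simp [hT]⟩
  obtain ⟨K, hK, hK0⟩ := exists_compact_support T
  have hWK : ∀ a, ∫ t, W t ((T a).1 t) = ∫ t in K, W t ((T a).1 t) := fun a =>
    (setIntegral_eq_integral_of_forall_compl_eq_zero fun t ht => by
      rw [hK0 a t ht, potential_zero h2]).symm
  set Bl := (energyBilin hα hα' hL lam).compl₁₂ T T with hBl
  set Bc : E →L[ℝ] E →L[ℝ] ℝ := LinearMap.toContinuousLinearMap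
    (LinearMap.toContinuousLinearMap.toLinearMap ∘ₗ Bl) with hBc
  have hBc_apply : ∀ a a', Bc a a' = energyBilin hα hα' hL lam (T a) (T a') := fun a a' => rfl
  have hq : ∀ a, quad α L lam (T a).1 = Bc a a := fun a => (energyBilin_self hα hα' hL lam _).symm
  set f : E → ℝ := fun a => action α L W lam (T a).1 with hf
  have hfeq : f = fun a => Bc a a / 2 - ∫ t in K, W t ((T a).1 t) := by
    ext a
    simp only [hf, action, hq, hWK]
  set f' : E → E →L[ℝ] ℝ := fun a => Bc a - ∫ t in K, potentialDeriv T W a t with hf'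
  have hderiv : ∀ a, HasFDerivAt f (f' a) a := by
    intro a
    rw [hfeq]
    have h1 := ((Bc.hasFDerivAt (x := a)).clm_apply (hasFDerivAt_id a)).mul_const (2⁻¹ : ℝ)
    have h2 := h1.sub (hasFDerivAt_integral_potential T hW hK a)
    refine (h2.congr_fderiv ?_)
    ext x
    -- Symmetry of `L` makes the two halves of the derivative of `Bc a a / 2` equal.
    have hcomm : Bc x a = Bc a x := by
      rw [hBc_apply, hBc_apply, energyBilin_comm hα hα' hL hs]
    simp only [hf', sub_apply, smul_apply,
      add_apply, ContinuousLinearMap.comp_apply,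
      ContinuousLinearMap.flip_apply, ContinuousLinearMap.id_apply, id_eq, smul_eq_mul, hcomm]
    ring
  have hf'c : Continuous f' :=
    Bc.continuous.sub (continuous_parametric_integral_of_continuous
      (continuous_potentialDeriv T hW) hK)
  have hincl : Function.Injective (inclLp n hα hα') := by
    intro φ ψ hφψ
    have h1 : φ.1 =ᵐ[volume] ψ.1 := (MemLp.toLp_eq_toLp_iff (IsTest.memLp φ.2 2)
      (IsTest.memLp ψ.2 2)).1 hφψ
    exact Subtype.ext ((IsTest.continuous φ.2).ae_eq_iff_eq volume (IsTest.continuous ψ.2) |>.1 h1)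
  -- An injective linear map on a finite dimensional space is bounded below, so the `L²` norm
  -- controls the coordinates. The constant depends on the space, but only boundedness of `{f ≥ 0}`
  -- uses it.
  obtain ⟨κ, hκ, hanti⟩ := (inclLp n hα hα' ∘ₗ T).exists_antilipschitzWith (by
    rw [LinearMap.ker_eq_bot, LinearMap.coe_comp]
    exact hincl.comp hTinj)
  have hlow : ∀ a, ‖a‖ ^ 2 ≤ (κ : ℝ) ^ 2 * ∫ t in K, ‖(T a).1 t‖ ^ 2 := by
    intro a
    have h1 : ‖a‖ ≤ κ * ‖(inclLp n hα hα' ∘ₗ T) a‖ := by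
      simpa using hanti.le_mul_dist a 0
    have h2 : ‖(inclLp n hα hα' ∘ₗ T) a‖ ^ 2 = ∫ t, ‖(T a).1 t‖ ^ 2 :=
      norm_toLp_sq (IsTest.memLp (T a).2 2)
    rw [setIntegral_eq_integral_of_forall_compl_eq_zero fun t ht => by rw [hK0 a t ht]; simp, ← h2,
      ← mul_pow]
    gcongr
  have hbdd : Bornology.IsBounded {a | 0 ≤ f a} := by
    set Q := ‖Bc‖ with hQ
    have hQ0 : 0 ≤ Q := norm_nonneg Bc
    have hκ0 : (0 : ℝ) < κ := hκ
    -- The factor `κ²` converts the `L²` norm into `‖a‖²`; `Q + 1` then beats the quadratic form and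
    -- leaves at least `-‖a‖²`.
    obtain ⟨R, hR, hWR⟩ := exists_lower_potential h2 h3
      (M := (Q + 1) * (κ : ℝ) ^ 2) (by positivity)
    have hupper : ∀ a, f a ≤ -‖a‖ ^ 2 + (Q + 1) * κ ^ 2 * R ^ 2 * volume.real K := by
      intro a
      have hi : IntegrableOn (fun t => ‖(T a).1 t‖ ^ 2) K :=
        (IsTest.integrable_norm_sq (T a).2).integrableOn
      have h1 : ∫ t in K, (Q + 1) * κ ^ 2 * (‖(T a).1 t‖ ^ 2 - R ^ 2) ≤
          ∫ t in K, W t ((T a).1 t) := by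
        refine integral_mono ((hi.sub (integrableOn_const hK.measure_lt_top.ne)).const_mul _)
          (IsTest.integrable_potential (T a).2 hW h2).integrableOn fun t => hWR t _
      rw [integral_const_mul, integral_sub hi (integrableOn_const hK.measure_lt_top.ne),
        setIntegral_const, smul_eq_mul] at h1
      have h4 : Bc a a ≤ Q * ‖a‖ ^ 2 := by
        have := Bc.le_opNorm₂ a a
        rw [sq, ← mul_assoc]
        exact (le_abs_self _).trans this
      have h5 := mul_le_mul_of_nonneg_left (hlow a) (by linarith : 0 ≤ Q + 1)
      rw [hfeq]
      dsimp only
      nlinarith [sq_nonneg ‖a‖]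
    rw [isBounded_iff_forall_norm_le]
    refine ⟨Real.sqrt ((Q + 1) * κ ^ 2 * R ^ 2 * volume.real K), fun a ha => ?_⟩
    refine Real.le_sqrt_of_sq_le ?_
    have h1 : 0 ≤ f a := ha
    linarith [hupper a]
  obtain ⟨ae, hae⟩ := hTS e heS
  have hT0 : (T 0).1 = 0 := by rw [map_zero]; rfl
  obtain ⟨a, ha, hac, haM⟩ := exists_mountain_pass (f := f)
    (G := fun a => (InnerProductSpace.toDual ℝ E).symm (f' a)) (q := fun a => Bc a a)
    (ρ := ρ) (c₀ := c₀) (M := M) (e := ae)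
    (fun a => by
      refine (hderiv a).congr_fderiv ?_
      ext x
      simp)
    ((LinearIsometryEquiv.continuous _).comp hf'c) (by fun_prop) (by simp) hρ hc₀
    (fun a ha => hgeo _ (T a).2 (by rw [hq]; exact ha))
    (by rw [hfeq]; simp only [map_zero]; simp [potential_zero h2])
    (by rw [← hq, hae]; exact he) (by simp only [hf, hae]; exact hfe) hbdd
    (fun s hs => by simp only [hf, map_smul, hae]; exact hM s hs)
  refine ⟨T a, (T₀ a).2, fun ψ hψ => ?_, hac, haM⟩
  obtain ⟨x, rfl⟩ := hTS ψ hψ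
  have h0 : f' a = 0 := by simpa using ha
  have h1 : f' a x = 0 := by rw [h0]; rfl
  have hint : IntegrableOn (fun t => potentialDeriv T W a t) K :=
    ((continuous_potentialDeriv T hW).comp (continuous_const.prodMk
      continuous_id)).continuousOn.integrableOn_compact hK
  simp only [hf', sub_apply] at h1
  rw [ContinuousLinearMap.integral_apply hint, hBc_apply, sub_eq_zero] at h1
  have h3 : ∫ t in K, inner ℝ (grad W t ((T a).1 t)) ((T x).1 t) =
      ∫ t, inner ℝ (grad W t ((T a).1 t)) ((T x).1 t) :=
    setIntegral_eq_integral_of_forall_compl_eq_zero fun t ht => by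
      rw [hK0 x t ht, inner_zero_right]
  rw [h1, ← h3]
  congr 1; ext t
  simp [potentialDeriv, evalCoord_apply]

end FracHam

/-! ### Critical points on an exhausting sequence of subspaces -/

namespace FracHam

variable {n : ℕ} {α : ℝ} {L : ℝ → Matrix (Fin n) (Fin n) ℝ} {l : ℝ → ℝ} {c : ℝ}
  {W : ℝ → Vec n → ℝ}

theorem memLp_lin (hL : Continuous L) {φ : ℝ → Vec n} (hφ : IsTest φ) :
    MemLp (fun t => (L t).toEuclideanLin (φ t)) 2 := by
  refine (continuous_lin hL hφ.continuous).memLp_of_hasCompactSupport (hφ.2.mono fun t ht => ?_)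
  contrapose! ht
  simp only [Function.mem_support, not_not] at ht ⊢
  rw [ht, map_zero]

/-- The map `φ ↦ (φ, D^α φ, L φ)` from test functions to `L² × L² × L²`. -/
noncomputable def tripleMap (hα : 1 / 2 < α) (hα' : α < 1) (hL : Continuous L) :
    testSpace n →ₗ[ℝ] LTwo n × LTwo n × LTwo n :=
  (inclLp n hα hα').prod ((derivLp n hα hα').prod
    { toFun := fun φ => (memLp_lin hL φ.2).toLp _
      map_add' := fun φ ψ => by
        rw [← MemLp.toLp_add]
        refine (MemLp.toLp_eq_toLp_iff _ _).2 (Eventually.of_forall fun t => ?_)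
        exact map_add _ _ _
      map_smul' := fun r φ => by
        rw [RingHom.id_apply, ← MemLp.toLp_const_smul]
        refine (MemLp.toLp_eq_toLp_iff _ _).2 (Eventually.of_forall fun t => ?_)
        exact (L t).toEuclideanLin.map_smul r (φ.1 t) })

/-- The weak equation sees a test function only through `φ`, `D^α φ` and `Lφ`, each paired with a
fixed `L²` function. Separability of `L² × L² × L²` therefore reduces it to countably many tests. -/
theorem exists_dense_testSeq (hα : 1 / 2 < α) (hα' : α < 1) (hL : Continuous L) :
    ∃ ψ : ℕ → testSpace n, ∀ φ, tripleMap hα hα' hL φ ∈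
      closure (Set.range fun j => tripleMap hα hα' hL (ψ j)) := by
  set R := Set.range (tripleMap hα hα' hL) with hR
  obtain ⟨x, hx⟩ := TopologicalSpace.exists_dense_seq R
  choose ψ hψ using fun j => (x j).2
  refine ⟨ψ, fun φ => ?_⟩
  have h1 := hx ⟨_, Set.mem_range_self φ⟩
  rw [closure_subtype, ← Set.range_comp] at h1
  simpa only [hψ] using! h1

/-- A test function on which the form `(L φ, φ)` vanishes. -/
theorem exists_test_in_well (hn : 0 < n) (hL3 : CondL3 L l) :
    ∃ e : ℝ → Vec n, IsTest e ∧ (∀ t, form L t (e t) (e t) = 0) ∧ 0 < ∫ t, ‖e t‖ ^ 2 := by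
  obtain ⟨a, b, hab, -, hT⟩ := hL3
  let f : ContDiffBump ((a + b) / 2) :=
    { rIn := (b - a) / 4, rOut := (b - a) / 2, rIn_pos := by linarith, rIn_lt_rOut := by linarith }
  set y : Vec n := EuclideanSpace.single ⟨0, hn⟩ 1 with hy
  have hy1 : ‖y‖ = 1 := by simp [hy]
  have htest : IsTest fun t => f t • y :=
    ⟨f.contDiff.smul contDiff_const, f.hasCompactSupport.smul_right⟩
  refine ⟨fun t => f t • y, htest, fun t => ?_, ?_⟩
  · by_cases ht : t ∈ Set.Ioo a b
    · simp [form, hT t (subset_closure ht)]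
    · have h0 : f t = 0 := by
        have : t ∉ Function.support f := by
          rw [f.support_eq, Real.ball_eq_Ioo]
          convert ht using 3 <;> simp only [f] <;> ring
        simpa using this
      simp [form, h0]
  · rw [integral_pos_iff_support_of_nonneg (fun t => sq_nonneg _) htest.integrable_norm_sq]
    have hs : (Function.support fun t => ‖f t • y‖ ^ 2) = Function.support f := by
      ext t
      simp [norm_smul, hy1]
    rw [hs, f.support_eq]
    exact Metric.measure_ball_pos _ _ f.rOut_pos

theorem quad_smul (hα' : α < 1) (lam s : ℝ) {φ : ℝ → Vec n} (hφ : IsTest φ) :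
    quad α L lam (s • φ) = s ^ 2 * quad α L lam φ := by
  have h1 : ∀ t, form L t (s • φ t) (s • φ t) = s ^ 2 * form L t (φ t) (φ t) := fun t => by
    rw [form_smul_left, form_smul_right]
    ring
  simp only [quad, leftDeriv_smul hα' s hφ, Pi.smul_apply, h1, norm_smul, mul_pow,
    Real.norm_eq_abs, sq_abs, integral_const_mul]
  ring

/-- A direction along which the energy becomes negative, with bounds independent of `λ`. -/
theorem exists_descent_direction (hn : 0 < n) (hα' : α < 1)
    (hW : ContDiff ℝ 1 (fun p : ℝ × Vec n => W p.1 p.2)) (h2 : CondW2 W) (h3 : CondW3 W)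
    (hL3 : CondL3 L l) :
    ∃ e : ℝ → Vec n, IsTest e ∧ ∃ M > 0, ∀ lam : ℝ, action α L W lam e < 0 ∧
      ∀ s ∈ Set.Icc (0 : ℝ) 1, action α L W lam (s • e) ≤ M := by
  obtain ⟨e, he, hform, hpos⟩ := exists_test_in_well hn hL3
  set A := ∫ t, ‖leftDeriv α e t‖ ^ 2 with hA
  have hA0 : 0 ≤ A := integral_nonneg fun _ => sq_nonneg _
  set S := ∫ t, ‖e t‖ ^ 2 with hS
  have hq : ∀ lam, quad α L lam e = A := fun lam => by simp [quad, hform, hA]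
  obtain ⟨R, hR, hlow⟩ := exists_lower_potential h2 h3 (M := (A / 2 + 1) / S) (by positivity)
  set K := tsupport e with hK
  have hKc : IsCompact K := he.2.isCompact
  set k := (A / 2 + 1) / S * (R ^ 2 * volume.real K) with hk
  have hk0 : 0 ≤ k := by positivity
  -- The energy at `s • e` is at most `s²A/2 - (s²(A/2 + 1) - k) = k - s² = -1`.
  set s := Real.sqrt (k + 1) with hs
  have hs2 : s ^ 2 = k + 1 := Real.sq_sqrt (by linarith)
  have hWi : s ^ 2 * (A / 2 + 1) - k ≤ ∫ t, W t ((s • e) t) := by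
    have hi : IntegrableOn (fun t => ‖(s • e) t‖ ^ 2) K :=
      (he.smul s).integrable_norm_sq.integrableOn
    have h1 : ∫ t in K, (A / 2 + 1) / S * (‖(s • e) t‖ ^ 2 - R ^ 2) ≤
        ∫ t in K, W t ((s • e) t) :=
      integral_mono ((hi.sub (integrableOn_const hKc.measure_lt_top.ne)).const_mul _)
        ((he.smul s).integrable_potential hW h2).integrableOn fun t => hlow t _
    have h0 : ∀ t ∉ K, (s • e) t = 0 := fun t ht => by
      simp [image_eq_zero_of_notMem_tsupport ht]
    rw [integral_const_mul, integral_sub hi (integrableOn_const hKc.measure_lt_top.ne),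
      setIntegral_const, smul_eq_mul,
      setIntegral_eq_integral_of_forall_compl_eq_zero fun t ht => by rw [h0 t ht]; simp,
      setIntegral_eq_integral_of_forall_compl_eq_zero fun t ht => by
        rw [h0 t ht, potential_zero h2]] at h1
    have h4 : ∫ t, ‖(s • e) t‖ ^ 2 = s ^ 2 * S := by
      simp only [Pi.smul_apply, norm_smul, mul_pow, Real.norm_eq_abs, sq_abs, integral_const_mul, hS]
    rw [h4] at h1
    refine le_of_eq_of_le ?_ h1
    rw [hk]
    field_simp
  refine ⟨s • e, he.smul s, s ^ 2 * A / 2 + 1, by positivity, fun lam => ⟨?_, fun r hr => ?_⟩⟩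
  · rw [action, quad_smul hα' lam s he, hq]
    nlinarith
  · rw [action, quad_smul hα' lam r (he.smul s), quad_smul hα' lam s he, hq]
    -- Along the segment only `W ≥ 0` is used, so the bound is the kinetic part, free of `λ`.
    have h5 : 0 ≤ ∫ t, W t ((r • s • e) t) := integral_nonneg fun t => h2.1 t _
    have h6 : r ^ 2 ≤ 1 := by nlinarith [hr.1, hr.2]
    have h7 : r ^ 2 * (s ^ 2 * A) ≤ 1 * (s ^ 2 * A) := by gcongr
    linarith

/-- Critical points of the energy on an exhausting sequence of finite dimensional spaces. -/
theorem exists_critical_seq (hn : 0 < n) (hα : 1 / 2 < α) (hα' : α < 1) (h : Coercive L l c)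
    (hL3 : CondL3 L l) (hW : ContDiff ℝ 1 (fun p : ℝ × Vec n => W p.1 p.2)) (h1 : CondW1 W)
    (h2 : CondW2 W) (h3 : CondW3 W) (h4 : CondW4 W) (ψ : ℕ → testSpace n) :
    ∃ Lam ≥ (1 : ℝ), ∀ lam > Lam, ∃ (B θ : ℝ) (φ : ℕ → testSpace n), 0 < θ ∧
      (∀ k, quad α L lam (φ k).1 ≤ B ∧ θ ≤ ∫ t in {t | l t < c}, ‖(φ k).1 t‖ ^ 2) ∧
      ∀ k, ∀ j < k, energyBilin hα hα' h.continuous_L lam (φ k) (ψ j) =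
        ∫ t, inner ℝ (grad W t ((φ k).1 t)) ((ψ j).1 t) := by
  obtain ⟨e, he, M, hM, hact⟩ := exists_descent_direction (α := α) hn hα' hW h2 h3 hL3
  obtain ⟨ρ, hρ, hbar⟩ := h.exists_barrier hα hα' hW h1 h2
  obtain ⟨Lam, hLam, B, -, θ, hθ, hmass⟩ := h.exists_mass_bound hα hα' hW h1 h2 h3 h4 hM
  refine ⟨Lam, hLam, fun lam hlam => ?_⟩
  have hlam1 : 1 ≤ lam := hLam.trans hlam.le
  -- Below `ρ` the barrier makes the energy nonnegative, whereas it is negative at `e`.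
  have heρ : ρ ≤ quad α L lam e := by
    by_contra! hlt
    have i1 := hbar lam hlam1 e he hlt.le
    have i2 := h.quad_nonneg (α := α) (by linarith : 0 ≤ lam) e
    have i3 : quad α L lam e / 2 - ∫ t, W t (e t) < 0 := (hact lam).1
    linarith
  have hcrit : ∀ k : ℕ, ∃ φ : testSpace n,
      (quad α L lam φ.1 ≤ B ∧ θ ≤ ∫ t in {t | l t < c}, ‖φ.1 t‖ ^ 2) ∧
      ∀ j < k, energyBilin hα hα' h.continuous_L lam φ (ψ j) =
        ∫ t, inner ℝ (grad W t (φ.1 t)) ((ψ j).1 t) := by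
    intro k
    set S : Submodule ℝ (testSpace n) :=
      Submodule.span ℝ (insert ⟨e, he⟩ (ψ '' Set.Iio k)) with hS
    have : FiniteDimensional ℝ S :=
      FiniteDimensional.span_of_finite ℝ (((Set.finite_Iio k).image ψ).insert _)
    obtain ⟨φ, hφS, hφ, hlow, hup⟩ := exists_galerkin hα hα' h.continuous_L h.symm hW h2 h3 hρ
      (show 0 < ρ / 4 by positivity)
      (fun φ hφ hq => by
        have := hbar lam hlam1 φ hφ hq.le
        rw [hq] at this
        rwa [action, hq])
      S (e := ⟨e, he⟩) (Submodule.subset_span (Set.mem_insert _ _)) heρ (hact lam).1.le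
      (hact lam).2
    -- The critical point lies in its own test space; this choice yields the Nehari identity and
    -- identifies the level with `∫H`.
    have hself := hφ φ hφS
    rw [energyBilin_self] at hself
    have hpot := (IsTest.integrable_potential φ.2 hW h2)
    have hH := (IsTest.integrable_hFun φ.2 hW h2)
    simp only [two_potential_add] at hself
    rw [integral_add (hpot.const_mul 2) (hH.const_mul 2), integral_const_mul,
      integral_const_mul] at hself
    have haction : action α L W lam φ.1 = ∫ t, hFun W t (φ.1 t) := by
      rw [action, hself]; ring
    rw [haction] at hlow hup
    exact ⟨φ, hmass lam hlam φ.1 φ.2 hself hup (by linarith), fun j hj =>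
      hφ _ (Submodule.subset_span (Set.mem_insert_of_mem _ ⟨j, hj, rfl⟩))⟩
  choose φ hφ1 hφ2 using hcrit
  exact ⟨B, θ, φ, hθ, hφ1, hφ2⟩

end FracHam

/-! ### Passage to the limit against test functions -/

namespace FracHam

variable {n : ℕ} {α : ℝ} {L : ℝ → Matrix (Fin n) (Fin n) ℝ} {l : ℝ → ℝ} {c : ℝ}
  {W : ℝ → Vec n → ℝ}

/-- Outside a compact set `u` is so small that (W₁) gives `|∇W(t,u)| ≤ |u|`; on the compact set the
gradient is bounded. -/
theorem memLp_grad (hW : ContDiff ℝ 1 (fun p : ℝ × Vec n => W p.1 p.2)) (h1 : CondW1 W)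
    {u : ℝ → Vec n} (hu : Continuous u) (hu0 : Tendsto u (cocompact ℝ) (𝓝 0)) (hu2 : MemLp u 2) :
    MemLp (fun t => grad W t (u t)) 2 := by
  obtain ⟨δ, hδ, hgrad⟩ := h1 1 one_pos
  have hc : Continuous fun t => grad W t (u t) := (continuous_grad hW).comp (continuous_id.prodMk hu)
  obtain ⟨K, hK, hKδ⟩ := mem_cocompact.1 (hu0.norm.eventually (gt_mem_nhds (by simpa using hδ)))
  obtain ⟨C, hC⟩ := hK.exists_bound_of_continuousOn hc.continuousOn
  have hi : MemLp (K.indicator fun _ => C) 2 (volume : Measure ℝ) :=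
    memLp_indicator_const 2 hK.measurableSet C (Or.inr hK.measure_lt_top.ne)
  refine (hu2.norm.add hi).mono' hc.aestronglyMeasurable (Eventually.of_forall fun t => ?_)
  by_cases ht : t ∈ K
  · have := hC t ht
    simp only [Pi.add_apply, Set.indicator_of_mem ht]
    linarith [norm_nonneg (u t)]
  · have := hgrad t (u t) (hKδ ht)
    simp only [Pi.add_apply, Set.indicator_of_notMem ht]
    linarith

theorem form_eq_inner {t : ℝ} (h : (L t).IsSymm) (x y : Vec n) :
    form L t x y = inner ℝ x ((L t).toEuclideanLin y) := by
  rw [form_comm h, form, real_inner_comm]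

theorem tendsto_integral_form (hL : Continuous L) (hs : ∀ t, (L t).IsSymm) {φ : ℕ → ℝ → Vec n}
    {u ψ : ℝ → Vec n} {b : ℝ} (hφ : ∀ k, IsTest (φ k)) (hb : ∀ k t, ‖φ k t‖ ≤ b)
    (hlim : ∀ t, Tendsto (fun k => φ k t) atTop (𝓝 (u t))) (hψ : IsTest ψ) :
    Tendsto (fun k => ∫ t, form L t (φ k t) (ψ t)) atTop (𝓝 (∫ t, form L t (u t) (ψ t))) := by
  have hi : Integrable fun t => ‖(L t).toEuclideanLin (ψ t)‖ := by
    refine (continuous_lin hL hψ.continuous).norm.integrable_of_hasCompactSupport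
      (hψ.2.mono fun t ht => ?_)
    contrapose! ht
    simp only [Function.mem_support, not_not] at ht ⊢
    rw [ht, map_zero, norm_zero]
  refine tendsto_integral_of_dominated_convergence
    (fun t => b * ‖(L t).toEuclideanLin (ψ t)‖)
    (fun k => (continuous_form hL (hφ k).continuous hψ.continuous).aestronglyMeasurable)
    (hi.const_mul b) (fun k => Eventually.of_forall fun t => ?_)
    (Eventually.of_forall fun t => ?_)
  · rw [form_eq_inner (hs t)]
    refine (norm_inner_le_norm _ _).trans ?_
    gcongr
    exact hb k t
  · simp only [form_eq_inner (hs t)]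
    exact (hlim t).inner tendsto_const_nhds

theorem tendsto_integral_grad (hW : ContDiff ℝ 1 (fun p : ℝ × Vec n => W p.1 p.2))
    {φ : ℕ → ℝ → Vec n} {u ψ : ℝ → Vec n} {b : ℝ} (hφ : ∀ k, IsTest (φ k))
    (hb : ∀ k t, ‖φ k t‖ ≤ b) (hlim : ∀ t, Tendsto (fun k => φ k t) atTop (𝓝 (u t)))
    (hψ : IsTest ψ) :
    Tendsto (fun k => ∫ t, inner ℝ (grad W t (φ k t)) (ψ t)) atTop
      (𝓝 (∫ t, inner ℝ (grad W t (u t)) (ψ t))) := by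
  obtain ⟨G, hG⟩ := (hψ.2.isCompact.prod (isCompact_closedBall (0 : Vec n) b)).exists_bound_of_continuousOn
    (continuous_grad hW).continuousOn
  have hi : Integrable fun t => ‖ψ t‖ :=
    hψ.continuous.norm.integrable_of_hasCompactSupport hψ.2.norm
  refine tendsto_integral_of_dominated_convergence (fun t => G * ‖ψ t‖)
    (fun k => (((continuous_grad hW).comp (continuous_id.prodMk (hφ k).continuous)).inner
      hψ.continuous).aestronglyMeasurable)
    (hi.const_mul G) (fun k => Eventually.of_forall fun t => ?_)
    (Eventually.of_forall fun t => ?_)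
  · by_cases ht : t ∈ tsupport ψ
    · refine (norm_inner_le_norm _ _).trans ?_
      gcongr
      exact hG (t, φ k t) ⟨ht, mem_closedBall_zero_iff.2 (hb k t)⟩
    · simp [image_eq_zero_of_notMem_tsupport ht]
  · exact ((((continuous_grad hW).comp (Continuous.prodMk_right t)).tendsto _).comp
      (hlim t)).inner tendsto_const_nhds

/-- A nonzero function in `X^α` which solves the equation against all test functions. -/
theorem exists_test_solution (hα : 1 / 2 < α) (hα' : α < 1) (h : Coercive L l c)
    (hW : ContDiff ℝ 1 (fun p : ℝ × Vec n => W p.1 p.2)) (h1 : CondW1 W)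
    {lam B θ : ℝ} (hlam : 1 ≤ lam) (hθ : 0 < θ) {φ ψ : ℕ → testSpace n}
    (hψ : ∀ f, tripleMap hα hα' h.continuous_L f ∈
      closure (Set.range fun j => tripleMap hα hα' h.continuous_L (ψ j)))
    (hφ : ∀ k, quad α L lam (φ k).1 ≤ B ∧ θ ≤ ∫ t in {t | l t < c}, ‖(φ k).1 t‖ ^ 2)
    (hcrit : ∀ k, ∀ j < k, energyBilin hα hα' h.continuous_L lam (φ k) (ψ j) =
      ∫ t, inner ℝ (grad W t ((φ k).1 t)) ((ψ j).1 t)) :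
    ∃ u v : ℝ → Vec n, MemX α L u v ∧ Continuous u ∧ MemLp (fun t => grad W t (u t)) 2 ∧
      ¬ (u =ᵐ[volume] 0) ∧ ∀ f, IsTest f → (∫ t, inner ℝ (v t) (leftDeriv α f t)) +
        lam * (∫ t, form L t (u t) (f t)) = ∫ t, inner ℝ (grad W t (u t)) (f t) := by
  have hL := h.continuous_L
  obtain ⟨C, hC, hemb⟩ := h.exists_embedding hα hα'
  have hlam0 : 0 ≤ lam := by linarith
  have hCB : ∀ k, C * quad α L lam (φ k).1 ≤ C * B := fun k => by
    have := (hφ k).1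
    gcongr
  have hsq : ∀ k t, ‖(φ k).1 t‖ ^ 2 ≤ C * B := fun k t => ((hemb lam hlam _ (φ k).2).2 t).trans (hCB k)
  have hsup : ∀ k t, ‖(φ k).1 t‖ ≤ Real.sqrt (C * B) := fun k t => Real.le_sqrt_of_sq_le (hsq k t)
  obtain ⟨g, u, v, hg, huv, huc, hu0, hlim, hweak⟩ := exists_weak_limit hα hα' (fun k => (φ k).2)
    (B := max (C * B) B)
    (fun k => (((hemb lam hlam _ (φ k).2).1).trans (hCB k)).trans (le_max_left _ _))
    (fun k => ((h.deriv_le_quad hlam0 _).trans (hφ k).1).trans (le_max_right _ _))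
  have hgL2 := memLp_grad hW h1 huc hu0 huv.1
  -- Nontriviality survives because constants are integrable on `{l < c}`: the sup bound dominates,
  -- and pointwise convergence is enough.
  have hmass : θ ≤ ∫ t in {t | l t < c}, ‖u t‖ ^ 2 := by
    refine ge_of_tendsto' (tendsto_integral_of_dominated_convergence
      (F := fun k t => ‖(φ (g k)).1 t‖ ^ 2) (fun _ => C * B)
      (fun k => ((IsTest.continuous (φ (g k)).2).norm.pow 2).aestronglyMeasurable)
      (integrableOn_const h.finite.ne)
      (fun k => Eventually.of_forall fun t => ?_)
      (Eventually.of_forall fun t => ((hlim t).norm.pow 2))) fun k => (hφ (g k)).2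
    rw [Real.norm_of_nonneg (sq_nonneg _)]
    exact hsq (g k) t
  have hform : Integrable fun t => form L t (u t) (u t) := by
    have hcont : ∀ k, Continuous fun t => form L t ((φ k).1 t) ((φ k).1 t) := fun k =>
      continuous_form hL (IsTest.continuous (φ k).2) (IsTest.continuous (φ k).2)
    have hle : ∀ k, ∫⁻ t, ‖form L t ((φ (g k)).1 t) ((φ (g k)).1 t)‖ₑ ≤ ENNReal.ofReal B := by
      intro k
      rw [← ofReal_integral_norm_eq_lintegral_enorm
        (integrable_form hL (IsTest.continuous (φ (g k)).2) (φ (g k)).2)]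
      simp only [Real.norm_of_nonneg (h.form_nonneg _ _)]
      refine ENNReal.ofReal_le_ofReal (le_trans ?_ (hφ (g k)).1)
      have i1 : 0 ≤ ∫ t, form L t ((φ (g k)).1 t) ((φ (g k)).1 t) :=
        integral_nonneg fun t => h.form_nonneg t _
      have i2 : 0 ≤ ∫ t, ‖leftDeriv α (φ (g k)).1 t‖ ^ 2 := integral_nonneg fun t => sq_nonneg _
      unfold quad
      nlinarith
    -- Fatou's lemma: the approximants have form integrals at most `B` because `λ ≥ 1`.
    refine integrable_of_tendsto (G := fun k t => form L t ((φ (g k)).1 t) ((φ (g k)).1 t))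
      (Eventually.of_forall fun t => ?_) (fun k => (hcont (g k)).aestronglyMeasurable) ?_
    · exact (((L t).toEuclideanLin.continuous_of_finiteDimensional.tendsto _).comp
        (hlim t)).inner (hlim t)
    · refine ne_top_of_le_ne_top ENNReal.ofReal_ne_top
        ((liminf_le_liminf (Eventually.of_forall hle)).trans (liminf_const _).le)
  have heq : ∀ j, (∫ t, inner ℝ (v t) (leftDeriv α (ψ j).1 t)) +
      lam * (∫ t, form L t (u t) ((ψ j).1 t)) = ∫ t, inner ℝ (grad W t (u t)) ((ψ j).1 t) := by
    intro j
    have t1 := hweak _ (leftDeriv_memLp hα hα' (ψ j).2)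
    have t2 := tendsto_integral_form hL h.symm (fun k => (φ (g k)).2) (fun k => hsup (g k)) hlim (ψ j).2
    have t3 := tendsto_integral_grad hW (fun k => (φ (g k)).2) (fun k => hsup (g k)) hlim (ψ j).2
    refine tendsto_nhds_unique (t1.add (t2.const_mul lam)) (t3.congr' ?_)
    filter_upwards [eventually_gt_atTop j] with k hk
    rw [← hcrit (g k) j (hk.trans_le (hg.id_le k)), energyBilin_apply]
  refine ⟨u, v, ⟨huv.memH hα hα', huv, hform⟩, huc, hgL2, fun hu => ?_, fun f hf => ?_⟩
  · have : ∫ t in {t | l t < c}, ‖u t‖ ^ 2 = 0 := by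
      refine integral_eq_zero_of_ae (ae_restrict_of_ae ?_)
      filter_upwards [hu] with t ht
      simp [ht]
    linarith
  · have hF : ∀ f : testSpace n,
        inner ℝ (huv.2.1.toLp v) (tripleMap hα hα' hL f).2.1 +
        lam * inner ℝ (huv.1.toLp u) (tripleMap hα hα' hL f).2.2 -
        inner ℝ (hgL2.toLp _) (tripleMap hα hα' hL f).1 =
        (∫ t, inner ℝ (v t) (leftDeriv α f.1 t)) +
        lam * (∫ t, form L t (u t) (f.1 t)) - ∫ t, inner ℝ (grad W t (u t)) (f.1 t) := by
      intro f
      simp only [form_eq_inner (h.symm _)]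
      rw [← inner_toLp huv.2.1 (leftDeriv_memLp hα hα' f.2), ← inner_toLp huv.1 (memLp_lin hL f.2),
        ← inner_toLp hgL2 (IsTest.memLp f.2 2)]
      rfl
    -- The equation is a closed condition on the triple, so it passes from the dense sequence to
    -- every test function.
    set Z : Set (LTwo n × LTwo n × LTwo n) := {p | inner ℝ (huv.2.1.toLp v) p.2.1 +
      lam * inner ℝ (huv.1.toLp u) p.2.2 - inner ℝ (hgL2.toLp _) p.1 = 0} with hZ
    have hZc : IsClosed Z := isClosed_eq (by fun_prop) continuous_const
    have hsub : (Set.range fun j => tripleMap hα hα' hL (ψ j)) ⊆ Z := by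
      rintro _ ⟨j, rfl⟩
      simp only [hZ, Set.mem_ofPred_eq]
      rw [hF, heq, sub_self]
    have hmem := closure_minimal hsub hZc (hψ ⟨f, hf⟩)
    simp only [hZ, Set.mem_ofPred_eq] at hmem
    rw [hF, sub_eq_zero] at hmem
    exact hmem

end FracHam

/-! ### Extension of the equation to the whole space -/

namespace FracHam

variable {n : ℕ} {α : ℝ} {L : ℝ → Matrix (Fin n) (Fin n) ℝ} {l : ℝ → ℝ} {c : ℝ}
  {W : ℝ → Vec n → ℝ}

theorem integrable_inner_of_memLp {u v : ℝ → Vec n} (hu : MemLp u 2) (hv : MemLp v 2) :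
    Integrable fun t => inner ℝ (u t) (v t) := by
  refine (L2.integrable_inner (𝕜 := ℝ) (hu.toLp u) (hv.toLp v)).congr ?_
  filter_upwards [hu.coeFn_toLp, hv.coeFn_toLp] with t ht ht'
  rw [ht, ht']

theorem integral_inner_sq_le {u v : ℝ → Vec n} (hu : MemLp u 2) (hv : MemLp v 2) :
    (∫ t, inner ℝ (u t) (v t)) ^ 2 ≤ (∫ t, ‖u t‖ ^ 2) * ∫ t, ‖v t‖ ^ 2 := by
  rw [← inner_toLp hu hv, ← norm_toLp_sq hu, ← norm_toLp_sq hv, ← mul_pow, ← sq_abs]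
  gcongr
  exact abs_real_inner_le_norm _ _

theorem tendsto_integral_inner {p w : ℝ → Vec n} {φ : ℕ → ℝ → Vec n} (hp : MemLp p 2)
    (hw : MemLp w 2) (hφ : ∀ k, MemLp (φ k) 2)
    (h : Tendsto (fun k => ∫ t, ‖φ k t - w t‖ ^ 2) atTop (𝓝 0)) :
    Tendsto (fun k => ∫ t, inner ℝ (p t) (φ k t)) atTop (𝓝 (∫ t, inner ℝ (p t) (w t))) := by
  have h1 : ∀ k, ((∫ t, inner ℝ (p t) (φ k t)) - ∫ t, inner ℝ (p t) (w t)) ^ 2 ≤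
      (∫ t, ‖p t‖ ^ 2) * ∫ t, ‖φ k t - w t‖ ^ 2 := fun k => by
    rw [← integral_sub (integrable_inner_of_memLp hp (hφ k)) (integrable_inner_of_memLp hp hw)]
    simp only [← inner_sub_right]
    exact integral_inner_sq_le hp ((hφ k).sub hw)
  have h2 := h.const_mul (∫ t, ‖p t‖ ^ 2)
  rw [mul_zero] at h2
  have h3 := squeeze_zero (fun k => sq_nonneg _) h1 h2
  rw [tendsto_iff_norm_sub_tendsto_zero]
  have h4 := h3.sqrt
  simpa [Real.sqrt_sq_eq_abs] using h4

theorem memLp_cutoff_smul {m : ℝ} (hm : 0 < m) {p : ℝ → Vec n} (hp : Continuous p) :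
    MemLp (fun t => cutoff m t • p t) 2 :=
  ((cutoff_contDiff m).continuous.smul hp).memLp_of_hasCompactSupport
    (HasCompactSupport.smul_right (f := cutoff m) (cutoff_hasCompactSupport hm))

theorem IsTest.exists_cutoff_eq {φ : ℝ → Vec n} (h : IsTest φ) :
    ∃ m₀ ≥ (1 : ℝ), ∀ m ≥ m₀, (fun t => cutoff m t • φ t) = φ := by
  obtain ⟨r, hr⟩ := h.2.isCompact.isBounded.subset_closedBall 0
  refine ⟨max 1 r, le_max_left _ _, fun m hm => funext fun t => ?_⟩
  have hm1 : 0 < m := one_pos.trans_le ((le_max_left _ _).trans hm)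
  by_cases ht : t ∈ tsupport φ
  · have := hr ht
    rw [mem_closedBall_zero_iff, Real.norm_eq_abs] at this
    rw [cutoff_eq_one hm1 (this.trans ((le_max_right _ _).trans hm)), one_smul]
  · rw [image_eq_zero_of_notMem_tsupport ht, smul_zero]

/-- An equation tested against test functions extends to all functions in the domain of the closure
of `D^α` for which it makes sense. -/
theorem integral_inner_add_eq_zero (hα : 1 / 2 < α) (hα' : α < 1) {v p w z : ℝ → Vec n}
    (hv : MemLp v 2) (hp : Continuous p) (hwz : HasLeftDeriv α w z)
    (hpw : Integrable fun t => inner ℝ (p t) (w t))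
    (h : ∀ f, IsTest f → (∫ t, inner ℝ (v t) (leftDeriv α f t)) + ∫ t, inner ℝ (p t) (f t) = 0) :
    (∫ t, inner ℝ (v t) (z t)) + ∫ t, inner ℝ (p t) (w t) = 0 := by
  obtain ⟨hw, hz, φ, hφ, h1, h2⟩ := hwz
  have hD : ∀ {f : ℝ → Vec n}, IsTest f → MemLp (leftDeriv α f) 2 := fun hf => leftDeriv_memLp hα hα' hf
  have hL2 : ∀ k, MemLp (φ k) 2 := fun k => (hφ k).memLp 2
  replace h1 := (tendsto_eLpNorm_iff fun k => (hL2 k).sub hw).1 h1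
  replace h2 := (tendsto_eLpNorm_iff fun k => (hD (hφ k)).sub hz).1 h2
  simp only [Pi.sub_apply] at h1 h2
  obtain ⟨C, hC, hcut⟩ := exists_cutoff_vec n hα hα'
  set P := ∫ t, inner ℝ (v t) (z t) with hP
  set V := ∫ t, ‖v t‖ ^ 2 with hV
  have hV0 : 0 ≤ V := integral_nonneg fun _ => sq_nonneg _
  set A : ℝ → ℝ := fun m => ∫ t, inner ℝ (cutoff m t • p t) (w t) with hA
  have hAlim : Tendsto A atTop (𝓝 (∫ t, inner ℝ (p t) (w t))) := by
    refine tendsto_integral_filter_of_dominated_convergence (fun t => ‖inner ℝ (p t) (w t)‖)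
      (Eventually.of_forall fun m => ?_) (Eventually.of_forall fun m => ?_) hpw.norm ?_
    · exact (((cutoff_contDiff m).continuous.smul hp).aestronglyMeasurable).inner hw.1
    · refine Eventually.of_forall fun t => ?_
      rw [real_inner_smul_left, norm_mul, Real.norm_of_nonneg (cutoff_nonneg m t)]
      exact mul_le_of_le_one_left (norm_nonneg _) (cutoff_le_one m t)
    · refine Eventually.of_forall fun t => tendsto_const_nhds.congr' ?_
      filter_upwards [eventually_gt_atTop |t|] with m hm
      rw [cutoff_eq_one ((abs_nonneg t).trans_lt hm) hm.le, one_smul]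
  -- Order of limits: `i` fixes the accuracy `ε`, then `m` is taken beyond the support of `φ i`,
  -- then `j → ∞`; afterwards `m → ∞` and finally `ε → 0`. The cutoff makes `χ_m p` square
  -- integrable, as `p` itself need not be.
  have hsmall : ∀ ε > 0, ∀ᶠ m in atTop, (P + A m) ^ 2 ≤ V * ((16 * C + 2) * ε) := by
    intro ε hε
    obtain ⟨i, hi⟩ := eventually_atTop.1 ((h1.eventually (gt_mem_nhds hε)).and
      (h2.eventually (gt_mem_nhds hε)))
    obtain ⟨m₀, hm₀, hcutm⟩ := (hφ i).exists_cutoff_eq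
    filter_upwards [eventually_ge_atTop m₀] with m hm
    have hm1 : 1 ≤ m := hm₀.trans hm
    have hlim := (tendsto_integral_inner (memLp_cutoff_smul (one_pos.trans_le hm1) hp) hw hL2
      h1).const_add P
    refine le_of_tendsto (hlim.pow 2) ?_
    filter_upwards [eventually_ge_atTop i] with j hj
    have hf : IsTest fun t => cutoff m t • φ j t := (hφ j).cutoff_smul
    have e1 : P + ∫ t, inner ℝ (cutoff m t • p t) (φ j t) =
        ∫ t, inner ℝ (v t) (z t - leftDeriv α (fun t => cutoff m t • φ j t) t) := by
      simp only [inner_sub_right]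
      rw [integral_sub (integrable_inner_of_memLp hv hz) (integrable_inner_of_memLp hv (hD hf)),
        eq_neg_of_add_eq_zero_left (h _ hf)]
      simp only [real_inner_smul_left, real_inner_smul_right]
      ring
    rw [e1]
    refine (integral_inner_sq_le hv (hz.sub (hD hf))).trans ?_
    refine mul_le_mul_of_nonneg_left ?_ hV0
    have hψ := (hφ j).sub (hφ i)
    have hψc : IsTest fun t => cutoff m t • (φ j - φ i) t := hψ.cutoff_smul
    have e2 : ∀ t, z t - leftDeriv α (fun t => cutoff m t • φ j t) t =
        (z - leftDeriv α (φ i)) t - leftDeriv α (fun t => cutoff m t • (φ j - φ i) t) t := by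
      intro t
      -- The cutoff acts only on the small difference `φ j - φ i`, so the uniform bound suffices:
      -- the error is at most `2ε + 2C(4ε + 4ε)`.
      have e3 : (fun t => cutoff m t • φ j t) =
          φ i + fun t => cutoff m t • (φ j - φ i) t := by
        ext t : 1
        have e0 : cutoff m t • φ i t = φ i t := congrFun (hcutm m hm) t
        simp [smul_sub, e0]
      rw [e3, leftDeriv_add hα' (hφ i) hψc]
      simp only [Pi.add_apply, Pi.sub_apply]
      abel
    have e4 : ∫ t, ‖(z - leftDeriv α (φ i)) t‖ ^ 2 ≤ ε := by
      simp only [Pi.sub_apply, norm_sub_rev (z _)]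
      exact (hi i le_rfl).2.le
    have e5 : ∫ t, ‖(φ j - φ i) t‖ ^ 2 ≤ 4 * ε := by
      have := integral_sub_sq_le ((hL2 j).sub hw) ((hL2 i).sub hw)
      simp only [Pi.sub_apply, sub_sub_sub_cancel_right] at this
      simp only [Pi.sub_apply]
      linarith [(hi j hj).1, (hi i le_rfl).1]
    have e6 : ∫ t, ‖leftDeriv α (φ j - φ i) t‖ ^ 2 ≤ 4 * ε := by
      have := integral_sub_sq_le ((hD (hφ j)).sub hz) ((hD (hφ i)).sub hz)
      simp only [Pi.sub_apply, sub_sub_sub_cancel_right] at this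
      rw [leftDeriv_sub hα' (hφ j) (hφ i)]
      simp only [Pi.sub_apply]
      linarith [(hi j hj).2, (hi i le_rfl).2]
    have e7 := hcut m hm1 _ hψ
    have e8 : C * ((∫ t, ‖(φ j - φ i) t‖ ^ 2) + ∫ t, ‖leftDeriv α (φ j - φ i) t‖ ^ 2) ≤
        C * (4 * ε + 4 * ε) := by gcongr
    have e9 := integral_sub_sq_le (hz.sub (hD (hφ i))) (hD hψc)
    calc _ = ∫ t, ‖(z - leftDeriv α (φ i)) t -
          leftDeriv α (fun t => cutoff m t • (φ j - φ i) t) t‖ ^ 2 :=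
        integral_congr_ae (Eventually.of_forall fun t => congrArg (fun y => ‖y‖ ^ 2) (e2 t))
      _ ≤ _ := by linarith
  have hlim2 : Tendsto (fun m => (P + A m) ^ 2) atTop (𝓝 ((P + ∫ t, inner ℝ (p t) (w t)) ^ 2)) :=
    (hAlim.const_add P).pow 2
  have hle : ∀ ε > 0, (P + ∫ t, inner ℝ (p t) (w t)) ^ 2 ≤ V * ((16 * C + 2) * ε) :=
    fun ε hε => le_of_tendsto hlim2 (hsmall ε hε)
  have hle0 : (P + ∫ t, inner ℝ (p t) (w t)) ^ 2 ≤ 0 := by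
    have ht : Tendsto (fun ε : ℝ => V * ((16 * C + 2) * ε)) (𝓝[>] 0)
        (𝓝 (V * ((16 * C + 2) * 0))) :=
      ((continuous_const.mul (continuous_const.mul continuous_id)).tendsto 0).mono_left
        nhdsWithin_le_nhds
    rw [mul_zero, mul_zero] at ht
    exact ge_of_tendsto ht (eventually_mem_nhdsWithin.mono hle)
  exact pow_eq_zero_iff two_ne_zero |>.1 (le_antisymm hle0 (sq_nonneg _))

/-- Nonnegativity of the form at `x ± y`. It makes `(Lu, w)` integrable from the finiteness of
`∫(Lu,u)` and `∫(Lw,w)`. -/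
theorem Coercive.abs_form_le (h : Coercive L l c) (t : ℝ) (x y : Vec n) :
    |form L t x y| ≤ 1 / 2 * (form L t x x + form L t y y) := by
  have h1 := h.form_nonneg t (x + y)
  have h2 := h.form_nonneg t (x + (-1 : ℝ) • y)
  simp only [form_add_left, form_add_right, form_smul_left, form_smul_right] at h1 h2
  rw [form_comm (h.symm t) y x] at h1 h2
  exact abs_le.2 ⟨by linarith, by linarith⟩

theorem Coercive.isSolution (hα : 1 / 2 < α) (hα' : α < 1) (h : Coercive L l c)
    (hW : ContDiff ℝ 1 (fun p : ℝ × Vec n => W p.1 p.2)) {lam : ℝ} {u v : ℝ → Vec n}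
    (huv : MemX α L u v) (hu : Continuous u) (hg : MemLp (fun t => grad W t (u t)) 2)
    (heq : ∀ f, IsTest f → (∫ t, inner ℝ (v t) (leftDeriv α f t)) +
      lam * (∫ t, form L t (u t) (f t)) = ∫ t, inner ℝ (grad W t (u t)) (f t)) :
    IsSolution α L W lam u := by
  refine ⟨v, huv, fun w z hwz => ?_⟩
  have hLu := continuous_lin h.continuous_L hu
  have hgc : Continuous fun t => grad W t (u t) := (continuous_grad hW).comp (continuous_id.prodMk hu)
  have hgw := integrable_inner_of_memLp hg hwz.1.1
  have hvz := integrable_inner_of_memLp huv.2.1.2.1 hwz.2.1.2.1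
  have hform : Integrable fun t => form L t (u t) (w t) :=
    ((huv.2.2.add hwz.2.2).const_mul (1 / 2)).mono' (hLu.aestronglyMeasurable.inner hwz.1.1.1)
      (Eventually.of_forall fun t => h.abs_form_le t _ _)
  have hdiff : Integrable fun t => lam * form L t (u t) (w t) - inner ℝ (grad W t (u t)) (w t) :=
    (hform.const_mul lam).sub hgw
  refine ⟨hgw, (hvz.add (hform.const_mul lam)).sub hgw, ?_⟩
  -- All terms of order zero are gathered in one continuous function, of which only the
  -- integrability of its pairing with `w` is required.
  set p : ℝ → Vec n := fun t => lam • (L t).toEuclideanLin (u t) - grad W t (u t) with hp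
  have hpi : ∀ (t : ℝ) (y : Vec n), inner ℝ (p t) y =
      lam * form L t (u t) y - inner ℝ (grad W t (u t)) y := fun t y => by
    rw [hp, inner_sub_left, real_inner_smul_left]
    rfl
  have hmain := integral_inner_add_eq_zero hα hα' huv.2.1.2.1 (p := p)
    ((hLu.const_smul lam).sub hgc) hwz.2.1
    (by simpa only [hpi] using hdiff) fun f hf => by
      simp only [hpi]
      rw [integral_sub ((integrable_form h.continuous_L hu hf).const_mul lam)
        (integrable_inner_of_memLp hg (hf.memLp 2)), integral_const_mul, ← heq f hf]
      ring
  simp only [hpi] at hmain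
  rw [← integral_add hvz hdiff] at hmain
  simpa only [add_sub_assoc] using! hmain

end FracHam

theorem theorem1p1 (n : ℕ) (hn : 0 < n) (α : ℝ) (hα : 1 / 2 < α) (hα' : α < 1)
    (L : ℝ → Matrix (Fin n) (Fin n) ℝ) (l : ℝ → ℝ) (c : ℝ)
    (hL1 : FracHam.CondL1 α L l c) (hL2 : FracHam.CondL2 l) (hL3 : FracHam.CondL3 L l)
    (W : ℝ → FracHam.Vec n → ℝ)
    (hW : ContDiff ℝ 1 (fun p : ℝ × FracHam.Vec n => W p.1 p.2))
    (hW1 : FracHam.CondW1 W) (hW2 : FracHam.CondW2 W) (hW3 : FracHam.CondW3 W)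
    (hW4 : FracHam.CondW4 W) :
    ∃ Lam : ℝ, 0 < Lam ∧ ∀ lam : ℝ, Lam < lam →
      ∃ u : ℝ → FracHam.Vec n, FracHam.MemH α u ∧ ¬ (u =ᵐ[volume] 0) ∧
        FracHam.IsSolution α L W lam u := by
  have h := hL1.coercive
  obtain ⟨ψ, hψ⟩ := FracHam.exists_dense_testSeq (n := n) hα hα' h.continuous_L
  obtain ⟨Lam, hLam, hseq⟩ := FracHam.exists_critical_seq hn hα hα' h hL3 hW hW1 hW2 hW3 hW4 ψ
  refine ⟨Lam, by linarith, fun lam hlam => ?_⟩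
  obtain ⟨B, θ, φ, hθ, hφ, hcrit⟩ := hseq lam hlam
  obtain ⟨u, v, hX, hu, hg, hne, heq⟩ := FracHam.exists_test_solution hα hα' h hW hW1
    (hLam.trans hlam.le) hθ hψ hφ hcrit
  exact ⟨u, hX.1, hne, h.isSolution hα hα' hW hX hu hg heq⟩
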